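/- **Setting.** Write $\xi=(\xi_1,\xi')\in\mathbb R\times\mathbb R^2$, $\mathbb R^3_\pm=\{\pm\xi_1>0\}$, $\mathbb R_+=(0,\infty)$, and let $\chi$ be the indicator function of $\{s>0\}$. Let $n_e\in C^2(\mathbb R)$ with $n_e(0)=1$, $n_e'(0)=-1$; let $\varphi\in C_0^\infty(\mathbb R^3)$ with $\varphi\ge 0$, $\operatorname{supp}\varphi\subset\{|\xi|<1\}$, $\int\varphi\,d\xi=1$; let $\alpha\in[0,1]$ with $\alpha\neq 1$, and let $m_b\ge 0$, $m_\infty,v_b,v_\infty>0$ satisfy $$m_b+(1+\alpha)m_\infty=1,\qquad m_bv_b^{-2}+(1+\alpha)m_\infty v_\infty^{-2}<1.$$ For $\varepsilon>0$ and $\phi_b\in\mathbb R$ put $$g_{b,\varepsilon}(\xi)=\frac{m_b}{\varepsilon^3}\,\varphi\Big(\frac{(\sqrt{\xi_1^2-2\phi_b},\xi')-(v_b,0,0)}{\varepsilon}\Big)\chi(\xi_1^2-2\phi_b),\quad \xi\in\mathbb R^3_+,$$ $$g_{\infty,\varepsilon}(\xi)=\frac{m_\infty}{\varepsilon^3}\varphi\Big(\frac{\xi-(-v_\infty,0,0)}{\varepsilon}\Big)+\frac{m_b}{\varepsilon^3}\varphi\Big(\frac{\xi-(v_b,0,0)}{\varepsilon}\Big)+\alpha\frac{m_\infty}{\varepsilon^3}\varphi\Big(\frac{(-\xi_1,\xi')+(v_\infty,0,0)}{\varepsilon}\Big).$$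 **Vlasov–Poisson problem.** A solution with data $(f_b,f_\infty,\phi_b)$ is a pair $(f,\phi)$ such that (i) $f\in L^1_{loc}(\overline{\mathbb R_+}\times\mathbb R^3)\cap C(\overline{\mathbb R_+};L^1(\mathbb R^3))$, $\phi\in C^1(\overline{\mathbb R_+})\cap C^2(\mathbb R_+)$; (ii) $f\ge 0$, and either $\partial_x\phi>0$ on $\overline{\mathbb R_+}$ or $\partial_x\phi<0$ on $\overline{\mathbb R_+}$; (iii) for all $\psi\in C^1_0(\overline{\mathbb R_+}\times\mathbb R^3)$ with $\alpha\psi(0,\xi_1,\xi')=\psi(0,-\xi_1,\xi')$ for $\xi_1>0$, $$\int_{\mathbb R_+\times\mathbb R^3} f\,(\xi_1\partial_x\psi+\partial_x\phi\,\partial_{\xi_1}\psi)\,dx\,d\xi+\int_{\mathbb R^3_+}f_b(\xi)\,\xi_1\psi(0,\xi)\,d\xi=0,$$ and $\|f(x,\cdot)-f_\infty\|_{L^1(\mathbb R^3)}\to 0$ as $x\to\infty$; (iv) $\partial_{xx}\phi=\int_{\mathbb R^3}f\,d\xi-n_e(\phi)$ for $x>0$, $\phi(0)=\phi_b$, and $\phi(x)\to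 0$ as $x\to\infty$. **Theorem.** There exist positive constants $\varepsilon_0,\delta_0,C_0$, independent of $\phi_b$ and $\varepsilon$, such that for every $\phi_b\ne 0$ with $|\phi_b|<\delta_0$ the following hold. 1. The reduced problem $$\partial_{xx}\phi=\frac{m_bv_b}{\sqrt{v_b^2+2\phi}}+\frac{(1+\alpha)m_\infty v_\infty}{\sqrt{v_\infty^2+2\phi}}-n_e(\phi)\quad (x>0),\qquad \phi(0)=\phi_b,\qquad \lim_{x\to\infty}\phi(x)=0$$ has a unique monotone solution $\phi\in C^2(\overline{\mathbb R_+})$ (with $v_b^2+2\phi>0$, $v_\infty^2+2\phi>0$). Set $$\rho=\frac{m_bv_b}{\sqrt{v_b^2+2\phi}}+\frac{(1+\alpha)m_\infty v_\infty}{\sqrt{v_\infty^2+2\phi}},\qquad u=\frac{m_bv_b+(\alpha-1)m_\infty v_\infty}{\rho}.$$ 2. For every $\varepsilon\in(0,\varepsilon_0)$ the Vlasov–Poisson problem with $(f_b,f_\infty)=(g_{b,\varepsilon},g_{\infty,\varepsilon})$ has a unique solution $(f_\varepsilon,\phi_\varepsilon)$. Its moments $\rho_\varepsilon=\int f_\varepsilon\,d\xi>0$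 and $u_\varepsilon=\rho_\varepsilon^{-1}\int\xi_1f_\varepsilon\,d\xi$ are well defined for $x>0$, and $$\sup_{x>0}|\rho_\varepsilon-\rho|+\sup_{x>0}|\rho_\varepsilon u_\varepsilon-\rho u|+\sup_{x>0}|\phi_\varepsilon-\phi|\le C_0\varepsilon .$$ 3. If $m_b=0$, then $(\rho,u,\phi)$ solves the hydrodynamic model with reflection $$(\rho u)'=0,\qquad \frac{(\alpha+1)^2}{(\alpha-1)^2}\,uu'=\phi',\qquad \phi''=\rho-n_e(\phi)\qquad (x>0),$$ $$\inf_{x>0}\rho>0,\qquad \lim_{x\to\infty}(\rho,u,\phi)(x)=\Big(1,\frac{\alpha-1}{\alpha+1}v_\infty,0\Big),\qquad \phi(0)=\phi_b.$$ -/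

import Mathlib

open Set Filter Topology MeasureTheory
open scoped ContDiff ENNReal

noncomputable section

namespace Sheath

/-- Velocities `ξ = (ξ₁, ξ') ∈ ℝ × ℝ²`. The measure on this type is the Lebesgue measure of `ℝ³`;
its (sup) norm is used nowhere below except through the topology and the smooth structure. -/
abbrev Vel : Type := ℝ × (ℝ × ℝ)

/-- The indicator function of `{s > 0}`. -/
def chi (s : ℝ) : ℝ := (Ioi (0 : ℝ)).indicator (fun _ => 1) s

/-- A nonnegative smooth function of unit mass on `ℝ³`, supported in the open Euclidean
unit ball. -/
structure IsMollifier (η : Vel → ℝ) : Prop where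
  smooth : ContDiff ℝ ∞ η
  nonneg : ∀ ξ, 0 ≤ η ξ
  support_subset : tsupport η ⊆ {ξ | ξ.1 ^ 2 + ξ.2.1 ^ 2 + ξ.2.2 ^ 2 < 1}
  integral_eq_one : ∫ ξ, η ξ = 1

/-- The mollified boundary datum `g_{b,ε}`. -/
def gb (η : Vel → ℝ) (mb vb φb ε : ℝ) (ξ : Vel) : ℝ :=
  mb / ε ^ 3 * η (ε⁻¹ • ((√(ξ.1 ^ 2 - 2 * φb), ξ.2) - (vb, 0))) * chi (ξ.1 ^ 2 - 2 * φb)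

/-- The mollified datum at infinity `g_{∞,ε}`. -/
def ginf (η : Vel → ℝ) (α mb minf vb vinf ε : ℝ) (ξ : Vel) : ℝ :=
  minf / ε ^ 3 * η (ε⁻¹ • (ξ - (-vinf, 0)))
    + mb / ε ^ 3 * η (ε⁻¹ • (ξ - (vb, 0)))
    + α * (minf / ε ^ 3) * η (ε⁻¹ • ((-ξ.1, ξ.2) + (vinf, 0)))

/-- Test functions: `C¹` with compact support in `[0, ∞) × ℝ³` (written as restrictions of `C¹`
functions with compact support in `ℝ × ℝ³`; only the values at `x ≥ 0` are ever used), subject to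
`α ψ(0, ξ₁, ξ') = ψ(0, -ξ₁, ξ')` for `ξ₁ > 0`. -/
structure IsTest (α : ℝ) (ψ : ℝ × Vel → ℝ) : Prop where
  contDiff : ContDiff ℝ 1 ψ
  compactSupport : HasCompactSupport ψ
  reflect : ∀ ξ : Vel, 0 < ξ.1 → α * ψ (0, ξ) = ψ (0, (-ξ.1, ξ.2))

/-- The partial derivative `∂ₓ ψ`. -/
def dx (ψ : ℝ × Vel → ℝ) (p : ℝ × Vel) : ℝ := fderiv ℝ ψ p (1, 0)

/-- The partial derivative `∂ψ / ∂ξ₁`. -/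
def dxi (ψ : ℝ × Vel → ℝ) (p : ℝ × Vel) : ℝ := fderiv ℝ ψ p (0, (1, 0))

/-- `(f, φ)` is a solution of the stationary Vlasov-Poisson boundary value problem on the half line
`x > 0` with electron density `ne`, reflection rate `α`, boundary data `fb`, `φb` and datum at
infinity `finf`. Only the values of `f` and `φ` at `x ≥ 0` matter. -/
structure IsVPSolution (ne : ℝ → ℝ) (α φb : ℝ) (fb finf : Vel → ℝ)
    (f : ℝ × Vel → ℝ) (φ : ℝ → ℝ) : Prop where
  /-- `f ∈ L¹_loc([0, ∞) × ℝ³)` -/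
  locallyIntegrable : LocallyIntegrableOn f (Ici (0 : ℝ) ×ˢ (univ : Set Vel))
  /-- `f(x, ·) ∈ L¹(ℝ³)` for every `x ≥ 0` -/
  integrable_slice : ∀ x : ℝ, 0 ≤ x → Integrable fun ξ => f (x, ξ)
  /-- `x ↦ f(x, ·)` is continuous from `[0, ∞)` to `L¹(ℝ³)` -/
  continuous_slice : ∀ x₀ : ℝ, 0 ≤ x₀ →
    Tendsto (fun x => eLpNorm (fun ξ => f (x, ξ) - f (x₀, ξ)) 1 volume) (𝓝[Ici 0] x₀) (𝓝 0)
  /-- `φ ∈ C¹([0, ∞))` -/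
  contDiff_one : ContDiffOn ℝ 1 φ (Ici 0)
  /-- `φ ∈ C²((0, ∞))` -/
  contDiff_two : ContDiffOn ℝ 2 φ (Ioi 0)
  nonneg : ∀ x : ℝ, 0 ≤ x → ∀ᵐ ξ : Vel, 0 ≤ f (x, ξ)
  /-- `∂ₓφ > 0` on `[0, ∞)` or `∂ₓφ < 0` on `[0, ∞)` -/
  monotone : (∀ x : ℝ, 0 ≤ x → 0 < derivWithin φ (Ici 0) x) ∨
    (∀ x : ℝ, 0 ≤ x → derivWithin φ (Ici 0) x < 0)
  /-- weak form of the Vlasov equation with the boundary condition at the wall -/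
  weak : ∀ ψ : ℝ × Vel → ℝ, IsTest α ψ →
    (∫ p in Ioi (0 : ℝ) ×ˢ (univ : Set Vel),
        f p * (p.2.1 * dx ψ p + deriv φ p.1 * dxi ψ p))
      + ∫ ξ in {ξ : Vel | 0 < ξ.1}, fb ξ * (ξ.1 * ψ (0, ξ)) = 0
  tendsto_finf : Tendsto (fun x => eLpNorm (fun ξ => f (x, ξ) - finf ξ) 1 volume) atTop (𝓝 0)
  /-- the Poisson equation, in the classical sense -/
  poisson : ∀ x : ℝ, 0 < x → iteratedDeriv 2 φ x = (∫ ξ, f (x, ξ)) - ne (φ x)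
  boundary : φ 0 = φb
  tendsto_zero : Tendsto φ atTop (𝓝 0)

/-- The density `∫ f(x, ξ) dξ`. -/
def density (f : ℝ × Vel → ℝ) (x : ℝ) : ℝ := ∫ ξ, f (x, ξ)

/-- The mean velocity `(∫ ξ₁ f(x, ξ) dξ) / ρ(x)`. -/
def meanVel (f : ℝ × Vel → ℝ) (x : ℝ) : ℝ := 1 / density f x * ∫ ξ : Vel, ξ.1 * f (x, ξ)

/-- The ion density of the reduced problem as a function of the value `s` of the potential. -/
def ionDensity (α mb minf vb vinf s : ℝ) : ℝ :=
  mb * vb / √(vb ^ 2 + 2 * s) + (1 + α) * minf * vinf / √(vinf ^ 2 + 2 * s)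

/-- `φ ∈ C²([0, ∞))` is a monotone solution of the reduced boundary value problem. -/
structure IsReducedSolution (ne : ℝ → ℝ) (α mb minf vb vinf φb : ℝ) (φ : ℝ → ℝ) : Prop where
  contDiff : ContDiffOn ℝ 2 φ (Ici 0)
  monotone : MonotoneOn φ (Ici 0) ∨ AntitoneOn φ (Ici 0)
  /-- the square roots in the equation are those of positive numbers -/
  domain : ∀ x : ℝ, 0 ≤ x → 0 < vb ^ 2 + 2 * φ x ∧ 0 < vinf ^ 2 + 2 * φ x
  equation : ∀ x : ℝ, 0 < x →
    iteratedDeriv 2 φ x = ionDensity α mb minf vb vinf (φ x) - ne (φ x)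
  boundary : φ 0 = φb
  tendsto_zero : Tendsto φ atTop (𝓝 0)

/-- The limit density `ρ`. -/
def limDensity (α mb minf vb vinf : ℝ) (φ : ℝ → ℝ) (x : ℝ) : ℝ :=
  ionDensity α mb minf vb vinf (φ x)

/-- The limit velocity `u`. -/
def limVel (α mb minf vb vinf : ℝ) (φ : ℝ → ℝ) (x : ℝ) : ℝ :=
  (mb * vb + (α - 1) * minf * vinf) / limDensity α mb minf vb vinf φ x

/-- `(ρ, u, φ)` solves the hydrodynamic model which accounts for the reflection of ions at
the wall. -/
structure IsHydroSolution (ne : ℝ → ℝ) (α vinf φb : ℝ) (ρ u φ : ℝ → ℝ) : Prop where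
  diff_density : ∀ x : ℝ, 0 < x → DifferentiableAt ℝ ρ x
  diff_vel : ∀ x : ℝ, 0 < x → DifferentiableAt ℝ u x
  contDiff : ContDiffOn ℝ 2 φ (Ioi 0)
  continuousOn : ContinuousOn φ (Ici 0)
  mass : ∀ x : ℝ, 0 < x → deriv (fun y => ρ y * u y) x = 0
  momentum : ∀ x : ℝ, 0 < x → (α + 1) ^ 2 / (α - 1) ^ 2 * (u x * deriv u x) = deriv φ x
  poisson : ∀ x : ℝ, 0 < x → iteratedDeriv 2 φ x = ρ x - ne (φ x)
  /-- `inf ρ > 0` -/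
  inf_pos : ∃ c : ℝ, 0 < c ∧ ∀ x : ℝ, 0 < x → c ≤ ρ x
  tendsto_density : Tendsto ρ atTop (𝓝 1)
  tendsto_vel : Tendsto u atTop (𝓝 ((α - 1) / (α + 1) * vinf))
  tendsto_zero : Tendsto φ atTop (𝓝 0)
  boundary : φ 0 = φb

/-- `sup_{x > 0} |a(x) - b(x)|`, as an element of `[0, ∞]`. -/
def supDist (a b : ℝ → ℝ) : ℝ≥0∞ := ⨆ x ∈ Ioi (0 : ℝ), ENNReal.ofReal |a x - b x|

end Sheath

end

/-! The particle energy `ξ₁² - 2φ(x)` is conserved, so for a prescribed monotone potential the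
kinetic equation can be solved explicitly. Ions are labelled by the velocity they have where the
potential vanishes. Left-moving ions carry the profile `incoming` fixed at infinity. Reflection at
the wall preserves energy, so right-moving ions carry `outgoing`, that is `injected` plus `α` times
`incoming`. Hence the distribution at `x` depends on `x` only through `φ(x)`; it is
`ionDistribution`. When `ε` and `φ_b` are small the beams stay away from zero velocity, and all
these formulas are regular.

Conversely, every solution has this form (`IsVPSolution.ae_eq_ionDistribution`). The difference `D`
of a solution and `ionDistribution` solves a homogeneous linear problem and tends to zero at
infinity. Where `ξ₁² > 2φ`, energy-dependent test functions show that `D` is carried unchanged out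
to infinity, where it vanishes. Where `ξ₁² < 2φ`, ions bounce between the wall and a turning point
and lose the fraction `1 - α > 0` at each return. There the explicit solution is zero, so `D ≥ 0`,
and a test function adapted to the reflection law turns this loss into the vanishing of a
nonnegative integral.

Poisson's equation thereby becomes the scalar equation `φ'' = ρ_ε(φ) - n_e(φ)` with `ρ_ε` given by
`smoothDensity`; the reduced problem is the same equation with `ionDensity`. Bohm's inequality says
exactly that the right-hand side has positive slope at the origin. Strict differentiability makes
this bound uniform for small velocity perturbations, hence for all small `ε`
(`exists_density_constants`). Energy quadrature gives existence
(`exists_decaying_solution_of_local`). A maximum principle gives uniqueness and stability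
(`abs_sub_le_of_ode`): right-hand sides that differ by `O(ε)` have solutions that differ by `O(ε)`.
Densities follow by Lipschitz continuity. Currents do not depend on the potential at all, and their
error is computed directly. -/

namespace Sheath

/-! ### The ordinary differential equation for the potential -/

/-- One-sided maximum principle on the half line. -/
theorem le_div_of_iteratedDeriv_two_ge {w : ℝ → ℝ} {c κ : ℝ} (hc : 0 < c) (hκ : 0 ≤ κ)
    (hw : ContinuousOn w (Ici 0))
    (hw0 : w 0 = 0) (hlim : Tendsto w atTop (𝓝 0))
    (hineq : ∀ x : ℝ, 0 < x → 0 < w x → c * w x - κ ≤ iteratedDeriv 2 w x) :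
    ∀ x : ℝ, 0 ≤ x → w x ≤ κ / c := by
  intro x₁ hx₁
  by_contra! hlt
  have hpos : 0 < w x₁ := lt_of_le_of_lt (by positivity) hlt
  obtain ⟨X, hX1, hX⟩ : ∃ X, x₁ < X ∧ w X < w x₁ := by
    have h1 := (hlim.eventually (gt_mem_nhds hpos)).and (eventually_gt_atTop x₁)
    obtain ⟨X, hX, hX'⟩ := h1.exists
    exact ⟨X, hX', hX⟩
  obtain ⟨z, hz, hzmax⟩ := (isCompact_Icc (a := (0 : ℝ)) (b := X)).exists_isMaxOn
    ⟨x₁, hx₁, hX1.le⟩ (hw.mono Icc_subset_Ici_self)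
  have hzge : w x₁ ≤ w z := hzmax ⟨hx₁, hX1.le⟩
  have hz0 : 0 < z := by
    rcases hz.1.eq_or_lt with h | h
    · rw [← h, hw0] at hzge; linarith
    · exact h
  have hzX : z < X := by
    rcases hz.2.eq_or_lt with h | h
    · rw [h] at hzge; linarith
    · exact h
  have hmax : IsLocalMax w z := hzmax.isLocalMax (Icc_mem_nhds hz0 hzX)
  have hd2 : 0 < deriv (deriv w) z := by
    have h := hineq z hz0 (by linarith)
    rw [iteratedDeriv_succ, iteratedDeriv_one] at h
    have h2 : κ < c * w z := by
      rw [div_lt_iff₀ hc] at hlt; nlinarith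
    linarith
  -- The maximum point is now also a local minimum, so `w` is constant near `z`, against a positive
  -- second derivative.
  have hmin := isLocalMin_of_deriv_deriv_pos hd2 hmax.deriv_eq_zero
    (hw.continuousAt (Ici_mem_nhds hz0))
  have hconst : w =ᶠ[𝓝 z] fun _ => w z := by
    filter_upwards [hmax, hmin] with y h1 h2 using le_antisymm h1 h2
  have h3 : deriv (deriv w) z = 0 := by
    rw [hconst.deriv.deriv_eq]; simp
  linarith

theorem iteratedDeriv_two_sub {φ₁ φ₂ : ℝ → ℝ} (h₁ : ContDiffOn ℝ 2 φ₁ (Ioi 0))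
    (h₂ : ContDiffOn ℝ 2 φ₂ (Ioi 0)) {x : ℝ} (hx : 0 < x) :
    iteratedDeriv 2 (fun y => φ₁ y - φ₂ y) x = iteratedDeriv 2 φ₁ x - iteratedDeriv 2 φ₂ x :=
  iteratedDeriv_fun_sub (h₁.contDiffAt (Ioi_mem_nhds hx)) (h₂.contDiffAt (Ioi_mem_nhds hx))

/-- Comparison of two decaying solutions of `φ'' = hᵢ(φ)`, where `h₁` is strongly increasing. -/
theorem abs_sub_le_of_ode {φ₁ φ₂ h₁ h₂ : ℝ → ℝ} {δ c κ : ℝ} (hc : 0 < c) (hκ : 0 ≤ κ)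
    (hmono : ∀ s t, |s| ≤ δ → |t| ≤ δ → t ≤ s → c * (s - t) ≤ h₁ s - h₁ t)
    (hdist : ∀ s, |s| ≤ δ → |h₁ s - h₂ s| ≤ κ)
    (hc₁ : ContinuousOn φ₁ (Ici 0)) (hc₂ : ContinuousOn φ₂ (Ici 0))
    (hd₁ : ContDiffOn ℝ 2 φ₁ (Ioi 0)) (hd₂ : ContDiffOn ℝ 2 φ₂ (Ioi 0))
    (hb₁ : ∀ x, 0 ≤ x → |φ₁ x| ≤ δ) (hb₂ : ∀ x, 0 ≤ x → |φ₂ x| ≤ δ)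
    (he₁ : ∀ x, 0 < x → iteratedDeriv 2 φ₁ x = h₁ (φ₁ x))
    (he₂ : ∀ x, 0 < x → iteratedDeriv 2 φ₂ x = h₂ (φ₂ x))
    (h0 : φ₁ 0 = φ₂ 0) (hl₁ : Tendsto φ₁ atTop (𝓝 0)) (hl₂ : Tendsto φ₂ atTop (𝓝 0)) :
    ∀ x, 0 ≤ x → |φ₁ x - φ₂ x| ≤ κ / c := by
  intro x hx
  rw [abs_le]
  constructor
  · have := le_div_of_iteratedDeriv_two_ge (w := fun y => φ₂ y - φ₁ y) hc hκ (hc₂.sub hc₁)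
      (by simp [h0]) (by simpa using hl₂.sub hl₁) (by
        intro y hy hpos
        rw [iteratedDeriv_two_sub hd₂ hd₁ hy, he₁ y hy, he₂ y hy]
        have h1 := hmono (φ₂ y) (φ₁ y) (hb₂ y hy.le) (hb₁ y hy.le) (by linarith)
        have h2 := (abs_le.1 (hdist (φ₂ y) (hb₂ y hy.le))).2
        linarith) x hx
    linarith
  · exact le_div_of_iteratedDeriv_two_ge (w := fun y => φ₁ y - φ₂ y) hc hκ (hc₁.sub hc₂)
      (by simp [h0]) (by simpa using hl₁.sub hl₂) (by
        intro y hy hpos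
        rw [iteratedDeriv_two_sub hd₁ hd₂ hy, he₁ y hy, he₂ y hy]
        have h1 := hmono (φ₁ y) (φ₂ y) (hb₁ y hy.le) (hb₂ y hy.le) (by linarith)
        have h2 := (abs_le.1 (hdist (φ₂ y) (hb₂ y hy.le))).1
        linarith) x hx

theorem integral_eq_integral_zero_one (h : ℝ → ℝ) (s : ℝ) :
    ∫ r in (0 : ℝ)..s, h r = ∫ t in (0 : ℝ)..1, s * h (s * t) := by
  rw [intervalIntegral.integral_const_mul, intervalIntegral.mul_integral_comp_mul_left]
  simp

theorem integral_zero_one_mul (k : ℝ) : ∫ t in (0 : ℝ)..1, k * t = k / 2 := by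
  rw [intervalIntegral.integral_const_mul, integral_id]; ring

/-- Substituting `r = s * t` treats both signs of `s` at once: the pointwise bound at `s * t`,
divided by `t`, is integrated over `[0, 1]`. -/
theorem mul_sq_le_two_mul_integral {h : ℝ → ℝ} (hh : Continuous h) {c : ℝ} (h0 : h 0 = 0)
    (hlow : ∀ s, c * s ^ 2 ≤ s * h s) (s : ℝ) : c * s ^ 2 ≤ 2 * ∫ r in (0 : ℝ)..s, h r := by
  have : ∫ t in (0 : ℝ)..1, (c * s ^ 2) * t ≤ ∫ t in (0 : ℝ)..1, s * h (s * t) := by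
    refine intervalIntegral.integral_mono_on zero_le_one
      (Continuous.intervalIntegrable (by fun_prop) _ _)
      (Continuous.intervalIntegrable (by fun_prop) _ _) fun t ht => ?_
    rcases ht.1.eq_or_lt with ht0 | ht0
    · simp [← ht0, h0]
    · have := hlow (s * t)
      have h2 : t * (c * s ^ 2 * t) ≤ t * (s * h (s * t)) := by linarith
      exact le_of_mul_le_mul_left h2 ht0
  rw [integral_zero_one_mul, ← integral_eq_integral_zero_one] at this
  linarith

/-- A decaying solution of `φ'' = h(φ)` through a prescribed nonzero boundary value. -/
theorem exists_decaying_solution {h : ℝ → ℝ} (hh : Continuous h) {c C : ℝ} (hc : 0 < c)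
    (h0 : h 0 = 0) (hlow : ∀ s, c * s ^ 2 ≤ s * h s) (hup : ∀ s, s * h s ≤ C * s ^ 2)
    {b : ℝ} (hb : b ≠ 0) :
    ∃ φ : ℝ → ℝ, ContDiff ℝ 2 φ ∧ (∀ x, iteratedDeriv 2 φ x = h (φ x)) ∧ φ 0 = b ∧
      Tendsto φ atTop (𝓝 0) ∧ (∀ x, deriv φ x * b < 0) := by
  set V : ℝ → ℝ := fun s => ∫ r in (0 : ℝ)..s, h r with hV
  have hVd : ∀ s, HasDerivAt V (h s) s := fun s =>
    intervalIntegral.integral_hasDerivAt_right (hh.intervalIntegrable _ _)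
      (hh.stronglyMeasurableAtFilter _ _) hh.continuousAt
  have hVc : Continuous V := continuous_iff_continuousAt.2 fun s => (hVd s).continuousAt
  have hVlow : ∀ s, c * s ^ 2 ≤ 2 * V s := mul_sq_le_two_mul_integral hh h0 hlow
  have hVup : ∀ s, 2 * V s ≤ C * s ^ 2 := by
    intro s
    have := mul_sq_le_two_mul_integral (h := fun s => - h s) hh.neg (c := -C) (by simp [h0])
      (fun s => by have := hup s; nlinarith) s
    rw [intervalIntegral.integral_neg] at this
    simp only [hV]
    linarith
  have hC : 0 < C := by
    have h1 := hVlow 1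
    have h2 := hVup 1
    linarith
  have hba : 0 < |b| := abs_pos.2 hb
  -- Writing `φ = b exp(-y)`, the first integral `(φ')² = 2V(φ)` becomes `y' = K(y)`. The
  -- logarithmic variable removes the degeneracy at `φ = 0`, since `K` stays between `√c` and `√C`.
  set K : ℝ → ℝ := fun y => √(2 * V (b * Real.exp (-y))) / (|b| * Real.exp (-y)) with hK
  have hKc : Continuous K := by
    refine Continuous.div (by fun_prop) (by fun_prop) fun y => by positivity
  have habs : ∀ y, |b * Real.exp (-y)| = |b| * Real.exp (-y) := fun y => by
    rw [abs_mul, abs_of_pos (Real.exp_pos _)]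
  have hKlow : ∀ y, √c ≤ K y := by
    intro y
    rw [hK, le_div_iff₀ (by positivity), ← habs, ← Real.sqrt_sq_eq_abs, ← Real.sqrt_mul hc.le]
    exact Real.sqrt_le_sqrt (hVlow _)
  have hKup : ∀ y, K y ≤ √C := by
    intro y
    rw [hK, div_le_iff₀ (by positivity), ← habs, ← Real.sqrt_sq_eq_abs, ← Real.sqrt_mul hC.le]
    exact Real.sqrt_le_sqrt (hVup _)
  have hsc : 0 < √c := Real.sqrt_pos.2 hc
  have hsC : 0 < √C := Real.sqrt_pos.2 hC
  have hKpos : ∀ y, 0 < K y := fun y => lt_of_lt_of_le hsc (hKlow y)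
  -- The position `x` as a function of `y`. Its slope is at least `1 / √C`, so it is a bijection of
  -- the line and its inverse is a global solution.
  set T : ℝ → ℝ := fun y => ∫ r in (0 : ℝ)..y, (K r)⁻¹ with hT
  have hKic : Continuous fun r => (K r)⁻¹ := hKc.inv₀ fun y => (hKpos y).ne'
  have hTd : ∀ y, HasDerivAt T (K y)⁻¹ y := fun s =>
    intervalIntegral.integral_hasDerivAt_right (hKic.intervalIntegrable _ _)
      (hKic.stronglyMeasurableAtFilter _ _) hKic.continuousAt
  have hT0 : T 0 = 0 := by simp [hT]
  have hTmono : StrictMono T := strictMono_of_deriv_pos fun y => by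
    rw [(hTd y).deriv]; exact inv_pos.2 (hKpos y)
  have hTc : Continuous T := continuous_iff_continuousAt.2 fun s => (hTd s).continuousAt
  have hTlin : Monotone fun y => T y - (√C)⁻¹ * y := by
    have hd : ∀ y, HasDerivAt (fun y => T y - (√C)⁻¹ * y) ((K y)⁻¹ - (√C)⁻¹) y := fun y => by
      simpa using (hTd y).fun_sub ((hasDerivAt_id y).const_mul (√C)⁻¹)
    refine monotone_of_deriv_nonneg (fun y => (hd y).differentiableAt) fun y => ?_
    rw [(hd y).deriv, sub_nonneg]
    exact inv_anti₀ (hKpos y) (hKup y)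
  have hTtop : Tendsto T atTop atTop := by
    have h1 : Tendsto (fun y : ℝ => (√C)⁻¹ * y) atTop atTop :=
      tendsto_id.const_mul_atTop (inv_pos.2 hsC)
    refine tendsto_atTop_mono' _ ?_ h1
    filter_upwards [eventually_ge_atTop (0 : ℝ)] with y hy
    have := hTlin hy
    simp only [hT0] at this
    linarith
  have hTbot : Tendsto T atBot atBot := by
    have h1 : Tendsto (fun y : ℝ => (√C)⁻¹ * y) atBot atBot :=
      tendsto_id.const_mul_atBot (inv_pos.2 hsC)
    refine tendsto_atBot_mono' _ ?_ h1
    filter_upwards [eventually_le_atBot (0 : ℝ)] with y hy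
    have := hTlin hy
    simp only [hT0] at this
    linarith
  set e := hTmono.orderIsoOfSurjective T (hTc.surjective hTtop hTbot) with he
  have heT : ∀ x, T (e.symm x) = x := fun x => e.apply_symm_apply x
  have hed : ∀ x, HasDerivAt e.symm (K (e.symm x)) x := fun x => by
    have := HasDerivAt.of_local_left_inverse (f := T) (g := e.symm) (a := x)
      e.symm.continuous.continuousAt (hTd _) (inv_pos.2 (hKpos _)).ne'
      (Eventually.of_forall heT)
    simpa using this
  have he0 : e.symm 0 = 0 := by
    rw [OrderIso.symm_apply_eq]
    exact hT0.symm
  set σ : ℝ := b / |b| with hσ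
  have hσσ : σ * σ = 1 := by
    rw [hσ, div_mul_div_comm, ← abs_mul, abs_mul_self, div_self (by positivity)]
  set φ : ℝ → ℝ := fun x => b * Real.exp (-(e.symm x)) with hφ
  set p : ℝ → ℝ := fun x => √(2 * V (φ x)) with hp
  have hφ0 : ∀ x, φ x ≠ 0 := fun x => mul_ne_zero hb (Real.exp_pos _).ne'
  have hVpos : ∀ x, 0 < 2 * V (φ x) := fun x =>
    lt_of_lt_of_le (by have := hφ0 x; positivity) (hVlow (φ x))
  have hppos : ∀ x, 0 < p x := fun x => Real.sqrt_pos.2 (hVpos x)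
  have hφd : ∀ x, HasDerivAt φ (-σ * p x) x := fun x => by
    have := ((hed x).neg.exp).const_mul b
    refine this.congr_deriv ?_
    simp only [hσ, hp, hφ, hK]
    have : Real.exp (-(e.symm x)) ≠ 0 := (Real.exp_pos _).ne'
    field_simp
    rfl
  have hφ1 : deriv φ = fun x => -σ * p x := funext fun x => (hφd x).deriv
  have hpd : ∀ x, HasDerivAt (fun x => -σ * p x) (h (φ x)) x := fun x => by
    have h1 : HasDerivAt (fun x => 2 * V (φ x)) (2 * (h (φ x) * (-σ * p x))) x :=
      ((hVd (φ x)).comp x (hφd x)).const_mul 2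
    have h2 := (h1.sqrt (hVpos x).ne').const_mul (-σ)
    refine h2.congr_deriv ?_
    change -σ * (2 * (h (φ x) * (-σ * p x)) / (2 * p x)) = _
    have := (hppos x).ne'
    field_simp
    rw [sq, hσσ, one_mul]
  have hφc : Continuous φ := continuous_iff_continuousAt.2 fun s => (hφd s).continuousAt
  have hφ2 : deriv (deriv φ) = fun x => h (φ x) := by
    rw [hφ1]; exact funext fun x => (hpd x).deriv
  refine ⟨φ, ?_, ?_, ?_, ?_, ?_⟩
  · rw [show (2 : WithTop ℕ∞) = 1 + 1 from rfl, contDiff_succ_iff_deriv]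
    refine ⟨fun x => (hφd x).differentiableAt, by simp, ?_⟩
    rw [contDiff_one_iff_deriv, hφ2]
    refine ⟨?_, hh.comp hφc⟩
    rw [hφ1]
    exact fun x => (hpd x).differentiableAt
  · intro x
    rw [iteratedDeriv_succ, iteratedDeriv_one, hφ2]
  · simp [hφ, he0]
  · have h1 : Tendsto (fun x => Real.exp (-(e.symm x))) atTop (𝓝 0) :=
      Real.tendsto_exp_neg_atTop_nhds_zero.comp e.symm.tendsto_atTop
    simpa using h1.const_mul b
  · intro x
    rw [hφ1]
    have h2 : σ * b = |b| := by
      rw [hσ, div_mul_eq_mul_div, ← abs_mul_abs_self b]; field_simp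
    have h3 := hppos x
    have h4 : (-σ * p x) * b = -(p x * |b|) := by rw [← h2]; ring
    simp only [h4]
    have : 0 < p x * |b| := by positivity
    linarith

theorem abs_le_abs_of_monotoneOn {φ : ℝ → ℝ} {b : ℝ} (h0 : φ 0 = b)
    (hlim : Tendsto φ atTop (𝓝 0))
    (hmono : MonotoneOn φ (Ici 0) ∨ AntitoneOn φ (Ici 0)) {x : ℝ} (hx : 0 ≤ x) :
    |φ x| ≤ |b| := by
  rcases hmono with h | h
  · have h1 : b ≤ φ x := h0 ▸ h self_mem_Ici hx hx
    have h2 : φ x ≤ 0 := ge_of_tendsto hlim (by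
      filter_upwards [eventually_ge_atTop x] with y hy using h hx (hx.trans hy) hy)
    rw [abs_of_nonpos h2, abs_of_nonpos (h1.trans h2)]
    linarith
  · have h1 : φ x ≤ b := h0 ▸ h self_mem_Ici hx hx
    have h2 : 0 ≤ φ x := le_of_tendsto hlim (by
      filter_upwards [eventually_ge_atTop x] with y hy using h hx (hx.trans hy) hy)
    rwa [abs_of_nonneg h2, abs_of_nonneg (h2.trans h1)]

/-- The clipped argument and the remainder are both nondecreasing. An increment thus splits into a
part with slope between `c` and `C` and a part with slope exactly `c ≤ C`. This extends a local
slope bound to the whole line. -/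
theorem mul_sub_le_clip {h : ℝ → ℝ} {δ c C : ℝ} (hδ : 0 < δ)
    (hmono : ∀ s t, |s| ≤ δ → |t| ≤ δ → t ≤ s →
      c * (s - t) ≤ h s - h t ∧ h s - h t ≤ C * (s - t)) {s t : ℝ} (hst : t ≤ s) :
    c * (s - t) ≤ (h (max (-δ) (min s δ)) + c * (s - max (-δ) (min s δ)))
        - (h (max (-δ) (min t δ)) + c * (t - max (-δ) (min t δ))) ∧
      (h (max (-δ) (min s δ)) + c * (s - max (-δ) (min s δ)))
        - (h (max (-δ) (min t δ)) + c * (t - max (-δ) (min t δ))) ≤ C * (s - t) := by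
  have hcl : ∀ u : ℝ, |max (-δ) (min u δ)| ≤ δ := fun u =>
    abs_le.2 ⟨le_max_left _ _, max_le (by linarith) (min_le_right _ _)⟩
  have hm : max (-δ) (min t δ) ≤ max (-δ) (min s δ) :=
    max_le_max le_rfl (min_le_min hst le_rfl)
  have hm2 : t - max (-δ) (min t δ) ≤ s - max (-δ) (min s δ) := by
    rcases le_total s δ with h1 | h1 <;> rcases le_total t δ with h2 | h2 <;>
      simp only [min_eq_left, min_eq_right, h1, h2] <;>
      rcases le_total (-δ) s with h3 | h3 <;> rcases le_total (-δ) t with h4 | h4 <;>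
      rcases le_total (-δ) δ with h5 | h5 <;>
      simp only [max_eq_left, max_eq_right, h3, h4, h5] <;> linarith
  have hcC : c ≤ C := by
    obtain ⟨h1, h2⟩ := hmono δ 0 (by rw [abs_of_pos hδ]) (by simpa using hδ.le) hδ.le
    exact le_of_mul_le_mul_right (by linarith) hδ
  obtain ⟨h1, h2⟩ := hmono _ _ (hcl s) (hcl t) hm
  constructor
  · linarith
  · nlinarith

/-- The decaying solution of `φ'' = h(φ)` when `h` is only controlled near the origin. -/
theorem exists_decaying_solution_of_local {h : ℝ → ℝ} {δ c C : ℝ} (hδ : 0 < δ) (hc : 0 < c)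
    (h0 : h 0 = 0)
    (hmono : ∀ s t, |s| ≤ δ → |t| ≤ δ → t ≤ s →
      c * (s - t) ≤ h s - h t ∧ h s - h t ≤ C * (s - t))
    {b : ℝ} (hb : b ≠ 0) (hbδ : |b| ≤ δ) :
    ∃ φ : ℝ → ℝ, ContDiff ℝ 2 φ ∧ (∀ x, 0 ≤ x → iteratedDeriv 2 φ x = h (φ x)) ∧ φ 0 = b ∧
      Tendsto φ atTop (𝓝 0) ∧ ((∀ x, 0 < deriv φ x) ∨ (∀ x, deriv φ x < 0)) ∧
      (∀ x, 0 ≤ x → |φ x| ≤ |b|) := by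
  set H : ℝ → ℝ := fun s => h (max (-δ) (min s δ)) + c * (s - max (-δ) (min s δ)) with hH
  have hclip : ∀ s, |s| ≤ δ → max (-δ) (min s δ) = s := fun s hs => by
    rw [abs_le] at hs
    rw [min_eq_left hs.2, max_eq_right hs.1]
  have hHh : ∀ s, |s| ≤ δ → H s = h s := fun s hs => by
    simp only [hH, hclip s hs, sub_self, mul_zero, add_zero]
  have hHm : ∀ s t, t ≤ s → c * (s - t) ≤ H s - H t ∧ H s - H t ≤ C * (s - t) :=
    fun s t hst => mul_sub_le_clip hδ hmono hst
  have hH0 : H 0 = 0 := by rw [hHh 0 (by simpa using hδ.le), h0]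
  have hlip : LipschitzWith C.toNNReal H := by
    have key : ∀ s t, t ≤ s → dist (H s) (H t) ≤ C.toNNReal * dist s t := fun s t hst => by
      obtain ⟨h1, h2⟩ := hHm s t hst
      have h3 : 0 ≤ s - t := by linarith
      have h4 : 0 ≤ H s - H t := le_trans (by positivity) h1
      rw [Real.dist_eq, Real.dist_eq, abs_of_nonneg h3, abs_of_nonneg h4]
      exact h2.trans (mul_le_mul_of_nonneg_right (Real.le_coe_toNNReal C) h3)
    refine LipschitzWith.of_dist_le_mul fun s t => ?_
    rcases le_total t s with h | h
    · exact key s t h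
    · rw [dist_comm, dist_comm s]
      exact key t s h
  have hb1 : ∀ s, c * s ^ 2 ≤ s * H s ∧ s * H s ≤ C * s ^ 2 := fun s => by
    rcases le_total 0 s with h | h
    · obtain ⟨h1, h2⟩ := hHm s 0 h
      rw [hH0, sub_zero, sub_zero] at h1 h2
      constructor <;> nlinarith
    · obtain ⟨h1, h2⟩ := hHm 0 s h
      rw [hH0, zero_sub, zero_sub] at h1 h2
      constructor <;> nlinarith
  obtain ⟨φ, hφ, hode, hφ0, hlim, hder⟩ := exists_decaying_solution hlip.continuous hc hH0
    (fun s => (hb1 s).1) (fun s => (hb1 s).2) hb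
  have hd : Differentiable ℝ φ := hφ.differentiable (by simp)
  have hsign : (∀ x, 0 < deriv φ x) ∨ (∀ x, deriv φ x < 0) := by
    rcases lt_or_gt_of_ne hb with hb | hb
    · exact Or.inl fun x => pos_of_mul_neg_left (hder x) hb.le
    · exact Or.inr fun x => neg_of_mul_neg_left (hder x) hb.le
  -- A monotone decaying solution never leaves `[-|b|, |b|]`, where `H` and `h` agree, so the
  -- extension is invisible for `x ≥ 0`.
  have hbd : ∀ x, 0 ≤ x → |φ x| ≤ |b| := fun x hx => by
    refine abs_le_abs_of_monotoneOn hφ0 hlim ?_ hx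
    rcases hsign with h | h
    · exact Or.inl ((strictMono_of_deriv_pos h).monotone.monotoneOn _)
    · exact Or.inr ((strictAnti_of_deriv_neg h).antitone.antitoneOn _)
  exact ⟨φ, hφ, fun x hx => by rw [hode, hHh _ ((hbd x hx).trans hbδ)], hφ0, hlim, hsign, hbd⟩

/-! ### Estimates for the charge density -/

/-- Strict differentiability at the origin controls differences between any two nearby points with
error `a / 2` times their distance. In the direction of `s` the slopes then lie in `[a/2, 3a/2]`,
uniformly in `τ`; in the direction of `τ` it gives a Lipschitz bound. -/
theorem exists_lipschitz_constants {H : ℝ × ℝ → ℝ} (hH : ContDiffAt ℝ 1 H (0, 0)) {a : ℝ}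
    (ha : 0 < a) (hd : HasDerivAt (fun s => H (0, s)) a 0) :
    ∃ r C : ℝ, 0 < r ∧ 0 < C ∧ ∀ τ s : ℝ, |τ| < r → |s| < r →
      |H (τ, s) - H (0, s)| ≤ C * |τ| ∧
      ∀ t : ℝ, |t| < r → t ≤ s →
        a / 2 * (s - t) ≤ H (τ, s) - H (τ, t) ∧ H (τ, s) - H (τ, t) ≤ C * (s - t) := by
  set L := fderiv ℝ H (0, 0)
  have hs : HasStrictFDerivAt H L (0, 0) := hH.hasStrictFDerivAt one_ne_zero
  have hL : L (0, 1) = a := by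
    have h1 : HasDerivAt (fun s : ℝ => ((0 : ℝ), s)) (0, 1) 0 :=
      (hasDerivAt_const _ _).prodMk (hasDerivAt_id _)
    exact (hs.hasFDerivAt.comp_hasDerivAt (0 : ℝ) h1).unique hd
  have hev := hs.isLittleO.def (half_pos ha)
  obtain ⟨r, hr, hball⟩ := Metric.eventually_nhds_iff.1 hev
  have hdist : ∀ τ s σ t : ℝ, |τ| < r → |s| < r → |σ| < r → |t| < r →
      dist (((τ, s), (σ, t)) : (ℝ × ℝ) × (ℝ × ℝ)) ((0, 0), (0, 0)) < r := by
    intro τ s σ t h1 h2 h3 h4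
    simp [Prod.dist_eq, h1, h2, h3, h4]
  refine ⟨r, max (3 / 2 * a) (|L (1, 0)| + a / 2), hr, by positivity, fun τ s hτ hsr => ⟨?_, ?_⟩⟩
  · have h := hball (hdist τ s 0 s hτ hsr (by simpa using hr) hsr)
    have e1 : ((τ, s) : ℝ × ℝ) - (0, s) = τ • (1, 0) := by ext <;> simp
    simp only [e1, map_smul, norm_smul, smul_eq_mul] at h
    have e2 : ‖((1, 0) : ℝ × ℝ)‖ = 1 := by simp [Prod.norm_def]
    rw [e2, mul_one, Real.norm_eq_abs, Real.norm_eq_abs] at h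
    have h3 : |H (τ, s) - H (0, s)| ≤ |H (τ, s) - H (0, s) - τ * L (1, 0)| + |τ * L (1, 0)| := by
      simpa using abs_add_le (H (τ, s) - H (0, s) - τ * L (1, 0)) (τ * L (1, 0))
    rw [abs_mul] at h3
    have h4 : (|L (1, 0)| + a / 2) * |τ| ≤ max (3 / 2 * a) (|L (1, 0)| + a / 2) * |τ| :=
      mul_le_mul_of_nonneg_right (le_max_right _ _) (abs_nonneg _)
    linarith
  · intro t ht hts
    have h := hball (hdist τ s τ t hτ hsr hτ ht)
    have e1 : ((τ, s) : ℝ × ℝ) - (τ, t) = (s - t) • (0, 1) := by ext <;> simp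
    simp only [e1, map_smul, norm_smul, smul_eq_mul, hL] at h
    have e2 : ‖((0, 1) : ℝ × ℝ)‖ = 1 := by simp [Prod.norm_def]
    have h0 : 0 ≤ s - t := by linarith
    rw [e2, mul_one, Real.norm_eq_abs, Real.norm_eq_abs, abs_of_nonneg h0, abs_le] at h
    have h4 : (3 / 2 * a) * (s - t) ≤ max (3 / 2 * a) (|L (1, 0)| + a / 2) * (s - t) :=
      mul_le_mul_of_nonneg_right (le_max_left _ _) h0
    constructor <;> linarith [h.1, h.2]

/-- The factor by which the potential `s` changes the density of ions of velocity `w`. -/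
noncomputable def densityFactor (w s : ℝ) : ℝ := w / √(w ^ 2 + 2 * s)

/-- The ion density of three monokinetic beams with velocities perturbed by `τ`. -/
noncomputable def beamDensity (α mb minf vb vinf τ s : ℝ) : ℝ :=
  mb * densityFactor (vb + τ) s + (1 + α) * minf * densityFactor (vinf - τ) s

theorem beamDensity_zero_left (α mb minf vb vinf s : ℝ) :
    beamDensity α mb minf vb vinf 0 s = ionDensity α mb minf vb vinf s := by
  simp only [beamDensity, densityFactor, ionDensity, add_zero, sub_zero]
  ring

theorem densityFactor_zero {w : ℝ} (hw : 0 < w) : densityFactor w 0 = 1 := by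
  simp [densityFactor, Real.sqrt_sq hw.le, hw.ne']

theorem contDiffAt_densityFactor {w s : ℝ} (h : 0 < w ^ 2 + 2 * s) :
    ContDiffAt ℝ 1 (fun p : ℝ × ℝ => densityFactor p.1 p.2) (w, s) := by
  unfold densityFactor
  refine contDiffAt_fst.div (ContDiffAt.sqrt (by fun_prop) h.ne') (Real.sqrt_pos.2 h).ne'

theorem hasDerivAt_densityFactor_zero {w : ℝ} (hw : 0 < w) :
    HasDerivAt (densityFactor w) (-(w ^ 2)⁻¹) 0 := by
  have h1 : HasDerivAt (fun s : ℝ => w ^ 2 + 2 * s) 2 0 := by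
    simpa using ((hasDerivAt_id (0 : ℝ)).const_mul 2).const_add (w ^ 2)
  have h2 := ((h1.sqrt (by positivity)).inv (by
    simp only [mul_zero, add_zero, Real.sqrt_sq hw.le]; exact hw.ne')).const_mul w
  refine (h2.congr_deriv ?_)
  simp only [mul_zero, add_zero, Real.sqrt_sq hw.le]
  field_simp

theorem contDiffAt_beamDensity (α mb minf : ℝ) {vb vinf : ℝ} (hvb : 0 < vb) (hvinf : 0 < vinf) :
    ContDiffAt ℝ 1 (fun p : ℝ × ℝ => beamDensity α mb minf vb vinf p.1 p.2) (0, 0) := by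
  unfold beamDensity
  have h1 : ContDiffAt ℝ 1 (fun p : ℝ × ℝ => densityFactor (vb + p.1) p.2) (0, 0) :=
    ContDiffAt.comp (0, 0) (g := fun p : ℝ × ℝ => densityFactor p.1 p.2)
      (f := fun p : ℝ × ℝ => (vb + p.1, p.2))
      (contDiffAt_densityFactor (by simp only [add_zero, mul_zero]; positivity)) (by fun_prop)
  have h2 : ContDiffAt ℝ 1 (fun p : ℝ × ℝ => densityFactor (vinf - p.1) p.2) (0, 0) :=
    ContDiffAt.comp (0, 0) (g := fun p : ℝ × ℝ => densityFactor p.1 p.2)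
      (f := fun p : ℝ × ℝ => (vinf - p.1, p.2))
      (contDiffAt_densityFactor (by simp only [sub_zero, add_zero, mul_zero]; positivity))
      (by fun_prop)
  exact (contDiffAt_const.mul h1).add (contDiffAt_const.mul h2)

theorem beamDensity_zero_right {α mb minf vb vinf τ : ℝ} (h1 : 0 < vb + τ) (h2 : 0 < vinf - τ)
    (hmass : mb + (1 + α) * minf = 1) : beamDensity α mb minf vb vinf τ 0 = 1 := by
  rw [beamDensity, densityFactor_zero h1, densityFactor_zero h2]
  linarith

/-- The slope at `0` of charge density minus `ne` is `1 - Σ m v⁻²`, positive by Bohm's inequality.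
The constants must not depend on `τ`, because the mollified density is an average over `τ`. -/
theorem exists_density_constants {ne : ℝ → ℝ} (hne : ContDiff ℝ 2 ne)
    (hne1 : deriv ne 0 = -1) {α mb minf vb vinf : ℝ}
    (hvb : 0 < vb) (hvinf : 0 < vinf) (hmass : mb + (1 + α) * minf = 1)
    (hbohm : mb * (vb ^ 2)⁻¹ + (1 + α) * minf * (vinf ^ 2)⁻¹ < 1) :
    ∃ r c C : ℝ, 0 < r ∧ 0 < c ∧ 0 < C ∧ ∀ τ s : ℝ, |τ| < r → |s| < r →
      1 / 2 ≤ beamDensity α mb minf vb vinf τ s ∧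
      |beamDensity α mb minf vb vinf τ s - ionDensity α mb minf vb vinf s| ≤ C * |τ| ∧
      ∀ t : ℝ, |t| < r → t ≤ s →
        c * (s - t) ≤ (beamDensity α mb minf vb vinf τ s - ne s)
          - (beamDensity α mb minf vb vinf τ t - ne t) ∧
        (beamDensity α mb minf vb vinf τ s - ne s)
          - (beamDensity α mb minf vb vinf τ t - ne t) ≤ C * (s - t) := by
  have hR := contDiffAt_beamDensity α mb minf hvb hvinf
  have hcont := hR.continuousAt
  have hH : ContDiffAt ℝ 1
      (fun p : ℝ × ℝ => beamDensity α mb minf vb vinf p.1 p.2 - ne p.2) (0, 0) :=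
    hR.sub ((hne.of_le (by norm_num)).contDiffAt.comp (0, 0) contDiffAt_snd)
  set a := 1 - (mb * (vb ^ 2)⁻¹ + (1 + α) * minf * (vinf ^ 2)⁻¹) with ha
  have ha0 : 0 < a := by linarith
  have hd : HasDerivAt (fun s : ℝ => beamDensity α mb minf vb vinf 0 s - ne s) a 0 := by
    have h1 := (hasDerivAt_densityFactor_zero hvb).const_mul mb
    have h2 := (hasDerivAt_densityFactor_zero hvinf).const_mul ((1 + α) * minf)
    have h3 : HasDerivAt ne (-1) 0 := by
      rw [← hne1]
      exact (hne.differentiable (by simp) 0).hasDerivAt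
    have h4 := (h1.add h2).sub h3
    have e : (fun s : ℝ => beamDensity α mb minf vb vinf 0 s - ne s) =
        (fun y => mb * densityFactor vb y) + (fun y => (1 + α) * minf * densityFactor vinf y)
          - ne := by
      ext s; simp [beamDensity]
    rw [e]
    refine h4.congr_deriv ?_
    rw [ha]; ring
  obtain ⟨r, C, hr, hC, hest⟩ := exists_lipschitz_constants hH ha0 hd
  have h1 : beamDensity α mb minf vb vinf 0 0 = 1 :=
    beamDensity_zero_right (by linarith) (by linarith) hmass
  have hev : ∀ᶠ p : ℝ × ℝ in 𝓝 (0, 0), 1 / 2 < beamDensity α mb minf vb vinf p.1 p.2 :=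
    hcont.eventually (lt_mem_nhds (by
      change 1 / 2 < beamDensity α mb minf vb vinf 0 0
      rw [h1]; norm_num))
  obtain ⟨r', hr', hball⟩ := Metric.eventually_nhds_iff.1 hev
  refine ⟨min r r', a / 2, C, lt_min hr hr', half_pos ha0, hC, fun τ s hτ hs => ⟨?_, ?_, ?_⟩⟩
  · refine (hball (y := (τ, s)) ?_).le
    simp [Prod.dist_eq, lt_of_lt_of_le hτ (min_le_right _ _),
      lt_of_lt_of_le hs (min_le_right _ _)]
  · have := (hest τ s (lt_of_lt_of_le hτ (min_le_left _ _))
      (lt_of_lt_of_le hs (min_le_left _ _))).1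
    rw [← beamDensity_zero_left]
    convert this using 2
    ring
  · intro t ht hts
    exact (hest τ s (lt_of_lt_of_le hτ (min_le_left _ _))
      (lt_of_lt_of_le hs (min_le_left _ _))).2 t (lt_of_lt_of_le ht (min_le_left _ _)) hts

end Sheath

namespace Sheath

/-! ### Beams of ions in a given potential -/

/-- The distribution of right-moving ions at a point where the potential is `s`, if it is `G` where
the potential vanishes. -/
noncomputable def beam (G : Vel → ℝ) (s : ℝ) (ξ : Vel) : ℝ :=
  (Ioi (0 : ℝ)).indicator (fun _ => G (√(ξ.1 ^ 2 - 2 * s), ξ.2)) ξ.1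

/-- The velocity, at a point where the potential is `s`, of a right-moving ion whose velocity is `ξ`
where the potential vanishes. -/
noncomputable def accelerate (s : ℝ) (ξ : Vel) : Vel := (√(ξ.1 ^ 2 + 2 * s), ξ.2)

/-- A continuous profile of ions with compact support in `{ξ₁ > r}`. -/
structure IsProfile (r : ℝ) (G : Vel → ℝ) : Prop where
  continuous : Continuous G
  compactSupport : HasCompactSupport G
  eq_zero : ∀ ξ : Vel, ξ.1 ≤ r → G ξ = 0

instance : (volume : Measure (ℝ × ℝ)).IsAddHaarMeasure := by
  rw [Measure.volume_eq_prod]; infer_instance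

instance : (volume : Measure Vel).IsAddHaarMeasure := by
  rw [Measure.volume_eq_prod]; infer_instance

variable {r s : ℝ} {G : Vel → ℝ}

theorem beam_of_pos (G : Vel → ℝ) (s : ℝ) {ξ : Vel} (h : 0 < ξ.1) :
    beam G s ξ = G (√(ξ.1 ^ 2 - 2 * s), ξ.2) := indicator_of_mem (mem_Ioi.2 h) _

theorem beam_of_nonpos (G : Vel → ℝ) (s : ℝ) {ξ : Vel} (h : ξ.1 ≤ 0) : beam G s ξ = 0 :=
  indicator_of_notMem (by simpa using h) _

theorem energy_pos (hs : 2 * |s| < r ^ 2) (hr : 0 < r) {w : ℝ} (hw : r < w) :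
    0 < w ^ 2 + 2 * s := by
  have := neg_abs_le s
  nlinarith

theorem beam_accelerate (hr : 0 < r) (hs : 2 * |s| < r ^ 2) {ξ : Vel} (hξ : r < ξ.1) :
    beam G s (accelerate s ξ) = G ξ := by
  have h := energy_pos hs hr hξ
  rw [beam_of_pos _ _ (Real.sqrt_pos.2 h)]
  simp only [accelerate, Real.sq_sqrt h.le, add_sub_cancel_right,
    Real.sqrt_sq (hr.trans hξ).le, Prod.mk.eta]

theorem accelerate_decelerate (hr : 0 < r) {ξ : Vel} (hξ : 0 < ξ.1)
    (h : r < √(ξ.1 ^ 2 - 2 * s)) : accelerate s (√(ξ.1 ^ 2 - 2 * s), ξ.2) = ξ := by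
  have h1 : 0 < ξ.1 ^ 2 - 2 * s := Real.sqrt_pos.1 (hr.trans h)
  simp only [accelerate, Real.sq_sqrt h1.le, sub_add_cancel, Real.sqrt_sq hξ.le, Prod.mk.eta]

theorem lt_of_beam_ne_zero (hG : IsProfile r G) {ξ : Vel} (h : beam G s ξ ≠ 0) :
    0 < ξ.1 ∧ r < √(ξ.1 ^ 2 - 2 * s) ∧ G (√(ξ.1 ^ 2 - 2 * s), ξ.2) ≠ 0 := by
  have h0 : 0 < ξ.1 := by
    by_contra h0
    exact h (beam_of_nonpos _ _ (not_lt.1 h0))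
  rw [beam_of_pos _ _ h0] at h
  refine ⟨h0, ?_, h⟩
  by_contra h1
  exact h (hG.eq_zero _ (not_lt.1 h1))

/-- Negative energies are included: the square root is then `0`, which is below the threshold `r`.
-/
theorem beam_eq_zero_of_sq_le (hG : IsProfile r G) (hr : 0 < r) {ξ : Vel}
    (h : ξ.1 ^ 2 - 2 * s ≤ r ^ 2) : beam G s ξ = 0 := by
  by_contra hne
  have h1 := (lt_of_beam_ne_zero hG hne).2.1
  rw [Real.lt_sqrt hr.le] at h1
  linarith

theorem hasFDerivAt_accelerate {ξ : Vel} (h : 0 < ξ.1 ^ 2 + 2 * s) :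
    HasFDerivAt (accelerate s)
      (((ξ.1 / √(ξ.1 ^ 2 + 2 * s)) • ContinuousLinearMap.id ℝ ℝ).prodMap
        (ContinuousLinearMap.id ℝ (ℝ × ℝ))) ξ := by
  have h1 : HasDerivAt (fun w : ℝ => √(w ^ 2 + 2 * s)) (ξ.1 / √(ξ.1 ^ 2 + 2 * s)) ξ.1 := by
    have h2 : HasDerivAt (fun w : ℝ => w ^ 2 + 2 * s) (2 * ξ.1) ξ.1 := by
      simpa using (hasDerivAt_pow 2 ξ.1).add_const (2 * s)
    refine (h2.sqrt h.ne').congr_deriv ?_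
    rw [mul_div_mul_left _ _ two_ne_zero]
  have h3 := h1.hasFDerivAt.prodMap ξ (hasFDerivAt_id ξ.2)
  refine h3.congr_fderiv ?_
  ext <;> simp

/-- The determinant is the Jacobian of `accelerate` once `c = ξ₁ / √(ξ₁² + 2s)`; this quotient is
how the potential enters the density. -/
theorem det_smul_prodMap (c : ℝ) :
    ((c • ContinuousLinearMap.id ℝ ℝ).prodMap (ContinuousLinearMap.id ℝ (ℝ × ℝ))).det = c := by
  have : (((c • ContinuousLinearMap.id ℝ ℝ).prodMap
      (ContinuousLinearMap.id ℝ (ℝ × ℝ)) : Vel →L[ℝ] Vel) : Vel →ₗ[ℝ] Vel) =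
      LinearMap.prodMap (c • LinearMap.id) LinearMap.id := rfl
  rw [ContinuousLinearMap.det, this, LinearMap.det_prodMap]
  simp

theorem injOn_accelerate (hr : 0 < r) (hs : 2 * |s| < r ^ 2) :
    InjOn (accelerate s) {ξ : Vel | r < ξ.1} := by
  intro ξ hξ ζ hζ h
  simp only [accelerate, Prod.mk.injEq] at h
  have h1 := energy_pos hs hr hξ
  have h2 := energy_pos hs hr hζ
  have h3 := h.1
  rw [Real.sqrt_inj h1.le h2.le, add_left_inj,
    sq_eq_sq₀ (hr.trans hξ).le (hr.trans hζ).le] at h3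
  exact Prod.ext h3 h.2

/-- Change of variables from the velocities in the potential `s` to those in the potential `0`. -/
theorem integral_beam_mul (hr : 0 < r) (hs : 2 * |s| < r ^ 2) (hG : IsProfile r G)
    (k : Vel → ℝ) :
    ∫ ξ, beam G s ξ * k ξ
      = ∫ ξ, G ξ * (ξ.1 / √(ξ.1 ^ 2 + 2 * s)) * k (accelerate s ξ) := by
  set A : Set Vel := {ξ : Vel | r < ξ.1} with hA
  have hAm : MeasurableSet A := measurableSet_lt measurable_const measurable_fst
  have h1 : ∫ ξ, beam G s ξ * k ξ = ∫ ξ in accelerate s '' A, beam G s ξ * k ξ := by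
    refine (setIntegral_eq_integral_of_forall_compl_eq_zero fun ξ hξ => ?_).symm
    by_contra hne
    obtain ⟨h0, h1, h2⟩ := lt_of_beam_ne_zero hG (left_ne_zero_of_mul hne)
    exact hξ ⟨(√(ξ.1 ^ 2 - 2 * s), ξ.2), h1, accelerate_decelerate hr h0 h1⟩
  have h2 : ∫ ξ, G ξ * (ξ.1 / √(ξ.1 ^ 2 + 2 * s)) * k (accelerate s ξ)
      = ∫ ξ in A, G ξ * (ξ.1 / √(ξ.1 ^ 2 + 2 * s)) * k (accelerate s ξ) := by
    refine (setIntegral_eq_integral_of_forall_compl_eq_zero fun ξ hξ => ?_).symm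
    rw [hG.eq_zero ξ (not_lt.1 hξ), zero_mul, zero_mul]
  rw [h1, h2, integral_image_eq_integral_abs_det_fderiv_smul volume hAm
    (fun ξ hξ => (hasFDerivAt_accelerate (energy_pos hs hr hξ)).hasFDerivWithinAt)
    (injOn_accelerate hr hs)]
  refine setIntegral_congr_fun hAm fun ξ hξ => ?_
  have h3 : 0 ≤ ξ.1 / √(ξ.1 ^ 2 + 2 * s) :=
    div_nonneg (hr.trans hξ).le (Real.sqrt_nonneg _)
  simp only [det_smul_prodMap, abs_of_nonneg h3, beam_accelerate hr hs hξ, smul_eq_mul]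
  ring

theorem IsProfile.bounded (hG : IsProfile r G) : ∃ C : ℝ, 0 ≤ C ∧ ∀ ξ, |G ξ| ≤ C := by
  obtain ⟨C, hC⟩ := hG.compactSupport.exists_bound_of_continuous hG.continuous
  exact ⟨C, (norm_nonneg _).trans (hC 0), hC⟩

theorem measurable_beam (hG : Continuous G) :
    Measurable fun p : ℝ × Vel => beam G p.1 p.2 := by
  have h1 : Measurable fun p : ℝ × Vel => G (√(p.2.1 ^ 2 - 2 * p.1), p.2.2) :=
    (hG.comp (by fun_prop)).measurable
  have h2 : MeasurableSet {p : ℝ × Vel | 0 < p.2.1} :=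
    measurableSet_lt measurable_const (by fun_prop)
  exact h1.indicator h2

theorem abs_beam_le {C : ℝ} (hC : 0 ≤ C) (hG : ∀ ξ, |G ξ| ≤ C) (s : ℝ) (ξ : Vel) :
    |beam G s ξ| ≤ C := by
  rcases lt_or_ge 0 ξ.1 with h | h
  · rw [beam_of_pos _ _ h]; exact hG _
  · rw [beam_of_nonpos _ _ h, abs_zero]; exact hC

/-- The supports of the beams in small potentials lie in a fixed compact set. -/
theorem exists_compact_support_beam (hG : IsProfile r G) :
    ∃ K : Set Vel, IsCompact K ∧ ∀ s ξ, 2 * |s| < r ^ 2 → ξ ∉ K → beam G s ξ = 0 := by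
  obtain ⟨R, hR⟩ := hG.compactSupport.isCompact.isBounded.exists_norm_le
  have hR' : ∀ ξ, G ξ ≠ 0 → ‖ξ‖ ≤ R := fun ξ h => hR ξ (subset_tsupport _ h)
  refine ⟨Metric.closedBall 0 (|R| + |r| + R), isCompact_closedBall _ _, fun s ξ hs hξ => ?_⟩
  by_contra hne
  obtain ⟨h0, h1, h2⟩ := lt_of_beam_ne_zero hG hne
  have h3 := hR' _ h2
  rw [Prod.norm_def, max_le_iff] at h3
  simp only [Real.norm_eq_abs, abs_of_nonneg (Real.sqrt_nonneg _)] at h3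
  have hR0 : 0 ≤ R := (Real.sqrt_nonneg _).trans h3.1
  apply hξ
  rw [mem_closedBall_zero_iff, Prod.norm_def, max_le_iff, Real.norm_eq_abs, abs_of_pos h0,
    abs_of_nonneg hR0]
  have h4 : ξ.1 ^ 2 - 2 * s ≤ R ^ 2 := by
    rw [← Real.sqrt_le_left hR0]; exact h3.1
  have h5 := le_abs_self s
  have h6 := sq_abs r
  have h7 := abs_nonneg r
  constructor
  · by_contra! h8
    nlinarith
  · linarith [h3.2]

/-- The cut at `ξ₁ = 0` creates no jump: the energy there is `-2s < r²`, so the beam already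
vanishes in a neighbourhood. -/
theorem continuousAt_beam (hr : 0 < r) (hG : IsProfile r G) (hs : 2 * |s| < r ^ 2) (ξ : Vel) :
    ContinuousAt (fun p : ℝ × Vel => beam G p.1 p.2) (s, ξ) := by
  rcases lt_trichotomy ξ.1 0 with h1 | h1 | h1
  · have hev : (fun p : ℝ × Vel => beam G p.1 p.2) =ᶠ[𝓝 (s, ξ)] fun _ => 0 := by
      have : ∀ᶠ p : ℝ × Vel in 𝓝 (s, ξ), p.2.1 < 0 :=
        (Continuous.tendsto (f := fun p : ℝ × Vel => p.2.1) (by fun_prop)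
          (s, ξ)).eventually (gt_mem_nhds h1)
      filter_upwards [this] with p hp using beam_of_nonpos _ _ hp.le
    exact continuousAt_const.congr hev.symm
  · have hev : (fun p : ℝ × Vel => beam G p.1 p.2) =ᶠ[𝓝 (s, ξ)] fun _ => 0 := by
      have : ∀ᶠ p : ℝ × Vel in 𝓝 (s, ξ), p.2.1 ^ 2 - 2 * p.1 < r ^ 2 :=
        (Continuous.tendsto (f := fun p : ℝ × Vel => p.2.1 ^ 2 - 2 * p.1) (by fun_prop)
          (s, ξ)).eventually (gt_mem_nhds (by
            have := neg_abs_le s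
            simp only [h1]
            linarith))
      filter_upwards [this] with p hp using beam_eq_zero_of_sq_le hG hr hp.le
    exact continuousAt_const.congr hev.symm
  · have hev : (fun p : ℝ × Vel => beam G p.1 p.2) =ᶠ[𝓝 (s, ξ)]
        fun p => G (√(p.2.1 ^ 2 - 2 * p.1), p.2.2) := by
      have : ∀ᶠ p : ℝ × Vel in 𝓝 (s, ξ), 0 < p.2.1 :=
        (Continuous.tendsto (f := fun p : ℝ × Vel => p.2.1) (by fun_prop)
          (s, ξ)).eventually (lt_mem_nhds h1)
      filter_upwards [this] with p hp using beam_of_pos _ _ hp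
    refine ContinuousAt.congr ?_ hev.symm
    exact (hG.continuous.comp (by fun_prop)).continuousAt

theorem continuous_beam (hr : 0 < r) (hG : IsProfile r G) (hs : 2 * |s| < r ^ 2) :
    Continuous (beam G s) :=
  continuous_iff_continuousAt.2 fun ξ =>
    (continuousAt_beam hr hG hs ξ).comp (f := fun ξ => (s, ξ)) (by fun_prop)

theorem hasCompactSupport_beam (hG : IsProfile r G) (hs : 2 * |s| < r ^ 2) :
    HasCompactSupport (beam G s) := by
  obtain ⟨K, hK, h⟩ := exists_compact_support_beam hG
  exact HasCompactSupport.intro hK fun ξ hξ => h s ξ hs hξ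

theorem integrable_beam (hr : 0 < r) (hG : IsProfile r G) (hs : 2 * |s| < r ^ 2) :
    Integrable (beam G s) :=
  (continuous_beam hr hG hs).integrable_of_hasCompactSupport (hasCompactSupport_beam hG hs)

theorem integrable_mul_beam (hr : 0 < r) (hG : IsProfile r G) (hs : 2 * |s| < r ^ 2) :
    Integrable fun ξ : Vel => ξ.1 * beam G s ξ :=
  (continuous_fst.mul (continuous_beam hr hG hs)).integrable_of_hasCompactSupport
    (hasCompactSupport_beam hG hs).mul_left

/-- The beam depends continuously, as an element of `L¹`, on the value of the potential. -/
theorem tendsto_eLpNorm_beam (hr : 0 < r) (hG : IsProfile r G) (hs : 2 * |s| < r ^ 2)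
    {ι : Type*} {l : Filter ι} [l.IsCountablyGenerated] {u : ι → ℝ} (hu : Tendsto u l (𝓝 s)) :
    Tendsto (fun i => eLpNorm (fun ξ => beam G (u i) ξ - beam G s ξ) 1 volume) l (𝓝 0) := by
  obtain ⟨C, hC0, hC⟩ := hG.bounded
  obtain ⟨K, hK, hKs⟩ := exists_compact_support_beam hG
  have hev : ∀ᶠ i in l, 2 * |u i| < r ^ 2 := by
    have h1 : Continuous fun x : ℝ => 2 * |x| := by fun_prop
    exact ((h1.tendsto s).comp hu).eventually (gt_mem_nhds hs)
  have hmeas : ∀ᶠ i in l, Measurable fun ξ => ‖beam G (u i) ξ - beam G s ξ‖ₑ := by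
    filter_upwards [hev] with i hi
    exact ((continuous_beam hr hG hi).sub (continuous_beam hr hG hs)).measurable.enorm
  have hbound : ∀ᶠ i in l, ∀ᵐ ξ : Vel, ‖beam G (u i) ξ - beam G s ξ‖ₑ
      ≤ K.indicator (fun _ => ENNReal.ofReal (2 * C)) ξ := by
    filter_upwards [hev] with i hi
    refine ae_of_all _ fun ξ => ?_
    by_cases hξ : ξ ∈ K
    · have h1 := abs_beam_le hC0 hC (u i) ξ
      have h2 := abs_beam_le hC0 hC s ξ
      have h3 : ‖beam G (u i) ξ - beam G s ξ‖ ≤ 2 * C := by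
        have := abs_sub (beam G (u i) ξ) (beam G s ξ)
        rw [Real.norm_eq_abs]
        linarith
      rw [indicator_of_mem hξ, ← ofReal_norm]
      exact ENNReal.ofReal_le_ofReal h3
    · rw [hKs _ ξ hi hξ, hKs _ ξ hs hξ]
      simp
  have hfin : ∫⁻ ξ, K.indicator (fun _ => ENNReal.ofReal (2 * C)) ξ ≠ ⊤ := by
    rw [lintegral_indicator hK.measurableSet, setLIntegral_const]
    exact ENNReal.mul_ne_top ENNReal.ofReal_ne_top hK.measure_lt_top.ne
  have hpt : ∀ᵐ ξ : Vel, Tendsto (fun i => ‖beam G (u i) ξ - beam G s ξ‖ₑ) l (𝓝 0) := by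
    filter_upwards with ξ
    have h0 : Tendsto (fun i => (u i, ξ)) l (𝓝 (s, ξ)) := hu.prodMk_nhds tendsto_const_nhds
    have h1 := (continuousAt_beam hr hG hs ξ).tendsto.comp h0
    simp only [Function.comp_def] at h1
    have h2 := (h1.sub_const (beam G s ξ)).enorm
    simpa using h2
  have hlim := tendsto_lintegral_filter_of_dominated_convergence _ hmeas hbound hfin hpt
  simpa only [eLpNorm_one_eq_lintegral_enorm, lintegral_zero] using hlim

end Sheath

namespace Sheath

/-! ### The weak form of the Vlasov equation -/

/-- The Vlasov operator `ξ₁ ∂ₓ + q(x) ∂_{ξ₁}`. -/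
noncomputable def transport (q : ℝ → ℝ) (ψ : ℝ × Vel → ℝ) (p : ℝ × Vel) : ℝ :=
  p.2.1 * dx ψ p + q p.1 * dxi ψ p

theorem transport_eq_fderiv (q : ℝ → ℝ) (ψ : ℝ × Vel → ℝ) (p : ℝ × Vel) :
    transport q ψ p = fderiv ℝ ψ p (p.2.1, (q p.1, 0)) := by
  have : ((p.2.1, (q p.1, 0)) : ℝ × Vel) = p.2.1 • (1, 0) + q p.1 • (0, (1, 0)) := by
    ext <;> simp
  rw [this, map_add, map_smul, map_smul]
  rfl

theorem continuous_transport {q : ℝ → ℝ} (hq : Continuous q) {ψ : ℝ × Vel → ℝ}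
    (hψ : ContDiff ℝ 1 ψ) : Continuous (transport q ψ) := by
  have h : transport q ψ = fun p => fderiv ℝ ψ p (p.2.1, (q p.1, 0)) :=
    funext (transport_eq_fderiv q ψ)
  rw [h]
  exact (hψ.continuous_fderiv one_ne_zero).clm_apply (by fun_prop)

theorem hasCompactSupport_transport (q : ℝ → ℝ) {ψ : ℝ × Vel → ℝ}
    (hψ : HasCompactSupport ψ) : HasCompactSupport (transport q ψ) := by
  refine (hψ.fderiv (𝕜 := ℝ)).mono fun p hp => ?_
  rw [Function.mem_support, transport_eq_fderiv] at hp
  rw [Function.mem_support]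
  intro h
  simp [h] at hp

variable {r δ : ℝ} {G : Vel → ℝ} {φ : ℝ → ℝ} {ψ : ℝ × Vel → ℝ}

theorem integrable_beam_mul (hG : IsProfile r G) (hφ : Measurable φ) {k : ℝ × Vel → ℝ}
    (hk : Integrable k) : Integrable fun p : ℝ × Vel => beam G (φ p.1) p.2 * k p := by
  obtain ⟨C, hC0, hC⟩ := hG.bounded
  refine hk.bdd_mul (c := C) ?_ (Eventually.of_forall fun p => abs_beam_le hC0 hC _ _)
  exact ((measurable_beam hG.continuous).comp
    ((hφ.comp measurable_fst).prodMk measurable_snd)).aestronglyMeasurable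

theorem exists_eq_zero_of_lt {k : ℝ × Vel → ℝ} (hk : HasCompactSupport k) :
    ∃ X : ℝ, 0 < X ∧ ∀ p : ℝ × Vel, X < p.1 → k p = 0 := by
  obtain ⟨R, hR⟩ := hk.isCompact.isBounded.exists_norm_le
  refine ⟨max R 1, by positivity, fun p hp => ?_⟩
  by_contra hne
  have h1 := hR p (subset_tsupport _ hne)
  rw [Prod.norm_def, max_le_iff] at h1
  have h2 := (le_abs_self p.1).trans h1.1
  have h3 := le_max_left R 1
  linarith

/-- The density of the flux form of the weak equation in the velocities at potential `0`. -/
theorem integrable_profile_transport (hr : 0 < r) (hδ : 2 * δ < r ^ 2) (hG : IsProfile r G)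
    (hφ : ContDiff ℝ 1 φ) (hb : ∀ x, 0 ≤ x → |φ x| ≤ δ) (hψ : ContDiff ℝ 1 ψ)
    (hc : HasCompactSupport ψ) :
    ∃ B : ℝ → Vel → ℝ, (∀ x ξ, 0 < x → |G ξ * (ξ.1 / √(ξ.1 ^ 2 + 2 * φ x)) *
        transport (deriv φ) ψ (x, accelerate (φ x) ξ)| ≤ B x ξ) ∧
      Integrable (fun p : ℝ × Vel => B p.1 p.2) ((volume.restrict (Ioi 0)).prod volume) ∧
      ∀ ξ, IntegrableOn (fun x => B x ξ) (Ioi 0) := by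
  have hq : Continuous (deriv φ) := hφ.continuous_deriv le_rfl
  obtain ⟨C, hC⟩ := (hasCompactSupport_transport (deriv φ) hc).exists_bound_of_continuous
    (continuous_transport hq hψ)
  obtain ⟨X, hX0, hX⟩ := exists_eq_zero_of_lt (hasCompactSupport_transport (deriv φ) hc)
  have hC0 : 0 ≤ C := (norm_nonneg _).trans (hC 0)
  -- A lower bound for the speed of every ion in the beam at every `x ≥ 0`; it keeps the Jacobian
  -- bounded.
  set m := √(r ^ 2 - 2 * δ) with hm
  have hm0 : 0 < m := Real.sqrt_pos.2 (by linarith)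
  have hi1 : Integrable ((Icc 0 X).indicator fun _ => C / m) (volume.restrict (Ioi (0 : ℝ))) := by
    refine Integrable.restrict ?_
    rw [integrable_indicator_iff measurableSet_Icc]
    exact integrableOn_const (by simp)
  have hi2 : Integrable fun ξ : Vel => |G ξ * ξ.1| :=
    ((hG.continuous.mul continuous_fst).integrable_of_hasCompactSupport
      hG.compactSupport.mul_right).abs
  refine ⟨fun x ξ => (Icc 0 X).indicator (fun _ => C / m) x * |G ξ * ξ.1|, ?_,
    hi1.mul_prod hi2, fun ξ => hi1.mul_const _⟩
  intro x ξ hx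
  rcases lt_or_ge X x with hxX | hxX
  · rw [hX _ hxX, mul_zero, abs_zero]
    exact mul_nonneg (indicator_nonneg (fun _ _ => by positivity) _) (abs_nonneg _)
  have hmem : x ∈ Icc 0 X := ⟨hx.le, hxX⟩
  simp only [indicator_of_mem hmem]
  rcases le_or_gt ξ.1 r with hξ | hξ
  · simp [hG.eq_zero ξ hξ]
  have h1 : m ≤ √(ξ.1 ^ 2 + 2 * φ x) := by
    refine Real.sqrt_le_sqrt ?_
    have := (abs_le.1 (hb x hx.le)).1
    nlinarith
  have h2 : |transport (deriv φ) ψ (x, accelerate (φ x) ξ)| ≤ C := hC _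
  rw [abs_mul, ← mul_div_assoc, abs_div, abs_of_nonneg (Real.sqrt_nonneg _)]
  calc |G ξ * ξ.1| / √(ξ.1 ^ 2 + 2 * φ x) * |transport (deriv φ) ψ (x, accelerate (φ x) ξ)|
      ≤ |G ξ * ξ.1| / m * C := by gcongr
    _ = C / m * |G ξ * ξ.1| := by ring

/-- Parametrised by `x`, the characteristic is `accelerate (φ x) ξ`. Along it `d/dx` is the Vlasov
operator divided by the speed, and this factor matches the Jacobian of the change of velocities. -/
theorem hasDerivAt_along_characteristic (hφ : ContDiff ℝ 1 φ) (hψ : ContDiff ℝ 1 ψ)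
    {x : ℝ} {ξ : Vel} (h : 0 < ξ.1 ^ 2 + 2 * φ x) :
    HasDerivAt (fun y => ψ (y, accelerate (φ y) ξ))
      ((√(ξ.1 ^ 2 + 2 * φ x))⁻¹ * transport (deriv φ) ψ (x, accelerate (φ x) ξ)) x := by
  have he : √(ξ.1 ^ 2 + 2 * φ x) ≠ 0 := (Real.sqrt_pos.2 h).ne'
  have h1 : HasDerivAt (fun y => ξ.1 ^ 2 + 2 * φ y) (2 * deriv φ x) x :=
    (((hφ.differentiable one_ne_zero) x).hasDerivAt.const_mul 2).const_add _
  have h2 : HasDerivAt (fun y => ((y, accelerate (φ y) ξ) : ℝ × Vel))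
      (1, (2 * deriv φ x / (2 * √(ξ.1 ^ 2 + 2 * φ x)), 0)) x :=
    (hasDerivAt_id x).prodMk ((h1.sqrt h.ne').prodMk (hasDerivAt_const x ξ.2))
  have h3 := ((hψ.differentiable one_ne_zero) _).hasFDerivAt.comp_hasDerivAt x h2
  refine h3.congr_deriv ?_
  rw [transport_eq_fderiv]
  refine Eq.trans ?_ (map_smul (fderiv ℝ ψ (x, accelerate (φ x) ξ)) _ _)
  congr 1
  ext <;> simp [accelerate]
  · rw [inv_mul_cancel₀ he]
  · field_simp

/-- In the velocities at potential `0` the integrand becomes an exact `x`-derivative along each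
characteristic. After Fubini only the wall term survives, since `ψ` has compact support, and the
change of velocities is undone at `x = 0`. -/
theorem integral_beam_transport (hr : 0 < r) (hδ : 2 * δ < r ^ 2) (hG : IsProfile r G)
    (hφ : ContDiff ℝ 1 φ) (hb : ∀ x, 0 ≤ x → |φ x| ≤ δ) (hψ : ContDiff ℝ 1 ψ)
    (hc : HasCompactSupport ψ) :
    ∫ p in Ioi (0 : ℝ) ×ˢ (univ : Set Vel), beam G (φ p.1) p.2 * transport (deriv φ) ψ p
      = -∫ ξ, beam G (φ 0) ξ * (ξ.1 * ψ (0, ξ)) := by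
  have hq : Continuous (deriv φ) := hφ.continuous_deriv le_rfl
  have hT := continuous_transport hq hψ
  have hTc := hasCompactSupport_transport (deriv φ) hc
  have hsmall : ∀ x, 0 ≤ x → 2 * |φ x| < r ^ 2 := fun x hx => by linarith [hb x hx]
  have hint : Integrable fun p : ℝ × Vel => beam G (φ p.1) p.2 * transport (deriv φ) ψ p :=
    integrable_beam_mul hG hφ.continuous.measurable (hT.integrable_of_hasCompactSupport hTc)
  obtain ⟨B, hB, hBi, hBx⟩ := integrable_profile_transport hr hδ hG hφ hb hψ hc
  have hmeas : Measurable fun p : ℝ × Vel => G p.2 * (p.2.1 / √(p.2.1 ^ 2 + 2 * φ p.1)) *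
        transport (deriv φ) ψ (p.1, accelerate (φ p.1) p.2) := by
    have h1 : Measurable fun p : ℝ × Vel => √(p.2.1 ^ 2 + 2 * φ p.1) :=
      Continuous.measurable (by have := hφ.continuous; fun_prop)
    have h2 : Measurable fun p : ℝ × Vel =>
        transport (deriv φ) ψ (p.1, accelerate (φ p.1) p.2) := by
      refine (hT.comp ?_).measurable
      have := hφ.continuous
      unfold accelerate
      fun_prop
    exact ((hG.continuous.measurable.comp measurable_snd).mul
      ((measurable_fst.comp measurable_snd).div h1)).mul h2
  have hint2 : Integrable (fun p : ℝ × Vel => G p.2 * (p.2.1 / √(p.2.1 ^ 2 + 2 * φ p.1)) *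
        transport (deriv φ) ψ (p.1, accelerate (φ p.1) p.2))
        ((volume.restrict (Ioi 0)).prod volume) := by
    refine hBi.mono' hmeas.aestronglyMeasurable ?_
    have : ∀ᵐ p : ℝ × Vel ∂((volume.restrict (Ioi (0 : ℝ))).prod volume), 0 < p.1 :=
      Measure.quasiMeasurePreserving_fst.ae (ae_restrict_mem measurableSet_Ioi)
    filter_upwards [this] with p hp using hB p.1 p.2 hp
  calc ∫ p in Ioi (0 : ℝ) ×ˢ (univ : Set Vel), beam G (φ p.1) p.2 * transport (deriv φ) ψ p
      = ∫ x in Ioi (0 : ℝ), ∫ ξ, beam G (φ x) ξ * transport (deriv φ) ψ (x, ξ) := by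
        rw [Measure.volume_eq_prod, setIntegral_prod _ (by
          rw [← Measure.volume_eq_prod]; exact hint.integrableOn)]
        simp only [Measure.restrict_univ]
    _ = ∫ x in Ioi (0 : ℝ), ∫ ξ, G ξ * (ξ.1 / √(ξ.1 ^ 2 + 2 * φ x)) *
          transport (deriv φ) ψ (x, accelerate (φ x) ξ) := by
        refine setIntegral_congr_fun measurableSet_Ioi fun x hx => ?_
        exact integral_beam_mul hr (hsmall x (le_of_lt hx)) hG _
    _ = ∫ ξ, ∫ x in Ioi (0 : ℝ), G ξ * (ξ.1 / √(ξ.1 ^ 2 + 2 * φ x)) *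
          transport (deriv φ) ψ (x, accelerate (φ x) ξ) := integral_integral_swap hint2
    _ = ∫ ξ, -(G ξ * (ξ.1 / √(ξ.1 ^ 2 + 2 * φ 0)) *
          ((accelerate (φ 0) ξ).1 * ψ (0, accelerate (φ 0) ξ))) := by
        refine integral_congr_ae (Eventually.of_forall fun ξ => ?_)
        dsimp only
        rcases le_or_gt ξ.1 r with hξ | hξ
        · simp [hG.eq_zero ξ hξ]
        have hd : ∀ x, 0 ≤ x → HasDerivAt (fun y => G ξ * ξ.1 * ψ (y, accelerate (φ y) ξ))
            (G ξ * (ξ.1 / √(ξ.1 ^ 2 + 2 * φ x)) *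
              transport (deriv φ) ψ (x, accelerate (φ x) ξ)) x := fun x hx => by
          refine ((hasDerivAt_along_characteristic hφ hψ
            (energy_pos (hsmall x hx) hr hξ)).const_mul (G ξ * ξ.1)).congr_deriv ?_
          ring
        obtain ⟨X, hX0, hX⟩ := exists_eq_zero_of_lt hc
        have hlim : Tendsto (fun y => G ξ * ξ.1 * ψ (y, accelerate (φ y) ξ)) atTop (𝓝 0) := by
          refine tendsto_const_nhds.congr' ?_
          filter_upwards [eventually_gt_atTop X] with y hy
          rw [hX _ hy, mul_zero]
        have hi : IntegrableOn (fun x => G ξ * (ξ.1 / √(ξ.1 ^ 2 + 2 * φ x)) *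
              transport (deriv φ) ψ (x, accelerate (φ x) ξ)) (Ioi 0) := by
          refine (hBx ξ).mono' (hmeas.comp measurable_prodMk_right).aestronglyMeasurable ?_
          filter_upwards [ae_restrict_mem measurableSet_Ioi] with x hx using hB x ξ hx
        rw [integral_Ioi_of_hasDerivAt_of_tendsto (hd 0 le_rfl).continuousAt.continuousWithinAt
          (fun x hx => hd x (le_of_lt hx)) hi hlim]
        have he : √(ξ.1 ^ 2 + 2 * φ 0) ≠ 0 :=
          (Real.sqrt_pos.2 (energy_pos (hsmall 0 le_rfl) hr hξ)).ne'
        simp only [accelerate]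
        field_simp
        ring
    _ = -∫ ξ, beam G (φ 0) ξ * (ξ.1 * ψ (0, ξ)) := by
        rw [integral_neg, integral_beam_mul hr (hsmall 0 le_rfl) hG]

end Sheath

namespace Sheath

/-! ### Continuous curves in `L¹` -/

theorem abs_integral_mul_le {g k : Vel → ℝ} {C : ℝ} (hg : Integrable g)
    (hk : ∀ ξ, |k ξ| ≤ C) : |∫ ξ, g ξ * k ξ| ≤ C * (eLpNorm g 1 volume).toReal := by
  have h1 : (eLpNorm g 1 volume).toReal = ∫ ξ, ‖g ξ‖ := by
    rw [eLpNorm_one_eq_lintegral_enorm, integral_norm_eq_lintegral_enorm hg.aestronglyMeasurable]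
  rw [h1, ← integral_const_mul, ← Real.norm_eq_abs]
  refine norm_integral_le_of_norm_le (hg.norm.const_mul C) (ae_of_all _ fun ξ => ?_)
  rw [norm_mul, mul_comm]
  exact mul_le_mul_of_nonneg_right (hk ξ) (norm_nonneg _)

/-- The regularity of the difference of two solutions, and its decay at infinity. -/
structure IsDecayingCurve (D : ℝ × Vel → ℝ) : Prop where
  locallyIntegrable : LocallyIntegrableOn D (Ici (0 : ℝ) ×ˢ (univ : Set Vel))
  integrable_slice : ∀ x : ℝ, 0 ≤ x → Integrable fun ξ => D (x, ξ)
  continuous_slice : ∀ x₀ : ℝ, 0 ≤ x₀ →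
    Tendsto (fun x => eLpNorm (fun ξ => D (x, ξ) - D (x₀, ξ)) 1 volume) (𝓝[Ici 0] x₀) (𝓝 0)
  tendsto_zero : Tendsto (fun x => eLpNorm (fun ξ => D (x, ξ)) 1 volume) atTop (𝓝 0)

variable {D B : ℝ × Vel → ℝ}

/-- The variation of `D` is controlled in `L¹` against the bound `C` on `B`. The variation of `B` is
handled by dominated convergence with `D (x₀, ·)` frozen, so no uniform continuity of `B` is needed.
-/
theorem IsDecayingCurve.continuousOn_pairing (hD : IsDecayingCurve D) (hB : Continuous B) {C : ℝ}
    (hC : ∀ x ξ, 0 ≤ x → |B (x, ξ)| ≤ C) :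
    ContinuousOn (fun x => ∫ ξ, D (x, ξ) * B (x, ξ)) (Ici 0) := by
  intro x₀ hx₀
  have hC0 : 0 ≤ C := (abs_nonneg _).trans (hC 0 0 le_rfl)
  have hBm : ∀ x, AEStronglyMeasurable (fun ξ => B (x, ξ)) volume := fun x =>
    (hB.comp (by fun_prop)).aestronglyMeasurable
  have hi : ∀ x y, 0 ≤ x → 0 ≤ y → Integrable fun ξ => D (x, ξ) * B (y, ξ) := fun x y hx hy =>
    (hD.integrable_slice x hx).mul_bdd (c := C) (hBm y) (ae_of_all _ fun ξ => hC y ξ hy)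
  have h1 : Tendsto (fun x => ∫ ξ, (D (x, ξ) - D (x₀, ξ)) * B (x, ξ)) (𝓝[Ici 0] x₀) (𝓝 0) := by
    have h2 : Tendsto (fun x => C * (eLpNorm (fun ξ => D (x, ξ) - D (x₀, ξ)) 1 volume).toReal)
        (𝓝[Ici 0] x₀) (𝓝 (C * 0)) :=
      ((ENNReal.tendsto_toReal ENNReal.zero_ne_top).comp (hD.continuous_slice x₀ hx₀)).const_mul C
    rw [mul_zero] at h2
    refine squeeze_zero_norm' ?_ h2
    filter_upwards [self_mem_nhdsWithin] with x hx
    exact abs_integral_mul_le ((hD.integrable_slice x hx).sub (hD.integrable_slice x₀ hx₀))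
      fun ξ => hC x ξ hx
  have h2 : Tendsto (fun x => ∫ ξ, D (x₀, ξ) * B (x, ξ)) (𝓝[Ici 0] x₀)
      (𝓝 (∫ ξ, D (x₀, ξ) * B (x₀, ξ))) := by
    refine tendsto_integral_filter_of_dominated_convergence (fun ξ => C * ‖D (x₀, ξ)‖) ?_ ?_
      ((hD.integrable_slice x₀ hx₀).norm.const_mul C) ?_
    · filter_upwards [self_mem_nhdsWithin] with x hx using (hi x₀ x hx₀ hx).aestronglyMeasurable
    · filter_upwards [self_mem_nhdsWithin] with x hx
      refine ae_of_all _ fun ξ => ?_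
      rw [norm_mul, mul_comm]
      exact mul_le_mul_of_nonneg_right (hC x ξ hx) (norm_nonneg _)
    · refine ae_of_all _ fun ξ => ?_
      have : Continuous fun x => D (x₀, ξ) * B (x, ξ) := by fun_prop
      exact (this.tendsto x₀).mono_left nhdsWithin_le_nhds
  have h3 := h1.add h2
  rw [zero_add] at h3
  refine h3.congr' ?_
  filter_upwards [self_mem_nhdsWithin] with x hx
  have hsub : Integrable fun ξ => (D (x, ξ) - D (x₀, ξ)) * B (x, ξ) :=
    ((hi x x hx hx).sub (hi x₀ x hx₀ hx)).congr (ae_of_all _ fun ξ => by simp [sub_mul])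
  rw [← integral_add hsub (hi x₀ x hx₀ hx)]
  congr 1
  ext ξ
  ring

theorem IsDecayingCurve.tendsto_pairing (hD : IsDecayingCurve D) {C : ℝ}
    (hC : ∀ x ξ, 0 ≤ x → |B (x, ξ)| ≤ C) :
    Tendsto (fun x => ∫ ξ, D (x, ξ) * B (x, ξ)) atTop (𝓝 0) := by
  have h2 : Tendsto (fun x => C * (eLpNorm (fun ξ => D (x, ξ)) 1 volume).toReal)
      atTop (𝓝 (C * 0)) :=
    ((ENNReal.tendsto_toReal ENNReal.zero_ne_top).comp hD.tendsto_zero).const_mul C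
  rw [mul_zero] at h2
  refine squeeze_zero_norm' ?_ h2
  filter_upwards [eventually_ge_atTop (0 : ℝ)] with x hx
  exact abs_integral_mul_le (hD.integrable_slice x hx) fun ξ => hC x ξ hx

theorem integrableOn_mul_of_hasCompactSupport
    (hD : LocallyIntegrableOn D (Ici (0 : ℝ) ×ˢ (univ : Set Vel))) {k : ℝ × Vel → ℝ}
    (hk : Continuous k) (hc : HasCompactSupport k) :
    IntegrableOn (fun p => D p * k p) (Ioi (0 : ℝ) ×ˢ (univ : Set Vel)) := by
  have h1 : LocallyIntegrable D (volume.restrict (Ici (0 : ℝ) ×ˢ (univ : Set Vel))) :=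
    (locallyIntegrableOn_iff_locallyIntegrable_restrict (isClosed_Ici.prod isClosed_univ)).1 hD
  have h2 := h1.integrable_smul_left_of_hasCompactSupport hk hc
  have h3 : IntegrableOn (fun p => D p * k p) (Ici (0 : ℝ) ×ˢ (univ : Set Vel)) := by
    refine h2.congr (ae_of_all _ fun p => ?_)
    simp [mul_comm]
  exact h3.mono_set (prod_mono Ioi_subset_Ici_self subset_rfl)

theorem setIntegral_prod_mul
    (hD : LocallyIntegrableOn D (Ici (0 : ℝ) ×ˢ (univ : Set Vel))) {k : ℝ × Vel → ℝ}
    (hk : Continuous k) (hc : HasCompactSupport k) :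
    ∫ p in Ioi (0 : ℝ) ×ˢ (univ : Set Vel), D p * k p
      = ∫ x in Ioi (0 : ℝ), ∫ ξ, D (x, ξ) * k (x, ξ) := by
  rw [Measure.volume_eq_prod, setIntegral_prod _ (by
    rw [← Measure.volume_eq_prod]; exact integrableOn_mul_of_hasCompactSupport hD hk hc)]
  simp only [Measure.restrict_univ]

/-- A function with vanishing weak derivative which tends to zero at infinity vanishes. -/
theorem eq_zero_of_weak_deriv {M : ℝ → ℝ} {a : ℝ} (ha : 0 ≤ a) (hM : ContinuousOn M (Ioi a))
    (hlim : Tendsto M atTop (𝓝 0))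
    (hweak : ∀ (χ : ℝ → ℝ) (p : ℝ), a < p → ContDiff ℝ 1 χ → HasCompactSupport χ →
      (∀ x ≤ p, χ x = 0) → ∫ x in Ioi (0 : ℝ), deriv χ x * M x = 0) :
    ∀ x, a < x → M x = 0 := by
  intro x₀ hx₀
  obtain ⟨p, hap, hpx⟩ := exists_between hx₀
  refine tendsto_nhds_unique (l := atTop) (tendsto_const_nhds (x := M x₀)) (hlim.congr' ?_)
  filter_upwards [eventually_gt_atTop x₀] with y hy
  have hpq : p < y + 1 := by linarith
  -- The window `(p, q)` contains both `x₀` and `y`. Constancy of `M` on it gives `M x₀ = M y` for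
  -- every large `y`, and the right side tends to zero.
  set q := y + 1 with hq
  set w : ℝ → ℝ := fun x => max (x - p) 0 * max (q - x) 0 with hw
  have hwc : Continuous w := by fun_prop
  have hw0 : ∀ x, 0 ≤ w x := fun x => mul_nonneg (le_max_right _ _) (le_max_right _ _)
  have hwout : ∀ x, x ∉ Ioo p q → w x = 0 := fun x hx => by
    rw [mem_Ioo, not_and_or, not_lt, not_lt] at hx
    rcases hx with hx | hx
    · simp [hw, max_eq_right (sub_nonpos.2 hx)]
    · simp [hw, max_eq_right (sub_nonpos.2 hx)]
  have hwin : ∀ x ∈ Ioo p q, 0 < w x := fun x hx =>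
    mul_pos (lt_max_of_lt_left (sub_pos.2 hx.1)) (lt_max_of_lt_left (sub_pos.2 hx.2))
  -- Clamping the argument to `[p, q]` makes `M`, continuous only beyond `a`, into a function
  -- continuous on the whole line.
  set N : ℝ → ℝ := fun x => M (max p (min x q)) with hN
  have hNc : Continuous N := hM.comp_continuous (by fun_prop) fun x =>
    lt_of_lt_of_le hap (le_max_left _ _)
  have hNM : ∀ x ∈ Icc p q, N x = M x := fun x hx => by
    simp only [hN, min_eq_left hx.2, max_eq_right hx.1]
  have hW : 0 < ∫ x in p..q, w x :=
    intervalIntegral.intervalIntegral_pos_of_pos_on (hwc.intervalIntegrable _ _) hwin hpq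
  -- The `w`-weighted mean. With it `w (N - c)` has zero integral, so its primitive `χ` is an
  -- admissible compactly supported test function.
  set c := (∫ x in p..q, w x * N x) / ∫ x in p..q, w x with hc
  set g : ℝ → ℝ := fun x => w x * (N x - c) with hg
  have hgc : Continuous g := by fun_prop
  have hg0 : ∫ x in p..q, g x = 0 := by
    have h1 : ∀ x, g x = w x * N x - w x * c := fun x => by simp only [hg]; ring
    simp_rw [h1]
    rw [intervalIntegral.integral_sub
      (Continuous.intervalIntegrable (by fun_prop) _ _)
      (Continuous.intervalIntegrable (by fun_prop) _ _), intervalIntegral.integral_mul_const, hc,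
      mul_div_cancel₀ _ hW.ne', sub_self]
  have hgout : ∀ x, x ∉ Ioo p q → g x = 0 := fun x hx => by simp [hg, hwout x hx]
  set χ : ℝ → ℝ := fun x => ∫ t in p..x, g t with hχ
  have hχd : deriv χ = g := funext fun x => hgc.deriv_integral g p x
  have hχ1 : ContDiff ℝ 1 χ := by
    rw [contDiff_one_iff_deriv, hχd]
    exact ⟨fun x => (intervalIntegral.integral_hasDerivAt_right (hgc.intervalIntegrable _ _)
      (hgc.stronglyMeasurableAtFilter _ _) hgc.continuousAt).differentiableAt, hgc⟩
  have hχp : ∀ x ≤ p, χ x = 0 := fun x hx => by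
    have : ∫ t in p..x, g t = ∫ t in p..x, (0 : ℝ) := by
      refine intervalIntegral.integral_congr fun t ht => ?_
      rw [uIcc_of_ge hx] at ht
      exact hgout t fun h => absurd h.1 (not_lt.2 ht.2)
    simp [hχ, this]
  have hχq : ∀ x, q ≤ x → χ x = 0 := fun x hx => by
    have h1 : ∫ t in q..x, g t = ∫ t in q..x, (0 : ℝ) := by
      refine intervalIntegral.integral_congr fun t ht => ?_
      rw [uIcc_of_le hx] at ht
      exact hgout t fun h => absurd h.2 (not_lt.2 ht.1)
    simp only [hχ]
    rw [← intervalIntegral.integral_add_adjacent_intervals (hgc.intervalIntegrable p q)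
      (hgc.intervalIntegrable q x), hg0, h1]
    simp
  have hχc : HasCompactSupport χ := HasCompactSupport.intro (isCompact_Icc (a := p) (b := q))
    fun x hx => by
      rw [mem_Icc, not_and_or, not_le, not_le] at hx
      rcases hx with hx | hx
      · exact hχp x hx.le
      · exact hχq x hx.le
  have key := hweak χ p hap hχ1 hχc hχp
  rw [hχd] at key
  have h1 : ∫ x in Ioi (0 : ℝ), g x * M x = ∫ x in p..q, g x * N x := by
    rw [intervalIntegral.integral_of_le hpq.le]
    symm
    have e1 : ∫ x in Ioc p q, g x * N x = ∫ x in Ioc p q, g x * M x :=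
      setIntegral_congr_fun measurableSet_Ioc fun x hx => by
        simp only [hNM x ⟨hx.1.le, hx.2⟩]
    rw [e1]
    refine (setIntegral_eq_of_subset_of_forall_sdiff_eq_zero measurableSet_Ioi
      (fun x hx => lt_of_le_of_lt (ha.trans hap.le) hx.1) fun x hx => ?_).symm
    rw [hgout x fun h => hx.2 ⟨h.1, h.2.le⟩, zero_mul]
  rw [h1] at key
  -- Testing with `χ` yields `∫ g N = 0`. Together with `∫ g = 0` this is the weighted variance of
  -- `N`, which forces `N = c` inside the window.
  have h2 : ∫ x in p..q, w x * (N x - c) ^ 2 = 0 := by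
    have e : ∀ x, w x * (N x - c) ^ 2 = g x * N x - c * g x := fun x => by
      simp only [hg]; ring
    simp_rw [e]
    rw [intervalIntegral.integral_sub
      (Continuous.intervalIntegrable (by fun_prop) _ _)
      (Continuous.intervalIntegrable (by fun_prop) _ _), intervalIntegral.integral_const_mul,
      key, hg0, mul_zero, sub_zero]
  have h3 : ∀ x ∈ Ioo p q, N x = c := by
    intro x hx
    by_contra hne
    have h4 : 0 < ∫ x in p..q, w x * (N x - c) ^ 2 := by
      refine intervalIntegral.integral_pos hpq (by fun_prop)
        (fun t _ => mul_nonneg (hw0 t) (sq_nonneg _)) ⟨x, ⟨hx.1.le, hx.2.le⟩, ?_⟩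
      have := sub_ne_zero.2 hne
      have := hwin x hx
      positivity
    linarith
  have hx₀m : x₀ ∈ Ioo p q := ⟨hpx, by linarith⟩
  have hym : y ∈ Ioo p q := ⟨by linarith, by linarith⟩
  rw [← hNM y (Ioo_subset_Icc_self hym), ← hNM x₀ (Ioo_subset_Icc_self hx₀m), h3 y hym, h3 x₀ hx₀m]

/-! ### Test functions which are transported by the flow -/

/-- The Vlasov operator at a point is a directional derivative, so one-variable calculus along the
tangent line computes it. -/
theorem transport_eq_of_hasDerivAt {q : ℝ → ℝ} {ψ : ℝ × Vel → ℝ} {x : ℝ} {ξ : Vel} {d : ℝ}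
    (hψ : DifferentiableAt ℝ ψ (x, ξ))
    (h : HasDerivAt (fun τ => ψ (x + τ * ξ.1, (ξ.1 + τ * q x, ξ.2))) d 0) :
    transport q ψ (x, ξ) = d := by
  have h1 : HasDerivAt (fun τ : ℝ => ((x + τ * ξ.1, (ξ.1 + τ * q x, ξ.2)) : ℝ × Vel))
      (ξ.1, (q x, 0)) 0 := by
    have e1 : HasDerivAt (fun τ : ℝ => x + τ * ξ.1) ξ.1 0 := by
      simpa using ((hasDerivAt_id (0 : ℝ)).mul_const ξ.1).const_add x
    have e2 : HasDerivAt (fun τ : ℝ => ξ.1 + τ * q x) (q x) 0 := by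
      simpa using ((hasDerivAt_id (0 : ℝ)).mul_const (q x)).const_add ξ.1
    exact e1.prodMk (e2.prodMk (hasDerivAt_const _ _))
  have h2 : HasFDerivAt ψ (fderiv ℝ ψ (x, ξ)) (x + 0 * ξ.1, (ξ.1 + 0 * q x, ξ.2)) := by
    simpa using hψ.hasFDerivAt
  rw [transport_eq_fderiv]
  exact (h2.comp_hasDerivAt (0 : ℝ) h1).unique h

variable {φ l χ σ : ℝ → ℝ} {Γ : Vel → ℝ}

theorem contDiff_transported (hφ : ContDiff ℝ 1 φ) (hl : ContDiff ℝ 1 l) (hχ : ContDiff ℝ 1 χ)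
    (hσ : ContDiff ℝ 1 σ) (hΓ : ContDiff ℝ 1 Γ) (c : ℝ) :
    ContDiff ℝ 1 fun p : ℝ × Vel => (l p.1 + χ p.1 * σ p.2.1) *
      Γ (p.2.1 ^ 2 - 2 * φ p.1 + c, p.2.2) := by
  fun_prop

/-- `ξ₁² - 2φ` and `ξ'` are invariants of the flow, so the factor `Γ` contributes nothing and only
the prefactor is differentiated. -/
theorem transport_transported (hφ : ContDiff ℝ 1 φ) (hl : ContDiff ℝ 1 l) (hχ : ContDiff ℝ 1 χ)
    (hσ : ContDiff ℝ 1 σ) (hΓ : ContDiff ℝ 1 Γ) (c x : ℝ) (ξ : Vel) :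
    transport (deriv φ) (fun p : ℝ × Vel => (l p.1 + χ p.1 * σ p.2.1) *
      Γ (p.2.1 ^ 2 - 2 * φ p.1 + c, p.2.2)) (x, ξ)
      = (ξ.1 * (deriv l x + deriv χ x * σ ξ.1) + deriv φ x * (χ x * deriv σ ξ.1)) *
        Γ (ξ.1 ^ 2 - 2 * φ x + c, ξ.2) := by
  refine transport_eq_of_hasDerivAt
    ((contDiff_transported hφ hl hχ hσ hΓ c).differentiable one_ne_zero _) ?_
  have e1 : HasDerivAt (fun τ : ℝ => x + τ * ξ.1) ξ.1 0 := by
    simpa using ((hasDerivAt_id (0 : ℝ)).mul_const ξ.1).const_add x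
  have e2 : HasDerivAt (fun τ : ℝ => ξ.1 + τ * deriv φ x) (deriv φ x) 0 := by
    simpa using ((hasDerivAt_id (0 : ℝ)).mul_const (deriv φ x)).const_add ξ.1
  have along : ∀ {h : ℝ → ℝ}, ContDiff ℝ 1 h →
      HasDerivAt (fun τ => h (x + τ * ξ.1)) (deriv h x * ξ.1) 0 := fun {h} hh => by
    have : HasDerivAt h (deriv h x) (x + 0 * ξ.1) := by
      simpa using (hh.differentiable one_ne_zero x).hasDerivAt
    exact this.comp (0 : ℝ) e1
  have hσ' : HasDerivAt (fun τ => σ (ξ.1 + τ * deriv φ x)) (deriv σ ξ.1 * deriv φ x) 0 := by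
    have : HasDerivAt σ (deriv σ ξ.1) (ξ.1 + 0 * deriv φ x) := by
      simpa using (hσ.differentiable one_ne_zero ξ.1).hasDerivAt
    exact this.comp (0 : ℝ) e2
  have ht : HasDerivAt (fun τ => (ξ.1 + τ * deriv φ x) ^ 2 - 2 * φ (x + τ * ξ.1) + c) 0 0 := by
    have := ((e2.fun_pow 2).fun_sub ((along hφ).const_mul 2)).add_const c
    refine this.congr_deriv ?_
    simp
    ring
  have hΓ' : HasDerivAt
      (fun τ => Γ ((ξ.1 + τ * deriv φ x) ^ 2 - 2 * φ (x + τ * ξ.1) + c, ξ.2)) 0 0 := by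
    have h1 := ((hΓ.differentiable one_ne_zero)
      ((ξ.1 + 0 * deriv φ x) ^ 2 - 2 * φ (x + 0 * ξ.1) + c, ξ.2)).hasFDerivAt.comp_hasDerivAt
        (0 : ℝ) (ht.prodMk (hasDerivAt_const (0 : ℝ) ξ.2))
    refine h1.congr_deriv ?_
    exact map_zero _
  have := (((along hl).fun_add ((along hχ).fun_mul hσ')).fun_mul hΓ')
  refine this.congr_deriv ?_
  simp only [zero_mul, mul_zero, add_zero]
  ring

end Sheath

namespace Sheath

/-! ### Uniqueness for the Vlasov equation in a given potential -/

/-- The square root is singular only at `0`, where `g` vanishes identically nearby. -/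
theorem contDiff_comp_sqrt {g : Vel → ℝ} (hg : ContDiff ℝ 1 g) {ν : ℝ} (hν : 0 < ν)
    (h0 : ∀ ξ : Vel, ξ.1 < ν → g ξ = 0) : ContDiff ℝ 1 fun ξ : Vel => g (√ξ.1, ξ.2) := by
  rw [contDiff_iff_contDiffAt]
  intro ξ
  rcases lt_or_ge 0 ξ.1 with h | h
  · exact hg.contDiffAt.comp ξ ((contDiffAt_fst.sqrt h.ne').prodMk contDiffAt_snd)
  · have hev : (fun ξ : Vel => g (√ξ.1, ξ.2)) =ᶠ[𝓝 ξ] fun _ => 0 := by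
      have : ∀ᶠ ζ : Vel in 𝓝 ξ, ζ.1 < ν ^ 2 :=
        (continuous_fst.tendsto ξ).eventually (gt_mem_nhds (lt_of_le_of_lt h (by positivity)))
      filter_upwards [this] with ζ hζ
      exact h0 _ ((Real.sqrt_lt' hν).2 hζ)
    exact contDiffAt_const.congr_of_eventuallyEq hev

/-- The transition is finished already at `ν / 2`, so the step is locally constant at every point of
the closed set `|y| ≥ ν`. -/
theorem exists_smooth_step {ν : ℝ} (hν : 0 < ν) :
    ∃ S : ℝ → ℝ, ContDiff ℝ 1 S ∧ (∀ y, 0 ≤ S y) ∧ (∀ y, S y ≤ 1) ∧ (∀ y, y ≤ 0 → S y = 0) ∧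
      (∀ y, ν ≤ y → S y = 1) ∧ ∀ y, ν ≤ |y| → deriv S y = 0 := by
  have hone : ∀ y, ν / 2 ≤ y → Real.smoothTransition (2 * y / ν) = 1 := fun y hy =>
    Real.smoothTransition.one_of_one_le (by rw [le_div_iff₀ hν]; linarith)
  have hzero : ∀ y, y ≤ 0 → Real.smoothTransition (2 * y / ν) = 0 := fun y hy =>
    Real.smoothTransition.zero_of_nonpos (div_nonpos_of_nonpos_of_nonneg (by linarith) hν.le)
  refine ⟨fun y => Real.smoothTransition (2 * y / ν),
    (Real.smoothTransition.contDiff (n := 1)).comp (by fun_prop),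
    fun y => Real.smoothTransition.nonneg _, fun y => Real.smoothTransition.le_one _, hzero,
    fun y hy => hone y (by linarith), fun y hy => ?_⟩
  rcases le_abs.1 hy with h | h
  · have : (fun y => Real.smoothTransition (2 * y / ν)) =ᶠ[𝓝 y] fun _ => 1 := by
      filter_upwards [Ioi_mem_nhds (show ν / 2 < y by linarith)] with z hz using hone z (le_of_lt hz)
    rw [this.deriv_eq]; simp
  · have : (fun y => Real.smoothTransition (2 * y / ν)) =ᶠ[𝓝 y] fun _ => 0 := by
      filter_upwards [Iio_mem_nhds (show y < 0 by linarith)] with z hz using hzero z (le_of_lt hz)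
    rw [this.deriv_eq]; simp

/-- The weak Vlasov equation in the interior of the half line. -/
def IsInteriorSolution (φ : ℝ → ℝ) (D : ℝ × Vel → ℝ) : Prop :=
  ∀ ψ : ℝ × Vel → ℝ, ContDiff ℝ 1 ψ → HasCompactSupport ψ → (∀ ξ, ψ (0, ξ) = 0) →
    ∫ p in Ioi (0 : ℝ) ×ˢ (univ : Set Vel), D p * transport (deriv φ) ψ p = 0

variable {φ : ℝ → ℝ} {D : ℝ × Vel → ℝ} {δ : ℝ}

/-- Ions which cross `x₀` with a velocity in a compact set of untrapped velocities come from
infinity with velocities bounded away from zero. -/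
theorem exists_velocity_bound (hφc : Continuous φ) (hlim : Tendsto φ atTop (𝓝 0))
    (hmono : MonotoneOn φ (Ici 0) ∨ AntitoneOn φ (Ici 0)) {x₀ : ℝ} (hx₀ : 0 < x₀)
    {K : Set Vel} (hK : IsCompact K) (hKU : ∀ ξ ∈ K, 0 < ξ.1 ∧ 2 * φ x₀ < ξ.1 ^ 2) :
    ∃ a ν : ℝ, 0 ≤ a ∧ a < x₀ ∧ 0 < ν ∧ ∀ ξ ∈ K, ν ≤ ξ.1 ∧
      ∀ x, a < x → ν ^ 2 ≤ ξ.1 ^ 2 - 2 * φ x₀ + 2 * φ x := by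
  -- The margin is taken above both thresholds: `2φ(x₀)` governs a falling potential and `0` a
  -- rising one.
  obtain ⟨μ, hμ, hKμ⟩ := hK.exists_forall_le' (f := fun ξ : Vel => ξ.1 ^ 2 - max (2 * φ x₀) 0)
    (a := 0) (by fun_prop) (fun ξ hξ => by
      have h := hKU ξ hξ
      have : max (2 * φ x₀) 0 < ξ.1 ^ 2 := max_lt h.2 (by have := h.1; positivity)
      linarith)
  have hν : 0 < √(μ / 2) := Real.sqrt_pos.2 (by linarith)
  have hν2 : √(μ / 2) ^ 2 = μ / 2 := Real.sq_sqrt (by linarith)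
  have hle : ∀ ξ ∈ K, √(μ / 2) ≤ ξ.1 := fun ξ hξ => by
    refine Real.sqrt_le_iff.2 ⟨(hKU ξ hξ).1.le, ?_⟩
    have h1 := hKμ ξ hξ
    have h2 := le_max_right (2 * φ x₀) 0
    linarith
  rcases hmono with h | h
  -- Rising potential: an ion traced back towards the wall is slower than at `x₀`, so the bound is
  -- claimed only beyond a point `a` just before `x₀`.
  · have hev : ∀ᶠ x in 𝓝 x₀, φ x₀ - μ / 4 < φ x :=
      (hφc.tendsto x₀).eventually (lt_mem_nhds (by linarith))
    obtain ⟨a, ha, hau⟩ := (((hev.filter_mono nhdsWithin_le_nhds).and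
      (Ioo_mem_nhdsLT hx₀)).exists : ∃ a, φ x₀ - μ / 4 < φ a ∧ a ∈ Ioo 0 x₀)
    refine ⟨a, √(μ / 2), hau.1.le, hau.2, hν, fun ξ hξ => ⟨hle ξ hξ, fun x hx => ?_⟩⟩
    rw [hν2]
    have h1 := hKμ ξ hξ
    have h2 := le_max_right (2 * φ x₀) 0
    have h3 := h (mem_Ici.2 hau.1.le) (mem_Ici.2 (hau.1.le.trans hx.le)) hx.le
    linarith
  -- Falling potential: `φ ≥ 0` everywhere, so the kinetic energy never drops below its value at
  -- infinity, and `a = 0` works.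
  · refine ⟨0, √(μ / 2), le_rfl, hx₀, hν, fun ξ hξ => ⟨hle ξ hξ, fun x hx => ?_⟩⟩
    rw [hν2]
    have h1 := hKμ ξ hξ
    have h2 := le_max_left (2 * φ x₀) 0
    have h3 : 0 ≤ φ x := le_of_tendsto hlim (by
      filter_upwards [eventually_ge_atTop x] with y hy using h hx.le (hx.le.trans hy) hy)
    linarith

/-- Right-moving untrapped ions are determined by the datum at infinity. -/
theorem integral_mul_eq_zero_of_untrapped (hφ : ContDiff ℝ 1 φ)
    (hb : ∀ x, 0 ≤ x → |φ x| ≤ δ) (hlim : Tendsto φ atTop (𝓝 0))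
    (hmono : MonotoneOn φ (Ici 0) ∨ AntitoneOn φ (Ici 0)) (hD : IsDecayingCurve D)
    (hint : IsInteriorSolution φ D) {x₀ : ℝ} (hx₀ : 0 < x₀) {g : Vel → ℝ} (hg : ContDiff ℝ 1 g)
    (hgc : HasCompactSupport g) (hgU : ∀ ξ ∈ tsupport g, 0 < ξ.1 ∧ 2 * φ x₀ < ξ.1 ^ 2) :
    ∫ ξ, D (x₀, ξ) * (ξ.1 * g ξ) = 0 := by
  obtain ⟨a, ν, ha, hax, hν, hKν⟩ :=
    exists_velocity_bound hφ.continuous hlim hmono hx₀ hgc.isCompact hgU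
  have hsupp : ∀ ξ, g ξ ≠ 0 → ξ ∈ tsupport g := fun ξ h => subset_tsupport _ h
  obtain ⟨R, hR⟩ := hgc.isCompact.isBounded.exists_norm_le
  obtain ⟨C, hC⟩ := hgc.exists_bound_of_continuous hg.continuous
  have hC0 : 0 ≤ C := (norm_nonneg _).trans (hC 0)
  obtain ⟨S, hS, hS0, hS1, hSz, hSo, hSd⟩ := exists_smooth_step hν
  -- `g` as a function of the energy. At `x₀` the shifted energy `E` has first component `ξ₁²`, so
  -- `Γ ∘ E` gives back `g` for right-moving ions.
  set Γ : Vel → ℝ := fun ξ => g (√ξ.1, ξ.2) with hΓdef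
  have hΓ : ContDiff ℝ 1 Γ := contDiff_comp_sqrt hg hν fun ξ hξ => by
    by_contra hne
    linarith [(hKν ξ (hsupp ξ hne)).1]
  set E : ℝ × Vel → Vel := fun p => (p.2.1 ^ 2 - 2 * φ p.1 + 2 * φ x₀, p.2.2) with hE
  have hEc : Continuous E := by
    have := hφ.continuous
    fun_prop
  have hΓE : ∀ p, Γ (E p) ≠ 0 → (√(E p).1, p.2.2) ∈ tsupport g ∧ 0 < (E p).1 ∧
      (a < p.1 → ν ≤ |p.2.1|) ∧ (0 ≤ p.1 → |p.2.1| ≤ |R| + 4 * δ + 1) ∧ ‖p.2.2‖ ≤ |R| := by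
    intro p hp
    have h1 := hsupp _ hp
    have h2 : 0 < (E p).1 := Real.sqrt_pos.1 (hν.trans_le (hKν _ h1).1)
    have h3 := hR _ h1
    rw [Prod.norm_def, max_le_iff, Real.norm_eq_abs, abs_of_nonneg (Real.sqrt_nonneg _)] at h3
    refine ⟨h1, h2, fun hap => ?_, fun hp0 => ?_, h3.2.trans (le_abs_self R)⟩
    · have h4 := (hKν _ h1).2 _ hap
      simp only [Real.sq_sqrt h2.le] at h4
      refine abs_le_of_sq_le_sq' ?_ (abs_nonneg _) |>.2
      rw [sq_abs]
      simp only [hE] at h4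
      linarith
    · have h4 : (E p).1 ≤ R ^ 2 := (Real.sqrt_le_left ((Real.sqrt_nonneg _).trans h3.1)).1 h3.1
      have h5 := abs_le.1 (hb _ hp0)
      have h6 := abs_le.1 (hb _ hx₀.le)
      have h7 : 0 ≤ δ := (abs_nonneg _).trans (hb 0 le_rfl)
      simp only [hE] at h4
      refine abs_le_of_sq_le_sq' ?_ (by positivity) |>.2
      rw [sq_abs]
      have := sq_abs R
      have := abs_nonneg R
      nlinarith
  -- Opposite velocities share the same energy; the step `S` keeps only the right-moving branch. The
  -- factor `ξ₁` makes the pairing of `D` with `B` a flux, which is constant in `x`.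
  set B : ℝ × Vel → ℝ := fun p => p.2.1 * (S p.2.1 * Γ (E p)) with hB
  have hBc : Continuous B := by
    have := hΓ.continuous
    have := hS.continuous
    fun_prop
  have hBb : ∀ x ξ, 0 ≤ x → |B (x, ξ)| ≤ (|R| + 4 * δ + 1) * C := by
    intro x ξ hx
    have h7 : 0 ≤ δ := (abs_nonneg _).trans (hb 0 le_rfl)
    by_cases h : Γ (E (x, ξ)) = 0
    · simp only [hB, h, mul_zero, abs_zero]
      positivity
    · have h1 := (hΓE _ h).2.2.2.1 hx
      have h2 : |Γ (E (x, ξ))| ≤ C := hC _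
      simp only [hB, abs_mul, abs_of_nonneg (hS0 ξ.1)]
      have h3 : S ξ.1 * |Γ (E (x, ξ))| ≤ C := by
        nlinarith [hS0 ξ.1, hS1 ξ.1, abs_nonneg (Γ (E (x, ξ)))]
      exact mul_le_mul h1 h3 (mul_nonneg (hS0 _) (abs_nonneg _)) (by positivity)
  have hM : ∀ x, a < x → ∫ ξ, D (x, ξ) * B (x, ξ) = 0 := by
    refine eq_zero_of_weak_deriv ha ((hD.continuousOn_pairing hBc hBb).mono fun x hx =>
      ha.trans (le_of_lt hx)) (hD.tendsto_pairing hBb) fun χ p hap hχ hχc hχp => ?_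
    set ψ : ℝ × Vel → ℝ := fun p => (0 + χ p.1 * S p.2.1) *
      Γ (p.2.1 ^ 2 - 2 * φ p.1 + 2 * φ x₀, p.2.2) with hψ
    have hψ1 : ContDiff ℝ 1 ψ := contDiff_transported hφ contDiff_const hχ hS hΓ _
    have hψc : HasCompactSupport ψ := by
      refine HasCompactSupport.intro
        (hχc.isCompact.prod (isCompact_closedBall (0 : Vel) (|R| + 4 * δ + 1))) fun p hp => ?_
      by_contra hne
      simp only [hψ, zero_add] at hne
      have h1 : χ p.1 ≠ 0 := left_ne_zero_of_mul (left_ne_zero_of_mul hne)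
      have h2 := hΓE p (right_ne_zero_of_mul hne)
      have h3 : a < p.1 := by
        by_contra h
        exact h1 (hχp _ ((not_lt.1 h).trans hap.le))
      have h7 : 0 ≤ δ := (abs_nonneg _).trans (hb 0 le_rfl)
      refine hp ⟨subset_tsupport _ h1, ?_⟩
      rw [mem_closedBall_zero_iff, Prod.norm_def, max_le_iff]
      exact ⟨h2.2.2.2.1 (ha.trans h3.le), h2.2.2.2.2.trans (by linarith)⟩
    have hψ0 : ∀ ξ, ψ (0, ξ) = 0 := fun ξ => by
      simp only [hψ, hχp 0 (ha.trans hap.le), zero_mul, add_zero]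
    have htr : ∀ x ξ, transport (deriv φ) ψ (x, ξ) = deriv χ x * B (x, ξ) := by
      intro x ξ
      rw [hψ, transport_transported hφ contDiff_const hχ hS hΓ]
      -- `S` varies only for `|ξ₁| < ν`, but beyond `a` the support of `Γ ∘ E` has `|ξ₁| ≥ ν`, and
      -- `χ` vanishes before `a`.
      have h1 : χ x * deriv S ξ.1 * Γ (E (x, ξ)) = 0 := by
        by_contra hne
        have h1 : χ x ≠ 0 := left_ne_zero_of_mul (left_ne_zero_of_mul hne)
        have h3 : a < x := by
          by_contra h
          exact h1 (hχp _ ((not_lt.1 h).trans hap.le))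
        exact right_ne_zero_of_mul (left_ne_zero_of_mul hne)
          (hSd _ ((hΓE (x, ξ) (right_ne_zero_of_mul hne)).2.2.1 h3))
      simp only [hE] at h1
      simp only [hB, hE, deriv_const]
      linear_combination (deriv φ x) * h1
    have h1 := hint ψ hψ1 hψc hψ0
    rw [setIntegral_prod_mul hD.locallyIntegrable
      (continuous_transport (hφ.continuous_deriv le_rfl) hψ1)
      (hasCompactSupport_transport _ hψc)] at h1
    refine Eq.trans ?_ h1
    refine setIntegral_congr_fun measurableSet_Ioi fun x _ => ?_
    rw [← integral_const_mul]
    refine integral_congr_ae (ae_of_all _ fun ξ => ?_)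
    simp only [htr]
    ring
  rw [← hM x₀ hax]
  refine integral_congr_ae (ae_of_all _ fun ξ => ?_)
  simp only [hB, hE, hΓdef, sub_add_cancel, Real.sqrt_sq_eq_abs]
  congr 1
  rcases le_or_gt ξ.1 0 with h | h
  · have : g ξ = 0 := by
      by_contra hne
      linarith [(hgU ξ (hsupp ξ hne)).1]
    rw [this, hSz _ h]; ring
  · rw [abs_of_pos h, Prod.mk.eta]
    by_cases hne : g ξ = 0
    · rw [hne]; ring
    · rw [hSo _ (hKν ξ (hsupp ξ hne)).1, one_mul]

/-- The flux identity holds for all test functions on an open set of velocities, so `ξ₁ D` vanishes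
there, and `ξ₁ ≠ 0`. -/
theorem ae_eq_zero_of_untrapped (hφ : ContDiff ℝ 1 φ)
    (hb : ∀ x, 0 ≤ x → |φ x| ≤ δ) (hlim : Tendsto φ atTop (𝓝 0))
    (hmono : MonotoneOn φ (Ici 0) ∨ AntitoneOn φ (Ici 0)) (hD : IsDecayingCurve D)
    (hint : IsInteriorSolution φ D) {x₀ : ℝ} (hx₀ : 0 < x₀) :
    ∀ᵐ ξ : Vel, 0 < ξ.1 → 2 * φ x₀ < ξ.1 ^ 2 → D (x₀, ξ) = 0 := by
  set U : Set Vel := {ξ | 0 < ξ.1 ∧ 2 * φ x₀ < ξ.1 ^ 2} with hU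
  have hUo : IsOpen U := (isOpen_lt (continuous_const (y := (0 : ℝ))) continuous_fst).inter
    (isOpen_lt (continuous_const (y := 2 * φ x₀)) (continuous_fst.pow 2))
  have hloc : LocallyIntegrableOn (fun ξ : Vel => ξ.1 * D (x₀, ξ)) U := by
    refine (LocallyIntegrableOn.continuousOn_smul (f := fun ξ => D (x₀, ξ))
      (g := fun ξ : Vel => ξ.1) hUo.isLocallyClosed ?_ ?_)
    · exact (hD.integrable_slice x₀ hx₀.le).locallyIntegrable.locallyIntegrableOn U
    · exact continuous_fst.continuousOn
  have h := hUo.ae_eq_zero_of_integral_contDiff_smul_eq_zero hloc fun g hg hgc hgU => by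
    have h1 := integral_mul_eq_zero_of_untrapped hφ hb hlim hmono hD hint hx₀
      (hg.of_le (by simp)) hgc hgU
    rw [← h1]
    refine integral_congr_ae (ae_of_all _ fun ξ => ?_)
    simp only [smul_eq_mul]
    ring
  filter_upwards [h] with ξ hξ h1 h2
  exact (mul_eq_zero.1 (hξ ⟨h1, h2⟩)).resolve_left h1.ne'

end Sheath

namespace Sheath

/-! ### Reflection of the normal velocity -/

/-- Reflection of the velocity at the wall. -/
def reflect (ξ : Vel) : Vel := (-ξ.1, ξ.2)

/-- Reflection of the velocity as a homeomorphism. -/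
def reflectHomeo : Vel ≃ₜ Vel := (Homeomorph.neg ℝ).prodCongr (Homeomorph.refl (ℝ × ℝ))

theorem reflect_reflect (ξ : Vel) : reflect (reflect ξ) = ξ := by simp [reflect]

theorem measurePreserving_reflect : MeasurePreserving reflect :=
  (Measure.measurePreserving_neg volume).prod (MeasurePreserving.id volume)

theorem contDiff_reflect {n : WithTop ℕ∞} : ContDiff ℝ n reflect := by
  unfold reflect
  fun_prop

theorem continuous_reflect : Continuous reflect := reflectHomeo.continuous

theorem integral_comp_reflect (k : Vel → ℝ) : ∫ ξ, k (reflect ξ) = ∫ ξ, k ξ :=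
  measurePreserving_reflect.integral_comp reflectHomeo.measurableEmbedding k

theorem eLpNorm_comp_reflect {g : Vel → ℝ} (hg : AEStronglyMeasurable g volume) :
    eLpNorm (fun ξ => g (reflect ξ)) 1 volume = eLpNorm g 1 volume :=
  eLpNorm_comp_measurePreserving hg measurePreserving_reflect

/-- Reflection of the velocity in phase space. -/
def reflectPhase : ℝ × Vel ≃ₜ ℝ × Vel := (Homeomorph.refl ℝ).prodCongr reflectHomeo

theorem measurePreserving_reflectPhase : MeasurePreserving reflectPhase :=
  (MeasurePreserving.id volume).prod measurePreserving_reflect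

theorem reflectPhase_preimage (A : Set ℝ) :
    reflectPhase ⁻¹' (A ×ˢ (univ : Set Vel)) = A ×ˢ (univ : Set Vel) := by
  ext p
  simp [reflectPhase]

theorem setIntegral_comp_reflectPhase (A : Set ℝ) (k : ℝ × Vel → ℝ) :
    ∫ p in A ×ˢ (univ : Set Vel), k (p.1, reflect p.2) = ∫ p in A ×ˢ (univ : Set Vel), k p := by
  have := measurePreserving_reflectPhase.setIntegral_preimage_emb
    reflectPhase.measurableEmbedding k (A ×ˢ univ)
  rwa [reflectPhase_preimage] at this

theorem locallyIntegrableOn_comp_reflect {D : ℝ × Vel → ℝ}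
    (hD : LocallyIntegrableOn D (Ici (0 : ℝ) ×ˢ (univ : Set Vel))) :
    LocallyIntegrableOn (fun p => D (p.1, reflect p.2)) (Ici (0 : ℝ) ×ˢ (univ : Set Vel)) := by
  have hcl : IsClosed (Ici (0 : ℝ) ×ˢ (univ : Set Vel)) := isClosed_Ici.prod isClosed_univ
  rw [locallyIntegrableOn_iff_locallyIntegrable_restrict hcl] at hD ⊢
  have h1 := measurePreserving_reflectPhase.restrict_preimage
    (hcl.measurableSet : MeasurableSet (Ici (0 : ℝ) ×ˢ (univ : Set Vel)))
  rw [reflectPhase_preimage] at h1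
  rw [← h1.map_eq] at hD
  exact (locallyIntegrable_map_homeomorph reflectPhase).1 hD

theorem IsDecayingCurve.comp_reflect {D : ℝ × Vel → ℝ} (hD : IsDecayingCurve D) :
    IsDecayingCurve fun p => D (p.1, reflect p.2) where
  locallyIntegrable := locallyIntegrableOn_comp_reflect hD.locallyIntegrable
  integrable_slice x hx :=
    (measurePreserving_reflect.integrable_comp_emb reflectHomeo.measurableEmbedding).2
      (hD.integrable_slice x hx)
  continuous_slice x₀ hx₀ := by
    refine (hD.continuous_slice x₀ hx₀).congr' ?_
    filter_upwards [self_mem_nhdsWithin] with x hx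
    exact (eLpNorm_comp_reflect ((hD.integrable_slice x hx).sub
      (hD.integrable_slice x₀ hx₀)).aestronglyMeasurable).symm
  tendsto_zero := by
    refine hD.tendsto_zero.congr' ?_
    filter_upwards [eventually_ge_atTop (0 : ℝ)] with x hx
    exact (eLpNorm_comp_reflect (hD.integrable_slice x hx).aestronglyMeasurable).symm

/-- Reversing the normal velocity changes the sign of both terms of the operator. Left-moving ions
are therefore handled by the statements for right-moving ones. -/
theorem transport_comp_reflect {q : ℝ → ℝ} {ψ : ℝ × Vel → ℝ} (hψ : ContDiff ℝ 1 ψ) (x : ℝ)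
    (ξ : Vel) : transport q (fun p => ψ (p.1, reflect p.2)) (x, ξ)
      = -transport q ψ (x, reflect ξ) := by
  refine transport_eq_of_hasDerivAt (ContDiff.differentiable (n := 1) (hψ.comp
    (contDiff_fst.prodMk (contDiff_reflect.comp contDiff_snd))) one_ne_zero _) ?_
  have h1 : HasDerivAt (fun τ : ℝ => ((x + τ * ξ.1, reflect (ξ.1 + τ * q x, ξ.2)) : ℝ × Vel))
      (-((reflect ξ).1, (q x, 0))) 0 := by
    have e1 : HasDerivAt (fun τ : ℝ => x + τ * ξ.1) ξ.1 0 := by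
      simpa using ((hasDerivAt_id (0 : ℝ)).mul_const ξ.1).const_add x
    have e2 : HasDerivAt (fun τ : ℝ => -(ξ.1 + τ * q x)) (-q x) 0 := by
      simpa using (((hasDerivAt_id (0 : ℝ)).mul_const (q x)).const_add ξ.1).fun_neg
    refine (e1.prodMk (e2.prodMk (hasDerivAt_const _ _))).congr_deriv ?_
    simp [reflect]
  have h2 : HasFDerivAt ψ (fderiv ℝ ψ (x, reflect ξ))
      (x + 0 * ξ.1, reflect (ξ.1 + 0 * q x, ξ.2)) := by
    simpa using (hψ.differentiable one_ne_zero (x, reflect ξ)).hasFDerivAt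
  refine (h2.comp_hasDerivAt (0 : ℝ) h1).congr_deriv ?_
  rw [map_neg, transport_eq_fderiv]

theorem hasCompactSupport_comp_reflect {ψ : ℝ × Vel → ℝ} (hψ : HasCompactSupport ψ) :
    HasCompactSupport fun p : ℝ × Vel => ψ (p.1, reflect p.2) :=
  hψ.comp_homeomorph reflectPhase

theorem contDiff_comp_reflect {ψ : ℝ × Vel → ℝ} (hψ : ContDiff ℝ 1 ψ) :
    ContDiff ℝ 1 fun p : ℝ × Vel => ψ (p.1, reflect p.2) :=
  hψ.comp (contDiff_fst.prodMk (contDiff_reflect.comp contDiff_snd))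

theorem IsInteriorSolution.comp_reflect {φ : ℝ → ℝ} {D : ℝ × Vel → ℝ}
    (h : IsInteriorSolution φ D) : IsInteriorSolution φ fun p => D (p.1, reflect p.2) := by
  intro ψ hψ hc h0
  have h1 := h _ (contDiff_comp_reflect hψ) (hasCompactSupport_comp_reflect hc)
    (fun ξ => h0 (reflect ξ))
  rw [← setIntegral_comp_reflectPhase] at h1
  refine neg_eq_zero.1 (Eq.trans ?_ h1)
  rw [← integral_neg]
  refine integral_congr_ae (ae_of_all _ fun p => ?_)
  dsimp only
  rw [transport_comp_reflect hψ, reflect_reflect]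
  ring

variable {φ : ℝ → ℝ} {D : ℝ × Vel → ℝ} {δ α : ℝ}

/-- The explicit derivative is strictly negative on all of `(-∞, a)`; in the trapped case it serves
as a weight without zeros before `a`. -/
theorem exists_decreasing_cutoff (a : ℝ) : ∃ χ : ℝ → ℝ, ContDiff ℝ 1 χ ∧
    (∀ x, deriv χ x = -max (a - x) 0) ∧ ∀ x, a ≤ x → χ x = 0 := by
  have hc : Continuous fun t : ℝ => -max (a - t) 0 := by fun_prop
  have hd : deriv (fun x => ∫ t in a..x, -max (a - t) 0) = fun t => -max (a - t) 0 :=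
    funext fun x => hc.deriv_integral _ a x
  refine ⟨fun x => ∫ t in a..x, -max (a - t) 0, ?_, fun x => congrFun hd x, fun x hx => ?_⟩
  · rw [contDiff_one_iff_deriv, hd]
    exact ⟨fun x => (intervalIntegral.integral_hasDerivAt_right (hc.intervalIntegrable _ _)
      (hc.stronglyMeasurableAtFilter _ _) hc.continuousAt).differentiableAt, hc⟩
  · have : ∫ t in a..x, -max (a - t) 0 = ∫ t in a..x, (0 : ℝ) := by
      refine intervalIntegral.integral_congr fun t ht => ?_
      rw [uIcc_of_le hx] at ht
      simp [ht.1]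
    simp [this]

end Sheath

/-! ### Trapped ions and uniqueness for the homogeneous linear problem. -/

namespace Sheath

/-- The odd combination `S(y) - S(-y)` distinguishes ions leaving the wall from ions returning to
it, and `y * σ y ≥ 0` gives both the same sign of flux. -/
theorem exists_smooth_sign {ν : ℝ} (hν : 0 < ν) :
    ∃ σ : ℝ → ℝ, ContDiff ℝ 1 σ ∧ (∀ y, σ (-y) = -σ y) ∧ (∀ y, |σ y| ≤ 1) ∧
      (∀ y, 0 ≤ y * σ y) ∧ (∀ y, ν ≤ y → σ y = 1) ∧ ∀ y, ν ≤ |y| → deriv σ y = 0 := by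
  obtain ⟨S, hS, hS0, hS1, hSz, hSo, hSd⟩ := exists_smooth_step hν
  refine ⟨fun y => S y - S (-y), by fun_prop, fun y => by simp, fun y => ?_, fun y => ?_,
    fun y hy => by
      simp only [hSo y hy, hSz (-y) (show -y ≤ 0 by linarith), sub_zero], fun y hy => ?_⟩
  · rw [abs_le]
    constructor <;> linarith [hS0 y, hS1 y, hS0 (-y), hS1 (-y)]
  · rcases le_total 0 y with h | h
    · simp only [hSz (-y) (show -y ≤ 0 by linarith), sub_zero]
      exact mul_nonneg h (hS0 y)
    · simp only [hSz y h, zero_sub, mul_neg, ← neg_mul]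
      exact mul_nonneg (by linarith) (hS0 _)
  · have h1 : HasDerivAt S 0 y := hSd y hy ▸ (hS.differentiable one_ne_zero y).hasDerivAt
    have h2 : HasDerivAt S 0 (-y) :=
      hSd (-y) (by rwa [abs_neg]) ▸ (hS.differentiable one_ne_zero (-y)).hasDerivAt
    have h3 := h1.fun_sub (h2.comp y (hasDerivAt_neg y))
    simpa using h3.deriv

variable {φ : ℝ → ℝ} {D : ℝ × Vel → ℝ} {δ α : ℝ}

/-- Ions which cannot escape from the wall to infinity are absent. -/
theorem eventually_eq_zero_of_trapped (hφ : ContDiff ℝ 1 φ)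
    (hb : ∀ x, 0 ≤ x → |φ x| ≤ δ) (hlim : Tendsto φ atTop (𝓝 0)) (hanti : AntitoneOn φ (Ici 0))
    (hα1 : α < 1) (hD : IsDecayingCurve D)
    (hweak : ∀ ψ, IsTest α ψ →
      ∫ p in Ioi (0 : ℝ) ×ˢ (univ : Set Vel), D p * transport (deriv φ) ψ p = 0)
    (hnn : ∀ x, 0 < x → ∀ᵐ ξ : Vel, ξ.1 ^ 2 < 2 * φ x → 0 ≤ D (x, ξ))
    {x₀ : ℝ} (hx₀ : 0 < x₀) {ξ₀ : Vel} (hξ₀ : ξ₀.1 ≠ 0) (htr : ξ₀.1 ^ 2 < 2 * φ x₀) :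
    ∃ u ∈ 𝓝 ξ₀, ∀ᵐ ξ : Vel, ξ ∈ u → D (x₀, ξ) = 0 := by
  set t₀ := ξ₀.1 ^ 2 - 2 * φ x₀ with ht₀
  have ht₀neg : t₀ < 0 := by linarith
  have hκ : 0 < ξ₀.1 ^ 2 := by positivity
  have hδ0 : 0 ≤ δ := (abs_nonneg _).trans (hb 0 le_rfl)
  -- `a` is so close to `x₀` that ions with energy near `t₀` keep speed at least `|ξ₀.1| / 2` on all
  -- of `[0, a]`: their turning points lie beyond `a`.
  obtain ⟨a, hφa, hxa⟩ : ∃ a, φ x₀ - ξ₀.1 ^ 2 / 8 < φ a ∧ x₀ < a := by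
    have hev : ∀ᶠ x in 𝓝 x₀, φ x₀ - ξ₀.1 ^ 2 / 8 < φ x :=
      (hφ.continuous.tendsto x₀).eventually (lt_mem_nhds (by linarith))
    exact ((hev.filter_mono nhdsWithin_le_nhds).and
      (self_mem_nhdsWithin : Ioi x₀ ∈ 𝓝[>] x₀)).exists
  -- The first bound on the energy window protects the speed on `[0, a]`; the second keeps all
  -- energies below `t₀ / 2 < 0`, hence trapped.
  set η := min (ξ₀.1 ^ 2 / 4) (-t₀ / 2) with hη
  have hη0 : 0 < η := lt_min (by linarith) (by linarith)
  have hη1 : η ≤ ξ₀.1 ^ 2 / 4 := min_le_left _ _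
  have hη2 : η ≤ -t₀ / 2 := min_le_right _ _
  let Γ : ContDiffBump ((t₀, ξ₀.2) : Vel) := ⟨η / 2, η, half_pos hη0, half_lt_self hη0⟩
  have hΓ : ContDiff ℝ 1 Γ := Γ.contDiff
  set ν := |ξ₀.1| / 2 with hν
  have hν0 : 0 < ν := by positivity
  have hν2 : ν ^ 2 = ξ₀.1 ^ 2 / 4 := by rw [hν, div_pow, sq_abs]; norm_num
  set E : ℝ × Vel → Vel := fun p => (p.2.1 ^ 2 - 2 * φ p.1 + 0, p.2.2) with hE
  have hEc : Continuous E := by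
    have := hφ.continuous
    fun_prop
  have hΓE : ∀ p, Γ (E p) ≠ 0 → p.2.1 ^ 2 - 2 * φ p.1 < t₀ / 2 ∧
      (0 ≤ p.1 → p.1 ≤ a → ν ≤ |p.2.1|) ∧ ‖p.2.2‖ ≤ ‖ξ₀.2‖ + η := by
    intro p hp
    have h1 : dist (E p) (t₀, ξ₀.2) < η := by
      by_contra h
      exact hp (Γ.zero_of_le_dist (not_lt.1 h))
    rw [Prod.dist_eq, max_lt_iff, Real.dist_eq, abs_lt] at h1
    simp only [hE, add_zero] at h1
    refine ⟨by linarith [h1.1.2], fun hp0 hpa => ?_, ?_⟩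
    · have h2 := hanti (mem_Ici.2 hp0) (mem_Ici.2 (hp0.trans hpa)) hpa
      refine (abs_le_of_sq_le_sq' ?_ (abs_nonneg _)).2
      rw [sq_abs, hν2]
      linarith [h1.1.1]
    · have h2 := norm_le_norm_add_norm_sub' p.2.2 ξ₀.2
      rw [dist_eq_norm] at h1
      linarith [h1.2]
  obtain ⟨σ, hσ, hσodd, hσ1, hσnn, hσone, hσd⟩ := exists_smooth_sign hν0
  obtain ⟨S, hS, hS0, hS1, hSz, hSo, hSd⟩ := exists_smooth_step one_pos
  -- `θ` acts only at negative `x`: test functions must have compact support in the whole line,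
  -- while only `x ≥ 0` enters the equation.
  set θ : ℝ → ℝ := fun x => S (x + 1) with hθ
  have hθ1 : ContDiff ℝ 1 θ := by fun_prop
  have hθone : ∀ x, 0 ≤ x → θ x = 1 := fun x hx => hSo _ (by linarith)
  have hθd : ∀ x, 0 ≤ x → deriv θ x = 0 := fun x hx => by
    rw [hθ, deriv_comp_add_const]
    exact hSd _ (by rw [abs_of_nonneg (by linarith)]; linarith)
  obtain ⟨χ, hχ, hχd, hχz⟩ := exists_decreasing_cutoff a
  -- On the support of `Γ` at the wall `σ = ±1`, so `l + kσ` equals `2χ(0)` for outgoing and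
  -- `2αχ(0)` for returning ions. This is the reflection condition.
  set l : ℝ → ℝ := fun x => θ x * ((1 + α) * χ 0) with hl
  set k : ℝ → ℝ := fun x => (1 - α) * (θ x * χ x) with hk
  have hl1 : ContDiff ℝ 1 l := by fun_prop
  have hk1 : ContDiff ℝ 1 k := by fun_prop
  have hld : ∀ x, 0 ≤ x → deriv l x = 0 := fun x hx => by
    rw [hl, deriv_mul_const (hθ1.differentiable one_ne_zero x), hθd x hx, zero_mul]
  have hkd : ∀ x, 0 ≤ x → deriv k x = (1 - α) * -max (a - x) 0 := fun x hx => by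
    have h1 := ((hθ1.differentiable one_ne_zero x).hasDerivAt.fun_mul
      (hχ.differentiable one_ne_zero x).hasDerivAt).const_mul (1 - α)
    rw [hk, h1.deriv, hθd x hx, hθone x hx, hχd x]
    ring
  set ψ : ℝ × Vel → ℝ := fun p => (l p.1 + k p.1 * σ p.2.1) *
      Γ (p.2.1 ^ 2 - 2 * φ p.1 + 0, p.2.2) with hψ
  have hψ1 : ContDiff ℝ 1 ψ := contDiff_transported hφ hl1 hk1 hσ hΓ _
  -- `l` does not decay, but energies below `t₀ / 2` cannot occur where `2φ < -t₀ / 2`; this bounds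
  -- the support of `ψ` in `x`.
  obtain ⟨X, hX⟩ : ∃ X, ∀ x, X < x → 2 * φ x < -t₀ / 2 := by
    have h1 : ∀ᶠ x in atTop, φ x < -t₀ / 4 := hlim.eventually (gt_mem_nhds (by linarith))
    obtain ⟨X, hX⟩ := eventually_atTop.1 h1
    exact ⟨X, fun x hx => by linarith [hX x hx.le]⟩
  obtain ⟨Φ, hΦ⟩ := (isCompact_Icc (a := (-1 : ℝ)) (b := X)).exists_bound_of_continuousOn
    hφ.continuous.continuousOn
  have hψc : HasCompactSupport ψ := by
    refine HasCompactSupport.intro ((isCompact_Icc (a := (-1 : ℝ)) (b := X)).prod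
      (isCompact_closedBall (0 : Vel) (max (2 * Φ + 1) (‖ξ₀.2‖ + η)))) fun p hp => ?_
    by_contra hne
    have hΓp := hΓE p (right_ne_zero_of_mul hne)
    have h1 : -1 ≤ p.1 := by
      by_contra h
      have h2 : θ p.1 = 0 := hSz _ (by linarith)
      exact left_ne_zero_of_mul hne (by simp [hl, hk, h2])
    have h2 : p.1 ≤ X := by
      by_contra! h
      have h3 := hX p.1 h
      nlinarith [hΓp.1, sq_nonneg p.2.1]
    have h3 := hΦ p.1 ⟨h1, h2⟩
    rw [Real.norm_eq_abs] at h3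
    refine hp ⟨⟨h1, h2⟩, ?_⟩
    rw [mem_closedBall_zero_iff, Prod.norm_def]
    refine max_le_max ?_ hΓp.2.2
    have h5 : 0 ≤ Φ := (abs_nonneg _).trans h3
    refine (abs_le_of_sq_le_sq' ?_ (by linarith)).2
    rw [Real.norm_eq_abs, sq_abs]
    nlinarith [hΓp.1, (abs_le.1 h3).2]
  have htest : IsTest α ψ := by
    refine ⟨hψ1, hψc, fun ξ hξ => ?_⟩
    simp only [hψ, neg_sq]
    by_cases hne : Γ (E (0, ξ)) = 0
    · simp only [hE] at hne
      rw [hne, mul_zero, mul_zero, mul_zero]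
    · have h1 := (hΓE _ hne).2.1 le_rfl (hx₀.le.trans hxa.le)
      simp only [abs_of_pos hξ] at h1
      simp only [hl, hk, hθone 0 le_rfl, hσodd, hσone _ h1]
      ring
  set B : ℝ × Vel → ℝ := fun p => p.2.1 * σ p.2.1 * Γ (E p) with hB
  have hBc : Continuous B := by
    have := hΓ.continuous
    have := hσ.continuous
    fun_prop
  have hB0 : ∀ p, 0 ≤ B p := fun p => mul_nonneg (hσnn _) Γ.nonneg
  have hBb : ∀ x ξ, 0 ≤ x → |B (x, ξ)| ≤ 2 * δ + 1 := by
    intro x ξ hx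
    by_cases h : Γ (E (x, ξ)) = 0
    · simp only [hB, h, mul_zero, abs_zero]
      positivity
    · have h1 := (hΓE _ h).1
      have h2 : |ξ.1| ≤ 2 * δ + 1 := by
        refine (abs_le_of_sq_le_sq' ?_ (by linarith)).2
        rw [sq_abs]
        have := (abs_le.1 (hb x hx)).2
        dsimp only at h1
        nlinarith
      have h3 : |σ ξ.1 * Γ (E (x, ξ))| ≤ 1 := by
        rw [abs_mul, abs_of_nonneg Γ.nonneg]
        exact mul_le_one₀ (hσ1 _) Γ.nonneg Γ.le_one
      simp only [hB]
      rw [mul_assoc, abs_mul]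
      nlinarith [abs_nonneg ξ.1]
  have htrψ : ∀ x ξ, 0 < x →
      transport (deriv φ) ψ (x, ξ) = (1 - α) * -max (a - x) 0 * B (x, ξ) := by
    intro x ξ hx
    rw [hψ, transport_transported hφ hl1 hk1 hσ hΓ, hld x hx.le, hkd x hx.le]
    have h1 : k x * deriv σ ξ.1 * Γ (E (x, ξ)) = 0 := by
      by_contra hne
      have h3 : x < a := by
        by_contra h
        exact left_ne_zero_of_mul (left_ne_zero_of_mul hne) (by simp [hk, hχz x (not_lt.1 h)])
      exact right_ne_zero_of_mul (left_ne_zero_of_mul hne)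
        (hσd _ ((hΓE (x, ξ) (right_ne_zero_of_mul hne)).2.1 hx.le h3.le))
    simp only [hE] at h1
    simp only [hB, hE]
    linear_combination (deriv φ x) * h1
  set M : ℝ → ℝ := fun x => ∫ ξ, D (x, ξ) * B (x, ξ) with hM
  have hMc : ContinuousOn M (Ici 0) := hD.continuousOn_pairing hBc hBb
  have hDB : ∀ x, 0 < x → ∀ᵐ ξ : Vel, 0 ≤ D (x, ξ) * B (x, ξ) := fun x hx => by
    filter_upwards [hnn x hx] with ξ hξ
    by_cases h : Γ (E (x, ξ)) = 0
    · simp [hB, h]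
    · have h1 := (hΓE _ h).1
      dsimp only at h1
      exact mul_nonneg (hξ (by linarith)) (hB0 _)
  have hMnn : ∀ x, 0 < x → 0 ≤ M x := fun x hx => integral_nonneg_of_ae (hDB x hx)
  -- The weak equation leaves `1 - α` times this integral. As `α < 1`, the integral vanishes, while
  -- its integrand is nonnegative.
  have hint : ∫ x in (0 : ℝ)..a, max (a - x) 0 * M x = 0 := by
    have h1 := hweak ψ htest
    rw [setIntegral_prod_mul hD.locallyIntegrable
      (continuous_transport (hφ.continuous_deriv le_rfl) hψ1)
      (hasCompactSupport_transport _ hψc)] at h1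
    have h2 : ∫ x in Ioi (0 : ℝ), ∫ ξ, D (x, ξ) * transport (deriv φ) ψ (x, ξ)
        = ∫ x in Ioi (0 : ℝ), -(1 - α) * (max (a - x) 0 * M x) := by
      refine setIntegral_congr_fun measurableSet_Ioi fun x hx => ?_
      simp only [hM]
      rw [← integral_const_mul, ← integral_const_mul]
      refine integral_congr_ae (ae_of_all _ fun ξ => ?_)
      simp only [htrψ x ξ hx]
      ring
    rw [h2, integral_const_mul] at h1
    have h3 := (mul_eq_zero.1 h1).resolve_left (by linarith)
    rw [intervalIntegral.integral_of_le (hx₀.le.trans hxa.le)]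
    refine Eq.trans (setIntegral_eq_of_subset_of_forall_sdiff_eq_zero measurableSet_Ioi
      (fun x hx => hx.1) fun x hx => ?_).symm h3
    have : a ≤ x := by
      by_contra! h
      exact hx.2 ⟨hx.1, h.le⟩
    rw [max_eq_right (by linarith), zero_mul]
  have hM0 : M x₀ = 0 := by
    by_contra hne
    have h1 : 0 < M x₀ := lt_of_le_of_ne (hMnn x₀ hx₀) (Ne.symm hne)
    have h2 : 0 < ∫ x in (0 : ℝ)..a, max (a - x) 0 * M x := by
      refine intervalIntegral.integral_pos (hx₀.trans hxa)
        ((Continuous.continuousOn (by fun_prop)).mul (hMc.mono Icc_subset_Ici_self))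
        (fun x hx => mul_nonneg (le_max_right _ _) (hMnn x hx.1)) ⟨x₀, ⟨hx₀.le, hxa.le⟩, ?_⟩
      exact mul_pos (lt_max_of_lt_left (by linarith)) h1
    linarith
  have hi : Integrable fun ξ => D (x₀, ξ) * B (x₀, ξ) :=
    (hD.integrable_slice x₀ hx₀.le).mul_bdd (c := 2 * δ + 1)
      (hBc.comp (by fun_prop)).aestronglyMeasurable (ae_of_all _ fun ξ => hBb x₀ ξ hx₀.le)
  have hae := (integral_eq_zero_iff_of_nonneg_ae (hDB x₀ hx₀) hi).1 hM0
  refine ⟨{ξ | 0 < B (x₀, ξ)}, ?_, ?_⟩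
  · refine (isOpen_lt continuous_const
      (hBc.comp (g := B) (f := fun ξ : Vel => (x₀, ξ)) (by fun_prop))).mem_nhds ?_
    have h1 : Γ (E (x₀, ξ₀)) = 1 := by
      refine Γ.one_of_mem_closedBall ?_
      simp only [hE, add_zero, ← ht₀]
      exact Metric.mem_closedBall_self (half_pos hη0).le
    simp only [mem_ofPred_eq, Function.comp, hB, h1, mul_one]
    have h2 : ν ≤ |ξ₀.1| := by rw [hν]; linarith [abs_nonneg ξ₀.1]
    rcases le_abs.1 h2 with h | h
    · rw [hσone _ h]; linarith
    · have h3 := hσone _ h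
      rw [hσodd] at h3
      have h4 : σ ξ₀.1 = -1 := by linarith
      rw [h4]; linarith
  · filter_upwards [hae] with ξ hξ hpos
    exact (mul_eq_zero.1 hξ).resolve_right (ne_of_gt hpos)

/-- Removes `ξ₁ = 0` and the separatrix `ξ₁² = 2φ(x)`, on which neither the trapped nor the
untrapped argument applies. -/
theorem ae_fst_ne (c : ℝ) : ∀ᵐ ξ : Vel, ξ.1 ≠ c := by
  have h : ∀ᵐ w : ℝ, w ≠ c := by
    rw [ae_iff]; simp
  exact Measure.quasiMeasurePreserving_fst.ae h

/-- Uniqueness for the linear problem with homogeneous data. -/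
theorem ae_eq_zero_of_homogeneous (hφ : ContDiff ℝ 1 φ)
    (hb : ∀ x, 0 ≤ x → |φ x| ≤ δ) (hlim : Tendsto φ atTop (𝓝 0))
    (hmono : MonotoneOn φ (Ici 0) ∨ AntitoneOn φ (Ici 0))
    (hα1 : α < 1) (hD : IsDecayingCurve D)
    (hweak : ∀ ψ, IsTest α ψ →
      ∫ p in Ioi (0 : ℝ) ×ˢ (univ : Set Vel), D p * transport (deriv φ) ψ p = 0)
    (hnn : ∀ x, 0 < x → ∀ᵐ ξ : Vel, ξ.1 ^ 2 < 2 * φ x → 0 ≤ D (x, ξ)) :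
    ∀ x, 0 ≤ x → ∀ᵐ ξ : Vel, D (x, ξ) = 0 := by
  have hint : IsInteriorSolution φ D := fun ψ h1 h2 h3 =>
    hweak ψ ⟨h1, h2, fun ξ _ => by rw [h3, h3, mul_zero]⟩
  have hpos : ∀ x, 0 < x → ∀ᵐ ξ : Vel, D (x, ξ) = 0 := by
    intro x hx
    have h1 := ae_eq_zero_of_untrapped hφ hb hlim hmono hD hint hx
    have h2 := measurePreserving_reflect.quasiMeasurePreserving.ae
      (ae_eq_zero_of_untrapped hφ hb hlim hmono hD.comp_reflect hint.comp_reflect hx)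
    simp only [reflect_reflect] at h2
    have h3 : ∀ᵐ ξ : Vel, ξ.1 ≠ 0 → ξ.1 ^ 2 < 2 * φ x → D (x, ξ) = 0 := by
      rw [ae_iff]
      refine measure_null_of_locally_null _ fun ξ₀ hξ₀ => ?_
      simp only [mem_ofPred_eq, Classical.not_imp] at hξ₀
      -- A potential rising to zero is nonpositive and has no trapped ions; only the falling case
      -- remains.
      have hanti : AntitoneOn φ (Ici 0) := by
        rcases hmono with h | h
        · exfalso
          have : φ x ≤ 0 := ge_of_tendsto hlim (by
            filter_upwards [eventually_ge_atTop x] with y hy using h hx.le (hx.le.trans hy) hy)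
          nlinarith [sq_nonneg ξ₀.1, hξ₀.2.1]
        · exact h
      obtain ⟨u, hu, hae⟩ := eventually_eq_zero_of_trapped hφ hb hlim hanti hα1 hD hweak hnn hx
        hξ₀.1 hξ₀.2.1
      refine ⟨_ ∩ u, inter_mem_nhdsWithin _ hu, ?_⟩
      rw [ae_iff] at hae
      refine measure_mono_null ?_ hae
      rintro ξ ⟨h2, h1⟩
      simp only [mem_ofPred_eq, Classical.not_imp] at h2 ⊢
      exact ⟨h1, h2.2.2⟩
    filter_upwards [h1, h2, h3, ae_fst_ne 0, ae_fst_ne (√(2 * φ x)), ae_fst_ne (-√(2 * φ x))]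
      with ξ e1 e2 e3 n1 n2 n3
    rcases lt_trichotomy (ξ.1 ^ 2) (2 * φ x) with h | h | h
    · exact e3 n1 h
    · exfalso
      rw [← h, Real.sqrt_sq_eq_abs] at n2 n3
      rcases abs_choice ξ.1 with h4 | h4
      · exact n2 h4.symm
      · rw [h4, neg_neg] at n3
        exact n3 rfl
    · rcases lt_or_gt_of_ne n1 with h4 | h4
      · exact e2 (by simpa [reflect] using h4) (by simpa [reflect] using h)
      · exact e1 h4 h
  intro x hx
  -- At the wall itself the claim follows from `x > 0` by continuity in `L¹`.
  rcases hx.eq_or_lt with h | h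
  · subst h
    have h1 := (hD.continuous_slice 0 le_rfl).mono_left (nhdsWithin_mono 0 Ioi_subset_Ici_self)
    have h2 : Tendsto (fun _ : ℝ => eLpNorm (fun ξ => D (0, ξ)) 1 volume) (𝓝[>] 0) (𝓝 0) := by
      refine h1.congr' ?_
      filter_upwards [self_mem_nhdsWithin] with x hx
      rw [← eLpNorm_neg (f := fun ξ => D (0, ξ))]
      refine eLpNorm_congr_ae ?_
      filter_upwards [hpos x hx] with ξ hξ
      simp [hξ]
    have h3 := tendsto_nhds_unique h2 tendsto_const_nhds
    have h4 := tendsto_nhds_unique tendsto_const_nhds h2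
    exact (eLpNorm_eq_zero_iff (hD.integrable_slice 0 le_rfl).aestronglyMeasurable
      one_ne_zero).1 h4
  · exact hpos x h

end Sheath

namespace Sheath

/-! ### Mollified beams -/

variable {η : Vel → ℝ} {α mb minf vb vinf v r s ε δ : ℝ}

theorem IsMollifier.abs_lt_one (hη : IsMollifier η) {z : Vel} (hz : η z ≠ 0) :
    |z.1| < 1 ∧ |z.2.1| < 1 ∧ |z.2.2| < 1 := by
  have h := hη.support_subset (subset_tsupport _ hz)
  simp only [mem_ofPred_eq] at h
  refine ⟨?_, ?_, ?_⟩ <;> rw [abs_lt] <;> constructor <;>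
    nlinarith [sq_nonneg z.1, sq_nonneg z.2.1, sq_nonneg z.2.2]

theorem IsMollifier.norm_le_one (hη : IsMollifier η) {z : Vel} (hz : η z ≠ 0) : ‖z‖ ≤ 1 := by
  obtain ⟨h1, h2, h3⟩ := hη.abs_lt_one hz
  rw [Prod.norm_def, Prod.norm_def]
  exact max_le h1.le (max_le h2.le h3.le)

theorem IsMollifier.hasCompactSupport (hη : IsMollifier η) : HasCompactSupport η :=
  HasCompactSupport.intro (isCompact_closedBall (0 : Vel) 1) fun z hz => by
    by_contra hne
    exact hz (mem_closedBall_zero_iff.2 (hη.norm_le_one hne))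

theorem IsMollifier.continuous (hη : IsMollifier η) : Continuous η := hη.smooth.continuous

theorem IsMollifier.integrable (hη : IsMollifier η) : Integrable η :=
  hη.continuous.integrable_of_hasCompactSupport hη.hasCompactSupport

/-- An average with respect to a mollifier lies between the bounds of the averaged function. -/
theorem IsMollifier.integral_mem_Icc (hη : IsMollifier η) {F : Vel → ℝ}
    (hF : Integrable fun z => η z * F z) {a b : ℝ} (h : ∀ z, η z ≠ 0 → a ≤ F z ∧ F z ≤ b) :
    a ≤ ∫ z, η z * F z ∧ ∫ z, η z * F z ≤ b := by
  have hconst : ∀ c : ℝ, ∫ z, η z * c = c := fun c => by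
    rw [integral_mul_const, hη.integral_eq_one, one_mul]
  constructor
  · rw [← hconst a]
    refine integral_mono (hη.integrable.mul_const a) hF fun z => ?_
    by_cases hz : η z = 0
    · simp [hz]
    · exact mul_le_mul_of_nonneg_left (h z hz).1 (hη.nonneg z)
  · rw [← hconst b]
    refine integral_mono hF (hη.integrable.mul_const b) fun z => ?_
    by_cases hz : η z = 0
    · simp [hz]
    · exact mul_le_mul_of_nonneg_left (h z hz).2 (hη.nonneg z)

/-- The mollified unit mass at the velocity `(v, 0)`. -/
noncomputable def pulse (η : Vel → ℝ) (ε v : ℝ) (ξ : Vel) : ℝ :=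
  (ε ^ 3)⁻¹ * η (ε⁻¹ • (ξ - (v, 0)))

theorem pulse_nonneg (hη : IsMollifier η) (hε : 0 < ε) (ξ : Vel) : 0 ≤ pulse η ε v ξ :=
  mul_nonneg (by positivity) (hη.nonneg _)

theorem continuous_pulse (hη : IsMollifier η) : Continuous (pulse η ε v) := by
  have := hη.continuous
  unfold pulse
  fun_prop

theorem norm_sub_le_of_pulse_ne_zero (hη : IsMollifier η) (hε : 0 < ε) {ξ : Vel}
    (h : pulse η ε v ξ ≠ 0) : ‖ξ - (v, 0)‖ ≤ ε := by
  have h1 := hη.norm_le_one (right_ne_zero_of_mul h)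
  rw [norm_smul, Real.norm_eq_abs, abs_of_pos (inv_pos.2 hε), inv_mul_le_iff₀ hε, mul_one] at h1
  exact h1

theorem abs_sub_lt_of_pulse_ne_zero (hη : IsMollifier η) (hε : 0 < ε) {ξ : Vel}
    (h : pulse η ε v ξ ≠ 0) : |ξ.1 - v| < ε := by
  have h1 := (hη.abs_lt_one (right_ne_zero_of_mul h)).1
  simp only [Prod.smul_fst, Prod.fst_sub, smul_eq_mul, abs_mul, abs_of_pos (inv_pos.2 hε)] at h1
  rwa [inv_mul_lt_iff₀ hε, mul_one] at h1

theorem hasCompactSupport_pulse (hη : IsMollifier η) (hε : 0 < ε) :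
    HasCompactSupport (pulse η ε v) :=
  HasCompactSupport.intro (isCompact_closedBall ((v, 0) : Vel) ε) fun z hz => by
    by_contra hne
    exact hz (mem_closedBall_iff_norm.2 (norm_sub_le_of_pulse_ne_zero hη hε hne))

theorem finrank_vel : Module.finrank ℝ Vel = 3 := by simp [Vel]

/-- The substitution `ξ = ε z + (v, 0)` in dimension `3` cancels the prefactor, so integrals against
a pulse become averages over the fixed mollifier. -/
theorem integral_pulse_mul (hε : 0 < ε) (k : Vel → ℝ) :
    ∫ ξ, pulse η ε v ξ * k ξ = ∫ z, η z * k (ε • z + (v, 0)) := by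
  have h1 : ∫ ξ, pulse η ε v ξ * k ξ
      = ∫ ξ : Vel, (fun ζ : Vel => (ε ^ 3)⁻¹ * η (ε⁻¹ • ζ) * k (ζ + (v, 0))) (ξ - (v, 0)) := by
    simp only [pulse, sub_add_cancel]
  rw [h1, integral_sub_right_eq_self (fun ζ : Vel => (ε ^ 3)⁻¹ * η (ε⁻¹ • ζ) * k (ζ + (v, 0)))]
  have h2 := Measure.integral_comp_inv_smul (volume : Measure Vel)
    (fun z => η z * k (ε • z + (v, 0))) ε
  rw [finrank_vel, abs_of_pos (by positivity : 0 < ε ^ 3), smul_eq_mul] at h2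
  simp only [smul_inv_smul₀ hε.ne'] at h2
  rw [← inv_mul_eq_iff_eq_mul₀ (by positivity), ← integral_const_mul] at h2
  rw [← h2]
  simp only [mul_assoc]

theorem IsProfile.const_mul {G : Vel → ℝ} (hG : IsProfile r G) (c : ℝ) :
    IsProfile r fun ξ => c * G ξ :=
  ⟨hG.continuous.const_mul c, hG.compactSupport.mul_left, fun ξ hξ => by
    rw [hG.eq_zero ξ hξ, mul_zero]⟩

theorem IsProfile.add {G H : Vel → ℝ} (hG : IsProfile r G) (hH : IsProfile r H) :
    IsProfile r fun ξ => G ξ + H ξ :=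
  ⟨hG.continuous.add hH.continuous, hG.compactSupport.add hH.compactSupport, fun ξ hξ => by
    rw [hG.eq_zero ξ hξ, hH.eq_zero ξ hξ, add_zero]⟩

theorem isProfile_pulse (hη : IsMollifier η) (hε : 0 < ε) (hv : r + ε ≤ v) :
    IsProfile r (pulse η ε v) :=
  ⟨continuous_pulse hη, hasCompactSupport_pulse hη hε, fun ξ hξ => by
    by_contra hne
    have h1 := abs_lt.1 (abs_sub_lt_of_pulse_ne_zero hη hε hne)
    linarith⟩

theorem isProfile_pulse_reflect (hη : IsMollifier η) (hε : 0 < ε) (hv : r + ε ≤ v) :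
    IsProfile r fun ξ => pulse η ε (-v) (reflect ξ) :=
  ⟨(continuous_pulse hη).comp continuous_reflect,
    (hasCompactSupport_pulse hη hε).comp_homeomorph reflectHomeo, fun ξ hξ => by
    by_contra hne
    have h1 := abs_lt.1 (abs_sub_lt_of_pulse_ne_zero hη hε hne)
    simp only [reflect] at h1
    linarith⟩

/-- Right-moving ions which are injected at the wall. -/
noncomputable def injected (η : Vel → ℝ) (mb vb ε : ℝ) (ξ : Vel) : ℝ := mb * pulse η ε vb ξ

/-- Left-moving ions, as a function of the reflected velocity. -/
noncomputable def incoming (η : Vel → ℝ) (minf vinf ε : ℝ) (ξ : Vel) : ℝ :=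
  minf * pulse η ε (-vinf) (reflect ξ)

/-- All right-moving ions. -/
noncomputable def outgoing (η : Vel → ℝ) (α mb minf vb vinf ε : ℝ) (ξ : Vel) : ℝ :=
  injected η mb vb ε ξ + α * incoming η minf vinf ε ξ

theorem isProfile_injected (hη : IsMollifier η) (hε : 0 < ε) (hv : r + ε ≤ vb) :
    IsProfile r (injected η mb vb ε) := (isProfile_pulse hη hε hv).const_mul mb

theorem isProfile_incoming (hη : IsMollifier η) (hε : 0 < ε) (hv : r + ε ≤ vinf) :
    IsProfile r (incoming η minf vinf ε) := (isProfile_pulse_reflect hη hε hv).const_mul minf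

theorem isProfile_outgoing (hη : IsMollifier η) (hε : 0 < ε) (hv : r + ε ≤ vb)
    (hv' : r + ε ≤ vinf) : IsProfile r (outgoing η α mb minf vb vinf ε) :=
  (isProfile_injected hη hε hv).add ((isProfile_incoming hη hε hv').const_mul α)

theorem incoming_nonneg (hη : IsMollifier η) (hε : 0 < ε) (hminf : 0 ≤ minf) (ξ : Vel) :
    0 ≤ incoming η minf vinf ε ξ := mul_nonneg hminf (pulse_nonneg hη hε _)

theorem outgoing_nonneg (hη : IsMollifier η) (hε : 0 < ε) (hα : 0 ≤ α) (hmb : 0 ≤ mb)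
    (hminf : 0 ≤ minf) (ξ : Vel) : 0 ≤ outgoing η α mb minf vb vinf ε ξ :=
  add_nonneg (mul_nonneg hmb (pulse_nonneg hη hε _))
    (mul_nonneg hα (incoming_nonneg hη hε hminf _))

theorem ginf_eq (ξ : Vel) : ginf η α mb minf vb vinf ε ξ
    = outgoing η α mb minf vb vinf ε ξ + incoming η minf vinf ε (reflect ξ) := by
  have h : ((-ξ.1, ξ.2) : Vel) + (vinf, 0) = reflect ξ - (-vinf, 0) := by
    ext <;> simp [reflect]
  simp only [ginf, outgoing, injected, incoming, pulse, reflect_reflect, h]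
  ring

/-- The cutoff `chi` is already implied: for nonpositive energy the square root is `0`, where the
injected profile vanishes. -/
theorem gb_eq (hr : 0 < r) (hη : IsMollifier η) (hε : 0 < ε) (hv : r + ε ≤ vb) {φb : ℝ}
    {ξ : Vel} (hξ : 0 < ξ.1) :
    gb η mb vb φb ε ξ = beam (injected η mb vb ε) φb ξ := by
  rw [beam_of_pos _ _ hξ]
  have h0 : gb η mb vb φb ε ξ = injected η mb vb ε (√(ξ.1 ^ 2 - 2 * φb), ξ.2) *
      chi (ξ.1 ^ 2 - 2 * φb) := by
    simp only [gb, injected, pulse]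
    ring
  rw [h0]
  rcases lt_or_ge 0 (ξ.1 ^ 2 - 2 * φb) with h | h
  · rw [chi, indicator_of_mem (mem_Ioi.2 h), mul_one]
  · rw [Real.sqrt_eq_zero_of_nonpos h, (isProfile_injected hη hε hv).eq_zero _ hr.le, zero_mul]

/-! ### Moments -/

/-- The charge density of the mollified beams as a function of the potential. -/
noncomputable def smoothDensity (η : Vel → ℝ) (α mb minf vb vinf ε s : ℝ) : ℝ :=
  ∫ z : Vel, η z * beamDensity α mb minf vb vinf (ε * z.1) s

/-- Replacing the speed by its maximum with `r` changes nothing on the support of `η` and makes the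
integrand continuous everywhere. -/
theorem integrable_mul_densityFactor (hη : IsMollifier η) (hr : 0 < r) (hs : 2 * |s| < r ^ 2)
    (c : ℝ) (hc : ∀ z, η z ≠ 0 → r ≤ v + c * z.1) :
    Integrable fun z : Vel => η z * densityFactor (v + c * z.1) s := by
  have h1 : (fun z : Vel => η z * densityFactor (v + c * z.1) s)
      = fun z => η z * densityFactor (max (v + c * z.1) r) s := by
    ext z
    by_cases hz : η z = 0
    · simp [hz]
    · rw [max_eq_left (hc z hz)]
  rw [h1]
  refine Continuous.integrable_of_hasCompactSupport (hη.continuous.mul ?_)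
    hη.hasCompactSupport.mul_right
  unfold densityFactor
  refine Continuous.div (by fun_prop) (by fun_prop) fun z => (Real.sqrt_pos.2 ?_).ne'
  have h2 := le_max_right (v + c * z.1) r
  have h3 := neg_abs_le s
  nlinarith

theorem le_add_mul_fst (hη : IsMollifier η) (hv : r + ε ≤ v) {c : ℝ} (hc : |c| ≤ ε) {z : Vel}
    (hz : η z ≠ 0) : r ≤ v + c * z.1 := by
  have h1 := (hη.abs_lt_one hz).1
  have h2 : |c * z.1| ≤ ε := by
    rw [abs_mul]
    nlinarith [abs_nonneg c, abs_nonneg z.1]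
  linarith [(abs_le.1 h2).1]

theorem integrable_mul_beamDensity (hη : IsMollifier η) (hr : 0 < r) (hs : 2 * |s| < r ^ 2)
    (hε : 0 < ε) (hv : r + ε ≤ vb) (hv' : r + ε ≤ vinf) :
    Integrable fun z : Vel => η z * beamDensity α mb minf vb vinf (ε * z.1) s := by
  have h1 := (integrable_mul_densityFactor hη hr hs ε fun z hz =>
    le_add_mul_fst hη hv (abs_of_pos hε).le hz).const_mul mb
  have h2 := (integrable_mul_densityFactor hη hr hs (-ε) fun z hz =>
    le_add_mul_fst hη hv' (by rw [abs_neg, abs_of_pos hε]) hz).const_mul ((1 + α) * minf)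
  refine (h1.add h2).congr (ae_of_all _ fun z => ?_)
  simp only [beamDensity, Pi.add_apply, neg_mul, ← sub_eq_add_neg]
  ring

theorem integral_beam (hr : 0 < r) (hs : 2 * |s| < r ^ 2) {G : Vel → ℝ} (hG : IsProfile r G) :
    ∫ ξ, beam G s ξ = ∫ ξ, G ξ * densityFactor ξ.1 s := by
  simpa [densityFactor] using integral_beam_mul hr hs hG fun _ => 1

/-- The new speed cancels the Jacobian denominator, so the flux of a beam does not depend on the
potential. -/
theorem integral_mul_beam (hr : 0 < r) (hs : 2 * |s| < r ^ 2) {G : Vel → ℝ}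
    (hG : IsProfile r G) : ∫ ξ : Vel, ξ.1 * beam G s ξ = ∫ ξ, G ξ * ξ.1 := by
  have h := integral_beam_mul hr hs hG fun ξ => ξ.1
  simp only [mul_comm _ (beam G s _)]
  rw [h]
  refine integral_congr_ae (ae_of_all _ fun ξ => ?_)
  rcases le_or_gt ξ.1 r with h1 | h1
  · simp [hG.eq_zero ξ h1]
  · have h2 : √(ξ.1 ^ 2 + 2 * s) ≠ 0 := (Real.sqrt_pos.2 (energy_pos hs hr h1)).ne'
    simp only [accelerate]
    field_simp

theorem integral_injected_mul (hε : 0 < ε) (k : ℝ → ℝ) :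
    ∫ ξ, injected η mb vb ε ξ * k ξ.1 = mb * ∫ z, η z * k (vb + ε * z.1) := by
  simp only [injected, mul_assoc]
  rw [integral_const_mul, integral_pulse_mul hε fun ξ => k ξ.1]
  simp [add_comm]

theorem integral_incoming_mul (hε : 0 < ε) (k : ℝ → ℝ) :
    ∫ ξ, incoming η minf vinf ε ξ * k ξ.1 = minf * ∫ z, η z * k (vinf + -ε * z.1) := by
  simp only [incoming, mul_assoc]
  rw [integral_const_mul, ← integral_comp_reflect]
  simp only [reflect_reflect]
  rw [integral_pulse_mul hε fun ξ => k (reflect ξ).1]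
  simp [reflect]

/-- The distribution of all ions at a point where the potential is `s`. -/
noncomputable def ionDistribution (η : Vel → ℝ) (α mb minf vb vinf ε s : ℝ) (ξ : Vel) : ℝ :=
  beam (outgoing η α mb minf vb vinf ε) s ξ + beam (incoming η minf vinf ε) s (reflect ξ)

theorem beam_outgoing (ξ : Vel) : beam (outgoing η α mb minf vb vinf ε) s ξ
    = beam (injected η mb vb ε) s ξ + α * beam (incoming η minf vinf ε) s ξ := by
  rcases lt_or_ge 0 ξ.1 with h | h
  · simp only [beam_of_pos _ _ h, outgoing]
  · simp only [beam_of_nonpos _ _ h, mul_zero, add_zero]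

/-- The assumptions on the size of the parameters: beams stay away from zero velocity. -/
structure IsSmall (η : Vel → ℝ) (vb vinf r ε : ℝ) : Prop where
  mollifier : IsMollifier η
  pos : 0 < r
  eps_pos : 0 < ε
  le_vb : r + ε ≤ vb
  le_vinf : r + ε ≤ vinf

theorem integrable_beam_reflect {G : Vel → ℝ} (hr : 0 < r) (hG : IsProfile r G)
    (hs : 2 * |s| < r ^ 2) : Integrable fun ξ => beam G s (reflect ξ) :=
  (measurePreserving_reflect.integrable_comp_emb reflectHomeo.measurableEmbedding).2
    (integrable_beam hr hG hs)

theorem integrable_mul_beam_reflect {G : Vel → ℝ} (hr : 0 < r) (hG : IsProfile r G)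
    (hs : 2 * |s| < r ^ 2) : Integrable fun ξ : Vel => ξ.1 * beam G s (reflect ξ) := by
  have h := (measurePreserving_reflect.integrable_comp_emb reflectHomeo.measurableEmbedding).2
    (integrable_mul_beam hr hG hs).neg
  refine h.congr (ae_of_all _ fun ξ => ?_)
  simp [reflect]

theorem IsSmall.profile_injected (h : IsSmall η vb vinf r ε) (mb : ℝ) :
    IsProfile r (injected η mb vb ε) := isProfile_injected h.1 h.3 h.4

theorem IsSmall.profile_incoming (h : IsSmall η vb vinf r ε) (minf : ℝ) :
    IsProfile r (incoming η minf vinf ε) := isProfile_incoming h.1 h.3 h.5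

theorem IsSmall.profile_outgoing (h : IsSmall η vb vinf r ε) (α mb minf : ℝ) :
    IsProfile r (outgoing η α mb minf vb vinf ε) := isProfile_outgoing h.1 h.3 h.4 h.5

theorem integrable_ionDistribution (h : IsSmall η vb vinf r ε) (hs : 2 * |s| < r ^ 2) :
    Integrable (ionDistribution η α mb minf vb vinf ε s) :=
  (integrable_beam h.pos (h.profile_outgoing α mb minf) hs).add
    (integrable_beam_reflect h.pos (h.profile_incoming minf) hs)

theorem integrable_mul_ionDistribution (h : IsSmall η vb vinf r ε) (hs : 2 * |s| < r ^ 2) :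
    Integrable fun ξ : Vel => ξ.1 * ionDistribution η α mb minf vb vinf ε s ξ := by
  refine ((integrable_mul_beam h.pos (h.profile_outgoing α mb minf) hs).add
    (integrable_mul_beam_reflect h.pos (h.profile_incoming minf) hs)).congr
    (ae_of_all _ fun ξ => ?_)
  simp only [ionDistribution, Pi.add_apply]
  ring

/-- Incoming and reflected ions have the same speed `vinf - ε z₁` at potential `0`, which explains
the common weight `(1 + α) minf` and the sign of `τ` in `beamDensity`. -/
theorem integral_ionDistribution (h : IsSmall η vb vinf r ε) (hs : 2 * |s| < r ^ 2) :
    ∫ ξ, ionDistribution η α mb minf vb vinf ε s ξ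
      = smoothDensity η α mb minf vb vinf ε s := by
  have hj := h.profile_injected mb
  have hi := h.profile_incoming minf
  have i1 := integrable_beam h.pos hj hs
  have i2 := integrable_beam h.pos hi hs
  have i3 := integrable_beam_reflect h.pos hi hs
  have i4 : Integrable fun ξ => beam (injected η mb vb ε) s ξ
      + α * beam (incoming η minf vinf ε) s ξ := i1.add (i2.const_mul α)
  simp only [ionDistribution, beam_outgoing]
  rw [integral_add i4 i3, integral_add i1 (i2.const_mul α),
    integral_const_mul, integral_comp_reflect, integral_beam h.pos hs hj,
    integral_beam h.pos hs hi, integral_injected_mul h.eps_pos fun w => densityFactor w s,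
    integral_incoming_mul h.eps_pos fun w => densityFactor w s, smoothDensity]
  have j1 := (integrable_mul_densityFactor h.mollifier h.pos hs ε fun z hz =>
    le_add_mul_fst h.mollifier h.le_vb (abs_of_pos h.eps_pos).le hz).const_mul mb
  have j2 := (integrable_mul_densityFactor h.mollifier h.pos hs (-ε) fun z hz =>
    le_add_mul_fst h.mollifier h.le_vinf (by rw [abs_neg, abs_of_pos h.eps_pos]) hz).const_mul
      ((1 + α) * minf)
  have e : ∀ z : Vel, η z * beamDensity α mb minf vb vinf (ε * z.1) s
      = mb * (η z * densityFactor (vb + ε * z.1) s)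
        + (1 + α) * minf * (η z * densityFactor (vinf + -ε * z.1) s) := fun z => by
    simp only [beamDensity, neg_mul, ← sub_eq_add_neg]
    ring
  simp_rw [e]
  rw [integral_add j1 j2, integral_const_mul, integral_const_mul]
  ring

theorem IsMollifier.abs_integral_affine_sub_le (hη : IsMollifier η) (c v : ℝ) :
    |(∫ z, η z * (v + c * z.1)) - v| ≤ |c| := by
  have hi : Integrable fun z : Vel => η z * (v + c * z.1) :=
    (hη.continuous.mul (by fun_prop)).integrable_of_hasCompactSupport
      hη.hasCompactSupport.mul_right
  have h := hη.integral_mem_Icc hi (a := v - |c|) (b := v + |c|) fun z hz => by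
    have h1 := (hη.abs_lt_one hz).1
    have h2 : |c * z.1| ≤ |c| := by
      rw [abs_mul]
      nlinarith [abs_nonneg c]
    rw [abs_le] at h2
    constructor <;> linarith
  rw [abs_le]
  constructor <;> linarith [h.1, h.2]

theorem integral_mul_ionDistribution (h : IsSmall η vb vinf r ε) (hs : 2 * |s| < r ^ 2) :
    ∫ ξ : Vel, ξ.1 * ionDistribution η α mb minf vb vinf ε s ξ
      = mb * (∫ z, η z * (vb + ε * z.1))
        + (α - 1) * minf * ∫ z, η z * (vinf + -ε * z.1) := by
  have hj := h.profile_injected mb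
  have hi := h.profile_incoming minf
  have i1 := integrable_mul_beam h.pos hj hs
  have i2 := integrable_mul_beam h.pos hi hs
  have i3 := integrable_mul_beam_reflect h.pos hi hs
  have e : ∀ ξ : Vel, ξ.1 * ionDistribution η α mb minf vb vinf ε s ξ
      = (ξ.1 * beam (injected η mb vb ε) s ξ + α * (ξ.1 * beam (incoming η minf vinf ε) s ξ))
        + ξ.1 * beam (incoming η minf vinf ε) s (reflect ξ) := fun ξ => by
    simp only [ionDistribution, beam_outgoing]
    ring
  have i4 : ∫ ξ : Vel, ξ.1 * beam (incoming η minf vinf ε) s (reflect ξ)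
      = -∫ ξ : Vel, ξ.1 * beam (incoming η minf vinf ε) s ξ := by
    rw [← integral_comp_reflect, ← integral_neg]
    simp only [reflect_reflect]
    simp [reflect]
  have i5 : Integrable fun ξ : Vel => ξ.1 * beam (injected η mb vb ε) s ξ
      + α * (ξ.1 * beam (incoming η minf vinf ε) s ξ) := i1.add (i2.const_mul α)
  simp_rw [e]
  rw [integral_add i5 i3, integral_add i1 (i2.const_mul α),
    integral_const_mul, i4, integral_mul_beam h.pos hs hj,
    integral_mul_beam h.pos hs hi, integral_injected_mul h.eps_pos fun w => w,
    integral_incoming_mul h.eps_pos fun w => w]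
  ring

/-- Each mean speed is off by at most `ε`, and the weights satisfy `mb + (1 - α) minf = 1 - 2 α minf
≤ 1`. Hence the constant is exactly `1`. -/
theorem abs_current_sub_le (h : IsSmall η vb vinf r ε) (hs : 2 * |s| < r ^ 2)
    (hα : α ∈ Icc (0 : ℝ) 1) (hmb : 0 ≤ mb) (hminf : 0 < minf)
    (hmass : mb + (1 + α) * minf = 1) :
    |(∫ ξ : Vel, ξ.1 * ionDistribution η α mb minf vb vinf ε s ξ)
      - (mb * vb + (α - 1) * minf * vinf)| ≤ ε := by
  rw [integral_mul_ionDistribution h hs]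
  have h1 := h.mollifier.abs_integral_affine_sub_le ε vb
  have h2 := h.mollifier.abs_integral_affine_sub_le (-ε) vinf
  rw [abs_neg] at h2
  rw [abs_of_pos h.eps_pos] at h1 h2
  set A := ∫ z, η z * (vb + ε * z.1)
  set A' := ∫ z, η z * (vinf + -ε * z.1)
  have e : mb * A + (α - 1) * minf * A' - (mb * vb + (α - 1) * minf * vinf)
      = mb * (A - vb) + (α - 1) * minf * (A' - vinf) := by ring
  rw [e]
  have h3 : |mb * (A - vb)| ≤ mb * ε := by
    rw [abs_mul, abs_of_nonneg hmb]
    exact mul_le_mul_of_nonneg_left h1 hmb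
  have h4 : |(α - 1) * minf * (A' - vinf)| ≤ (1 - α) * minf * ε := by
    rw [abs_mul, abs_mul, abs_of_pos hminf, abs_of_nonpos (by linarith [hα.2])]
    have : 0 ≤ (1 - α) * minf := mul_nonneg (by linarith [hα.2]) hminf.le
    calc -(α - 1) * minf * |A' - vinf| = (1 - α) * minf * |A' - vinf| := by ring
      _ ≤ _ := mul_le_mul_of_nonneg_left h2 this
  have h5 := abs_add_le (mb * (A - vb)) ((α - 1) * minf * (A' - vinf))
  have h6 : 0 ≤ α * minf * ε := mul_nonneg (mul_nonneg hα.1 hminf.le) h.eps_pos.le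
  have h7 : mb * ε + (1 - α) * minf * ε = ε - 2 * (α * minf * ε) := by
    linear_combination ε * hmass
  linarith

theorem smoothDensity_bounds (h : IsSmall η vb vinf r ε) (hs : 2 * |s| < r ^ 2) {a b : ℝ}
    (hab : ∀ τ, |τ| < ε → a ≤ beamDensity α mb minf vb vinf τ s ∧
      beamDensity α mb minf vb vinf τ s ≤ b) :
    a ≤ smoothDensity η α mb minf vb vinf ε s ∧ smoothDensity η α mb minf vb vinf ε s ≤ b := by
  refine h.mollifier.integral_mem_Icc
    (integrable_mul_beamDensity h.mollifier h.pos hs h.eps_pos h.le_vb h.le_vinf)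
    fun z hz => hab _ ?_
  rw [abs_mul, abs_of_pos h.eps_pos]
  exact mul_lt_of_lt_one_right h.eps_pos (h.mollifier.abs_lt_one hz).1

/-- Bounds valid for every perturbation `τ` survive averaging, because the mollifier is a
probability density; slope bounds thus pass to `smoothDensity` with the same constants. -/
theorem smoothDensity_sub_bounds (h : IsSmall η vb vinf r ε) {t : ℝ} (hs : 2 * |s| < r ^ 2)
    (ht : 2 * |t| < r ^ 2) {a b : ℝ}
    (hab : ∀ τ, |τ| < ε →
      a ≤ beamDensity α mb minf vb vinf τ s - beamDensity α mb minf vb vinf τ t ∧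
      beamDensity α mb minf vb vinf τ s - beamDensity α mb minf vb vinf τ t ≤ b) :
    a ≤ smoothDensity η α mb minf vb vinf ε s - smoothDensity η α mb minf vb vinf ε t ∧
      smoothDensity η α mb minf vb vinf ε s - smoothDensity η α mb minf vb vinf ε t ≤ b := by
  have i1 := integrable_mul_beamDensity (α := α) (mb := mb) (minf := minf)
    h.mollifier h.pos hs h.eps_pos h.le_vb h.le_vinf
  have i2 := integrable_mul_beamDensity (α := α) (mb := mb) (minf := minf)
    h.mollifier h.pos ht h.eps_pos h.le_vb h.le_vinf
  rw [smoothDensity, smoothDensity, ← integral_sub i1 i2]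
  simp only [← mul_sub]
  refine h.mollifier.integral_mem_Icc ((i1.sub i2).congr (ae_of_all _ fun z => ?_))
    fun z hz => hab _ ?_
  · simp only [Pi.sub_apply, mul_sub]
  · rw [abs_mul, abs_of_pos h.eps_pos]
    exact mul_lt_of_lt_one_right h.eps_pos (h.mollifier.abs_lt_one hz).1

/-! ### Limit datum, sign and `L¹` continuity of the ion distribution. -/

theorem beam_zero {G : Vel → ℝ} (hr : 0 < r) (hG : IsProfile r G) (ξ : Vel) :
    beam G 0 ξ = G ξ := by
  rcases lt_or_ge 0 ξ.1 with h | h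
  · rw [beam_of_pos _ _ h, mul_zero, sub_zero, Real.sqrt_sq h.le]
  · rw [beam_of_nonpos _ _ h, hG.eq_zero ξ (h.trans hr.le)]

theorem ionDistribution_zero (h : IsSmall η vb vinf r ε) (ξ : Vel) :
    ionDistribution η α mb minf vb vinf ε 0 ξ = ginf η α mb minf vb vinf ε ξ := by
  rw [ginf_eq, ionDistribution, beam_zero h.pos (h.profile_outgoing α mb minf),
    beam_zero h.pos (h.profile_incoming minf)]

theorem ionDistribution_nonneg (h : IsSmall η vb vinf r ε) (hα : 0 ≤ α) (hmb : 0 ≤ mb)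
    (hminf : 0 ≤ minf) (s : ℝ) (ξ : Vel) : 0 ≤ ionDistribution η α mb minf vb vinf ε s ξ :=
  add_nonneg
    (indicator_nonneg (fun _ _ => outgoing_nonneg h.mollifier h.eps_pos hα hmb hminf _) _)
    (indicator_nonneg (fun _ _ => incoming_nonneg h.mollifier h.eps_pos hminf _) _)

/-- The explicit solution contains no trapped ions. Any nonnegative solution therefore exceeds it in
the trapped region, which is the sign needed for uniqueness. -/
theorem ionDistribution_eq_zero (h : IsSmall η vb vinf r ε) {ξ : Vel} (hξ : ξ.1 ^ 2 < 2 * s) :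
    ionDistribution η α mb minf vb vinf ε s ξ = 0 := by
  have hr := h.pos
  have h1 : ξ.1 ^ 2 - 2 * s ≤ r ^ 2 := by nlinarith
  rw [ionDistribution, beam_eq_zero_of_sq_le (h.profile_outgoing α mb minf) hr h1,
    beam_eq_zero_of_sq_le (h.profile_incoming minf) hr (by simpa [reflect] using h1), add_zero]

theorem tendsto_eLpNorm_ionDistribution (h : IsSmall η vb vinf r ε) (hs : 2 * |s| < r ^ 2)
    {ι : Type*} {l : Filter ι} [l.IsCountablyGenerated] {u : ι → ℝ} (hu : Tendsto u l (𝓝 s)) :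
    Tendsto (fun i => eLpNorm (fun ξ => ionDistribution η α mb minf vb vinf ε (u i) ξ
      - ionDistribution η α mb minf vb vinf ε s ξ) 1 volume) l (𝓝 0) := by
  have h1 := tendsto_eLpNorm_beam h.pos (h.profile_outgoing α mb minf) hs hu
  have h2 := tendsto_eLpNorm_beam h.pos (h.profile_incoming minf) hs hu
  have h3 := h1.add h2
  rw [add_zero] at h3
  have hev : ∀ᶠ i in l, 2 * |u i| < r ^ 2 := by
    have h1 : Continuous fun x : ℝ => 2 * |x| := by fun_prop
    exact ((h1.tendsto s).comp hu).eventually (gt_mem_nhds hs)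
  refine tendsto_of_tendsto_of_tendsto_of_le_of_le' tendsto_const_nhds h3
    (Eventually.of_forall fun i => zero_le) ?_
  filter_upwards [hev] with i hi
  have m1 : AEStronglyMeasurable (fun ξ : Vel => beam (outgoing η α mb minf vb vinf ε) (u i) ξ
      - beam (outgoing η α mb minf vb vinf ε) s ξ) volume :=
    ((continuous_beam h.pos (h.profile_outgoing α mb minf) hi).sub
      (continuous_beam h.pos (h.profile_outgoing α mb minf) hs)).aestronglyMeasurable
  have m2 : AEStronglyMeasurable (fun ξ : Vel => beam (incoming η minf vinf ε) (u i) ξ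
      - beam (incoming η minf vinf ε) s ξ) volume :=
    ((continuous_beam h.pos (h.profile_incoming minf) hi).sub
      (continuous_beam h.pos (h.profile_incoming minf) hs)).aestronglyMeasurable
  have m3 := m2.comp_measurePreserving measurePreserving_reflect
  rw [← eLpNorm_comp_reflect m2]
  refine le_trans (le_of_eq ?_) (eLpNorm_add_le m1 m3 le_rfl)
  congr 1
  ext ξ
  simp only [ionDistribution, Pi.add_apply]
  ring

end Sheath

namespace Sheath

/-! ### The linear problem for a given potential -/

variable {η : Vel → ℝ} {α mb minf vb vinf r ε δ : ℝ} {φ : ℝ → ℝ} {ψ : ℝ × Vel → ℝ}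

theorem integrable_beam_reflect_mul {G : Vel → ℝ} (hG : IsProfile r G) (hφ : Measurable φ)
    {k : ℝ × Vel → ℝ} (hk : Integrable k) :
    Integrable fun p : ℝ × Vel => beam G (φ p.1) (reflect p.2) * k p := by
  have h1 := (measurePreserving_reflectPhase.integrable_comp_emb
    reflectPhase.measurableEmbedding).2 hk
  have h2 := (measurePreserving_reflectPhase.integrable_comp_emb
    reflectPhase.measurableEmbedding).2 (integrable_beam_mul hG hφ h1)
  refine h2.congr (ae_of_all _ fun p => ?_)
  change beam G (φ p.1) (reflect p.2) * k (p.1, reflect (reflect p.2)) = _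
  rw [reflect_reflect]

/-- Reversing velocities reduces to the right-moving formula with `ψ` reflected and the operator
negated. The wall term then involves `ψ(0, -ξ₁)`, which the test condition replaces by `α ψ(0, ξ₁)`.
-/
theorem integral_beam_reflect_transport (hr : 0 < r) (hδ : 2 * δ < r ^ 2) {G : Vel → ℝ}
    (hG : IsProfile r G) (hφ : ContDiff ℝ 1 φ) (hb : ∀ x, 0 ≤ x → |φ x| ≤ δ)
    (hψ : IsTest α ψ) :
    ∫ p in Ioi (0 : ℝ) ×ˢ (univ : Set Vel),
        beam G (φ p.1) (reflect p.2) * transport (deriv φ) ψ p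
      = α * ∫ ξ, beam G (φ 0) ξ * (ξ.1 * ψ (0, ξ)) := by
  have h1 := setIntegral_comp_reflectPhase (Ioi 0) fun p =>
    beam G (φ p.1) (reflect p.2) * transport (deriv φ) ψ p
  have h2 := integral_beam_transport hr hδ hG hφ hb (contDiff_comp_reflect hψ.contDiff)
    (hasCompactSupport_comp_reflect hψ.compactSupport)
  rw [← h1, ← integral_const_mul]
  simp only [reflect_reflect]
  have h3 : ∀ p : ℝ × Vel, beam G (φ p.1) p.2 * transport (deriv φ) ψ (p.1, reflect p.2)
      = -(beam G (φ p.1) p.2 * transport (deriv φ) (fun q => ψ (q.1, reflect q.2)) p) := fun p => by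
    rw [show p = (p.1, p.2) from rfl, transport_comp_reflect hψ.contDiff]
    ring
  simp only [h3]
  rw [integral_neg, h2, neg_neg]
  refine integral_congr_ae (ae_of_all _ fun ξ => ?_)
  rcases lt_or_ge 0 ξ.1 with h | h
  · simp only [reflect, ← hψ.reflect ξ h]
    ring
  · simp only [beam_of_nonpos _ _ h, zero_mul, mul_zero]

theorem ionDistribution_mul_eq (k : ℝ × Vel → ℝ) (p : ℝ × Vel) :
    ionDistribution η α mb minf vb vinf ε (φ p.1) p.2 * k p
      = beam (outgoing η α mb minf vb vinf ε) (φ p.1) p.2 * k p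
        + beam (incoming η minf vinf ε) (φ p.1) (reflect p.2) * k p := by
  rw [ionDistribution, add_mul]

theorem integrable_ionDistribution_mul (h : IsSmall η vb vinf r ε) (hφ : Measurable φ)
    {k : ℝ × Vel → ℝ} (hk : Integrable k) : Integrable fun p : ℝ × Vel =>
      ionDistribution η α mb minf vb vinf ε (φ p.1) p.2 * k p := by
  simp only [ionDistribution_mul_eq]
  exact (integrable_beam_mul (h.profile_outgoing α mb minf) hφ hk).add
    (integrable_beam_reflect_mul (h.profile_incoming minf) hφ hk)

/-- The superposition of the beams solves the Vlasov equation and satisfies the boundary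
condition. -/
theorem ionDistribution_weak (h : IsSmall η vb vinf r ε) (hδ : 2 * δ < r ^ 2)
    (hφ : ContDiff ℝ 1 φ) (hb : ∀ x, 0 ≤ x → |φ x| ≤ δ) (hψ : IsTest α ψ) :
    (∫ p in Ioi (0 : ℝ) ×ˢ (univ : Set Vel),
      ionDistribution η α mb minf vb vinf ε (φ p.1) p.2 * transport (deriv φ) ψ p)
      + ∫ ξ in {ξ : Vel | 0 < ξ.1}, gb η mb vb (φ 0) ε ξ * (ξ.1 * ψ (0, ξ)) = 0 := by
  have hT : Integrable (transport (deriv φ) ψ) :=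
    (continuous_transport (hφ.continuous_deriv le_rfl) hψ.contDiff).integrable_of_hasCompactSupport
      (hasCompactSupport_transport _ hψ.compactSupport)
  have hm := hφ.continuous.measurable
  have hs : 2 * |φ 0| < r ^ 2 := by linarith [hb 0 le_rfl]
  simp only [ionDistribution_mul_eq]
  rw [integral_add
    (integrable_beam_mul (h.profile_outgoing α mb minf) hm hT).integrableOn
    (integrable_beam_reflect_mul (h.profile_incoming minf) hm hT).integrableOn,
    integral_beam_transport h.pos hδ (h.profile_outgoing α mb minf) hφ hb hψ.contDiff
      hψ.compactSupport,
    integral_beam_reflect_transport h.pos hδ (h.profile_incoming minf) hφ hb hψ]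
  have hk : Continuous fun ξ : Vel => ξ.1 * ψ (0, ξ) := by
    have := hψ.contDiff.continuous
    fun_prop
  have hi : ∀ {G : Vel → ℝ}, IsProfile r G →
      Integrable fun ξ : Vel => beam G (φ 0) ξ * (ξ.1 * ψ (0, ξ)) := fun hG =>
    ((continuous_beam h.pos hG hs).mul hk).integrable_of_hasCompactSupport
      (hasCompactSupport_beam hG hs).mul_right
  have e1 : ∫ ξ in {ξ : Vel | 0 < ξ.1}, gb η mb vb (φ 0) ε ξ * (ξ.1 * ψ (0, ξ))
      = ∫ ξ : Vel, beam (injected η mb vb ε) (φ 0) ξ * (ξ.1 * ψ (0, ξ)) := by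
    have hm : MeasurableSet {ξ : Vel | 0 < ξ.1} :=
      measurableSet_lt (measurable_const (a := (0 : ℝ))) measurable_fst
    refine (setIntegral_congr_fun hm fun ξ hξ => ?_).trans
      (setIntegral_eq_integral_of_forall_compl_eq_zero fun ξ hξ => ?_)
    · rw [gb_eq h.pos h.mollifier h.eps_pos h.le_vb hξ]
    · rw [beam_of_nonpos _ _ (not_lt.1 hξ), zero_mul]
  have e2 : ∫ ξ : Vel, beam (outgoing η α mb minf vb vinf ε) (φ 0) ξ * (ξ.1 * ψ (0, ξ))
      = (∫ ξ : Vel, beam (injected η mb vb ε) (φ 0) ξ * (ξ.1 * ψ (0, ξ)))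
        + α * ∫ ξ : Vel, beam (incoming η minf vinf ε) (φ 0) ξ * (ξ.1 * ψ (0, ξ)) := by
    rw [← integral_const_mul, ← integral_add (hi (h.profile_injected mb))
      ((hi (h.profile_incoming minf)).const_mul α)]
    refine integral_congr_ae (ae_of_all _ fun ξ => ?_)
    dsimp only
    rw [beam_outgoing]
    ring
  rw [e1, e2]
  ring

theorem locallyIntegrable_ionDistribution (h : IsSmall η vb vinf r ε) (hφ : Measurable φ) :
    LocallyIntegrable fun p : ℝ × Vel =>
      ionDistribution η α mb minf vb vinf ε (φ p.1) p.2 := by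
  refine (locallyIntegrable_iff).2 fun K hK => ?_
  have h1 := integrable_ionDistribution_mul (α := α) (mb := mb) (minf := minf) h hφ
    (k := K.indicator fun _ => 1)
    ((integrable_indicator_iff hK.measurableSet).2 (integrableOn_const hK.measure_lt_top.ne))
  rw [← integrable_indicator_iff hK.measurableSet]
  refine h1.congr (ae_of_all _ fun p => ?_)
  by_cases hp : p ∈ K <;> simp [hp]

/-! ### Continuation of the potential -/

/-- A `C¹` function on the closed half line extends to a `C¹` function on the line. -/
theorem exists_contDiff_one_extension (hφ : ContDiffOn ℝ 1 φ (Ici 0)) :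
    ∃ Φ : ℝ → ℝ, ContDiff ℝ 1 Φ ∧ EqOn Φ φ (Ici 0) ∧ EqOn (deriv Φ) (deriv φ) (Ioi 0) := by
  have hd : ContinuousOn (derivWithin φ (Ici 0)) (Ici 0) :=
    hφ.continuousOn_derivWithin (uniqueDiffOn_Ici 0) le_rfl
  -- The derivative is frozen at its wall value for `t < 0`; its primitive is the extension.
  have hc : Continuous fun t : ℝ => derivWithin φ (Ici 0) (max t 0) :=
    hd.comp_continuous (by fun_prop) fun t => le_max_right t 0
  have hd' : ∀ x, HasDerivAt (fun x => φ 0 + ∫ t in (0 : ℝ)..x, derivWithin φ (Ici 0) (max t 0))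
      (derivWithin φ (Ici 0) (max x 0)) x := fun x =>
    (intervalIntegral.integral_hasDerivAt_right (hc.intervalIntegrable _ _)
      (hc.stronglyMeasurableAtFilter _ _) hc.continuousAt).const_add _
  have heq : EqOn (fun x => φ 0 + ∫ t in (0 : ℝ)..x, derivWithin φ (Ici 0) (max t 0)) φ
      (Ici 0) := by
    intro x hx
    have h1 : ∫ t in (0 : ℝ)..x, derivWithin φ (Ici 0) (max t 0) = φ x - φ 0 := by
      refine intervalIntegral.integral_eq_sub_of_hasDerivAt_of_le hx
        (hφ.continuousOn.mono Icc_subset_Ici_self) (fun t ht => ?_) (hc.intervalIntegrable _ _)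
      rw [max_eq_left ht.1.le]
      exact (hφ.differentiableOn one_ne_zero t (mem_Ici.2 ht.1.le)).hasDerivWithinAt.hasDerivAt
        (Ici_mem_nhds ht.1)
    dsimp only
    rw [h1]
    ring
  refine ⟨_, ?_, heq, fun x hx => ?_⟩
  · rw [contDiff_one_iff_deriv]
    refine ⟨fun x => (hd' x).differentiableAt, ?_⟩
    rw [show deriv _ = _ from funext fun x => (hd' x).deriv]
    exact hc
  · refine Filter.EventuallyEq.deriv_eq ?_
    filter_upwards [Ioi_mem_nhds hx] with y hy using heq (mem_Ici.2 (le_of_lt hy))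

theorem monotoneOn_or_antitoneOn_of_derivWithin (hφ : ContDiffOn ℝ 1 φ (Ici 0))
    (h : (∀ x : ℝ, 0 ≤ x → 0 < derivWithin φ (Ici 0) x) ∨
      (∀ x : ℝ, 0 ≤ x → derivWithin φ (Ici 0) x < 0)) :
    MonotoneOn φ (Ici 0) ∨ AntitoneOn φ (Ici 0) := by
  have hd := (hφ.differentiableOn one_ne_zero).mono interior_subset
  have e : ∀ x ∈ interior (Ici (0 : ℝ)), deriv φ x = derivWithin φ (Ici 0) x := fun x hx =>
    (derivWithin_of_mem_nhds (mem_interior_iff_mem_nhds.1 hx)).symm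
  refine h.imp (fun h => ?_) fun h => ?_
  · exact monotoneOn_of_deriv_nonneg (convex_Ici 0) hφ.continuousOn hd fun x hx => by
      rw [e x hx]; exact (h x (interior_subset hx)).le
  · exact antitoneOn_of_deriv_nonpos (convex_Ici 0) hφ.continuousOn hd fun x hx => by
      rw [e x hx]; exact (h x (interior_subset hx)).le

theorem IsVPSolution.monotoneOn {ne : ℝ → ℝ} {φb : ℝ} {fb finf : Vel → ℝ} {f : ℝ × Vel → ℝ}
    (hS : IsVPSolution ne α φb fb finf f φ) : MonotoneOn φ (Ici 0) ∨ AntitoneOn φ (Ici 0) :=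
  monotoneOn_or_antitoneOn_of_derivWithin hS.contDiff_one hS.monotone

theorem IsVPSolution.abs_le {ne : ℝ → ℝ} {φb : ℝ} {fb finf : Vel → ℝ} {f : ℝ × Vel → ℝ}
    (hS : IsVPSolution ne α φb fb finf f φ) {x : ℝ} (hx : 0 ≤ x) : |φ x| ≤ |φb| :=
  abs_le_abs_of_monotoneOn hS.boundary hS.tendsto_zero hS.monotoneOn hx

/-! ### The distribution is determined by the potential -/

theorem eLpNorm_sub_sub_le {A B A' B' : Vel → ℝ} (hA : Integrable A) (hB : Integrable B)
    (hA' : Integrable A') (hB' : Integrable B') :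
    eLpNorm (fun ξ => A ξ - B ξ - (A' ξ - B' ξ)) 1 volume
      ≤ eLpNorm (fun ξ => A ξ - A' ξ) 1 volume + eLpNorm (fun ξ => B ξ - B' ξ) 1 volume := by
  refine le_trans (le_of_eq ?_) (eLpNorm_sub_le (hA.sub hA').aestronglyMeasurable
    (hB.sub hB').aestronglyMeasurable (le_refl (1 : ℝ≥0∞)))
  congr 1
  ext ξ
  simp only [Pi.sub_apply]
  ring

theorem IsSmall.two_mul_abs_zero_lt (h : IsSmall η vb vinf r ε) : 2 * |(0 : ℝ)| < r ^ 2 := by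
  rw [abs_zero, mul_zero]
  exact pow_pos h.pos 2

theorem integrable_ginf (h : IsSmall η vb vinf r ε) : Integrable (ginf η α mb minf vb vinf ε) :=
  (integrable_ionDistribution h h.two_mul_abs_zero_lt).congr
    (ae_of_all _ (ionDistribution_zero h))

/-- At zero potential `ionDistribution` is `ginf`, so its `L¹` continuity in the potential shows
that both terms have the same limit at infinity. -/
theorem IsVPSolution.isDecayingCurve_sub {ne : ℝ → ℝ} {φb : ℝ} {f : ℝ × Vel → ℝ}
    {Φ : ℝ → ℝ} {fb : Vel → ℝ} (h : IsSmall η vb vinf r ε)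
    (hS : IsVPSolution ne α φb fb (ginf η α mb minf vb vinf ε) f φ)
    (hΦ : Continuous Φ) (hsm : ∀ x, 0 ≤ x → 2 * |Φ x| < r ^ 2) (hlim : Tendsto Φ atTop (𝓝 0)) :
    IsDecayingCurve fun p => f p - ionDistribution η α mb minf vb vinf ε (Φ p.1) p.2 := by
  have hF : ∀ x, 0 ≤ x → Integrable fun ξ => ionDistribution η α mb minf vb vinf ε (Φ x) ξ :=
    fun x hx => integrable_ionDistribution h (hsm x hx)
  have hFl : LocallyIntegrable fun p : ℝ × Vel =>
      ionDistribution η α mb minf vb vinf ε (Φ p.1) p.2 :=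
    locallyIntegrable_ionDistribution h hΦ.measurable
  refine ⟨hS.locallyIntegrable.sub (hFl.locallyIntegrableOn _),
    fun x hx => (hS.integrable_slice x hx).sub (hF x hx), fun x₀ hx₀ => ?_, ?_⟩
  · have h1 := tendsto_eLpNorm_ionDistribution (α := α) (mb := mb) (minf := minf) h
      (hsm x₀ hx₀) (hΦ.continuousWithinAt (s := Ici 0) (x := x₀))
    have h2 := (hS.continuous_slice x₀ hx₀).add h1
    rw [add_zero] at h2
    refine tendsto_of_tendsto_of_tendsto_of_le_of_le' tendsto_const_nhds h2
      (Eventually.of_forall fun _ => zero_le) ?_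
    filter_upwards [self_mem_nhdsWithin] with x hx
    exact eLpNorm_sub_sub_le (hS.integrable_slice x hx) (hF x hx)
      (hS.integrable_slice x₀ hx₀) (hF x₀ hx₀)
  · have h1 := tendsto_eLpNorm_ionDistribution (α := α) (mb := mb) (minf := minf) h
      h.two_mul_abs_zero_lt hlim
    simp only [ionDistribution_zero h] at h1
    have h2 := hS.tendsto_finf.add h1
    rw [add_zero] at h2
    refine tendsto_of_tendsto_of_tendsto_of_le_of_le' tendsto_const_nhds h2
      (Eventually.of_forall fun _ => zero_le) ?_
    filter_upwards [eventually_ge_atTop 0] with x hx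
    refine le_trans (le_of_eq ?_) (eLpNorm_sub_sub_le (hS.integrable_slice x hx)
      (hF x hx) (integrable_ginf h) (integrable_ginf h))
    congr 1
    ext ξ
    ring

/-- Both distributions satisfy the weak equation with the same injected datum, so the boundary
integrals cancel and a homogeneous problem is left. -/
theorem IsVPSolution.setIntegral_sub_transport {ne : ℝ → ℝ} {φb : ℝ} {f : ℝ × Vel → ℝ}
    {Φ : ℝ → ℝ} {finf : Vel → ℝ} (h : IsSmall η vb vinf r ε) (hb : 2 * |φb| < r ^ 2)
    (hS : IsVPSolution ne α φb (gb η mb vb φb ε) finf f φ)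
    (hΦ : ContDiff ℝ 1 Φ) (hb' : ∀ x, 0 ≤ x → |Φ x| ≤ |φb|) (h0 : Φ 0 = φb)
    (hderiv : EqOn (deriv Φ) (deriv φ) (Ioi 0)) (hψ : IsTest α ψ) :
    ∫ p in Ioi (0 : ℝ) ×ˢ (univ : Set Vel),
      (f p - ionDistribution η α mb minf vb vinf ε (Φ p.1) p.2) * transport (deriv Φ) ψ p = 0 := by
  have hTc := continuous_transport (hΦ.continuous_deriv le_rfl) hψ.contDiff
  have hTs := hasCompactSupport_transport (deriv Φ) hψ.compactSupport
  have w1 := hS.weak ψ hψ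
  have w2 := ionDistribution_weak (mb := mb) (minf := minf) h hb hΦ hb' hψ
  have e1 : ∫ p in Ioi (0 : ℝ) ×ˢ (univ : Set Vel),
        f p * (p.2.1 * dx ψ p + deriv φ p.1 * dxi ψ p)
      = ∫ p in Ioi (0 : ℝ) ×ˢ (univ : Set Vel), f p * transport (deriv Φ) ψ p := by
    refine setIntegral_congr_fun (measurableSet_Ioi.prod MeasurableSet.univ) fun p hp => ?_
    rw [transport, hderiv hp.1]
  have i2 := integrableOn_mul_of_hasCompactSupport
    ((locallyIntegrable_ionDistribution (α := α) (mb := mb) (minf := minf) h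
      hΦ.continuous.measurable).locallyIntegrableOn _) hTc hTs
  simp only [sub_mul]
  rw [integral_sub (integrableOn_mul_of_hasCompactSupport hS.locallyIntegrable hTc hTs) i2]
  rw [h0] at w2
  rw [e1] at w1
  linarith

/-- The linear uniqueness theorem is applied in the potential of the given solution itself, extended
to the line. This decouples the distribution from the question which potential occurs. -/
theorem IsVPSolution.ae_eq_ionDistribution {ne : ℝ → ℝ} {φb : ℝ} {f : ℝ × Vel → ℝ}
    (h : IsSmall η vb vinf r ε) (hα1 : α < 1) (hb : 2 * |φb| < r ^ 2)
    (hS : IsVPSolution ne α φb (gb η mb vb φb ε) (ginf η α mb minf vb vinf ε) f φ)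
    {x : ℝ} (hx : 0 ≤ x) :
    ∀ᵐ ξ : Vel, f (x, ξ) = ionDistribution η α mb minf vb vinf ε (φ x) ξ := by
  obtain ⟨Φ, hΦ, heq, hderiv⟩ := exists_contDiff_one_extension hS.contDiff_one
  have hb' : ∀ x, 0 ≤ x → |Φ x| ≤ |φb| := fun x hx => by
    rw [heq hx]; exact hS.abs_le hx
  have hlim : Tendsto Φ atTop (𝓝 0) := by
    refine hS.tendsto_zero.congr' ?_
    filter_upwards [eventually_ge_atTop 0] with x hx using (heq hx).symm
  have hmono : MonotoneOn Φ (Ici 0) ∨ AntitoneOn Φ (Ici 0) :=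
    hS.monotoneOn.imp (fun h => h.congr heq.symm) fun h => h.congr heq.symm
  have h0 : Φ 0 = φb := (heq self_mem_Ici).trans hS.boundary
  have hcurve := hS.isDecayingCurve_sub h hΦ.continuous
    (fun x hx => by linarith [hb' x hx]) hlim
  have key := ae_eq_zero_of_homogeneous hΦ hb' hlim hmono hα1 hcurve
    (fun ψ hψ => hS.setIntegral_sub_transport h hb hΦ hb' h0 hderiv hψ) (fun x hx => by
    filter_upwards [hS.nonneg x hx.le] with ξ hξ hlt
    rw [ionDistribution_eq_zero h hlt, sub_zero]
    exact hξ) x hx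
  filter_upwards [key] with ξ hξ
  rw [← heq hx]
  exact sub_eq_zero.1 hξ

end Sheath

namespace Sheath

/-! ### Solutions of the two problems -/

variable {ne φ : ℝ → ℝ} {η : Vel → ℝ} {α mb minf vb vinf r ε δ φb : ℝ}

theorem isVPSolution_ionDistribution (h : IsSmall η vb vinf r ε) (hα : 0 ≤ α) (hmb : 0 ≤ mb)
    (hminf : 0 ≤ minf) (hδ : 2 * δ < r ^ 2) (hφ : ContDiff ℝ 2 φ)
    (hb : ∀ x, 0 ≤ x → |φ x| ≤ δ) (hsign : (∀ x, 0 < deriv φ x) ∨ ∀ x, deriv φ x < 0)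
    (hode : ∀ x, 0 ≤ x →
      iteratedDeriv 2 φ x = smoothDensity η α mb minf vb vinf ε (φ x) - ne (φ x))
    (h0 : φ 0 = φb) (hlim : Tendsto φ atTop (𝓝 0)) :
    IsVPSolution ne α φb (gb η mb vb φb ε) (ginf η α mb minf vb vinf ε)
      (fun p => ionDistribution η α mb minf vb vinf ε (φ p.1) p.2) φ := by
  have hsm : ∀ x, 0 ≤ x → 2 * |φ x| < r ^ 2 := fun x hx => by linarith [hb x hx]
  have h1 : ContDiff ℝ 1 φ := hφ.of_le (by norm_num)
  have hd : ∀ x : ℝ, 0 ≤ x → derivWithin φ (Ici 0) x = deriv φ x := fun x hx =>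
    (h1.differentiable one_ne_zero x).derivWithin (uniqueDiffOn_Ici 0 x hx)
  have hint : ∀ x, 0 ≤ x → Integrable fun ξ => ionDistribution η α mb minf vb vinf ε (φ x) ξ :=
    fun x hx => integrable_ionDistribution h (hsm x hx)
  have hnn : ∀ x ξ, 0 ≤ ionDistribution η α mb minf vb vinf ε (φ x) ξ := fun x ξ =>
    ionDistribution_nonneg h hα hmb hminf (φ x) ξ
  have hloc : LocallyIntegrable fun p : ℝ × Vel =>
      ionDistribution η α mb minf vb vinf ε (φ p.1) p.2 :=
    locallyIntegrable_ionDistribution h hφ.continuous.measurable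
  have hcont : ∀ x₀, 0 ≤ x₀ → Tendsto (fun x => eLpNorm (fun ξ =>
      ionDistribution η α mb minf vb vinf ε (φ x) ξ
        - ionDistribution η α mb minf vb vinf ε (φ x₀) ξ) 1 volume) (𝓝[Ici 0] x₀) (𝓝 0) :=
    fun x₀ hx₀ => tendsto_eLpNorm_ionDistribution h (hsm x₀ hx₀)
      hφ.continuous.continuousWithinAt
  refine ⟨hloc.locallyIntegrableOn _, hint, hcont, h1.contDiffOn,
    hφ.contDiffOn, fun x _ => ae_of_all _ (hnn x),
    ?_, fun ψ hψ => ?_, ?_, fun x hx => ?_, h0, hlim⟩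
  · exact hsign.imp (fun h x hx => by rw [hd x hx]; exact h x)
      fun h x hx => by rw [hd x hx]; exact h x
  · rw [← h0]
    exact ionDistribution_weak h hδ h1 hb hψ
  · have := tendsto_eLpNorm_ionDistribution (α := α) (mb := mb) (minf := minf) h
      h.two_mul_abs_zero_lt hlim
    simpa only [ionDistribution_zero h] using this
  · dsimp only
    rw [integral_ionDistribution h (hsm x hx.le)]
    exact hode x hx.le

theorem density_ionDistribution (h : IsSmall η vb vinf r ε) {x : ℝ} (hs : 2 * |φ x| < r ^ 2) :
    density (fun p => ionDistribution η α mb minf vb vinf ε (φ p.1) p.2) x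
      = smoothDensity η α mb minf vb vinf ε (φ x) := by
  rw [← integral_ionDistribution h hs]
  rfl

/-- The comparison estimate with equal right-hand sides, that is with `κ = 0`. -/
theorem eqOn_of_ode {φ₁ φ₂ h : ℝ → ℝ} {c : ℝ} (hc : 0 < c)
    (hmono : ∀ s t, |s| ≤ δ → |t| ≤ δ → t ≤ s → c * (s - t) ≤ h s - h t)
    (hc₁ : ContinuousOn φ₁ (Ici 0)) (hc₂ : ContinuousOn φ₂ (Ici 0))
    (hd₁ : ContDiffOn ℝ 2 φ₁ (Ioi 0)) (hd₂ : ContDiffOn ℝ 2 φ₂ (Ioi 0))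
    (hb₁ : ∀ x, 0 ≤ x → |φ₁ x| ≤ δ) (hb₂ : ∀ x, 0 ≤ x → |φ₂ x| ≤ δ)
    (he₁ : ∀ x, 0 < x → iteratedDeriv 2 φ₁ x = h (φ₁ x))
    (he₂ : ∀ x, 0 < x → iteratedDeriv 2 φ₂ x = h (φ₂ x))
    (h0 : φ₁ 0 = φ₂ 0) (hl₁ : Tendsto φ₁ atTop (𝓝 0)) (hl₂ : Tendsto φ₂ atTop (𝓝 0)) :
    EqOn φ₁ φ₂ (Ici 0) := by
  intro x hx
  have h1 := abs_sub_le_of_ode hc le_rfl hmono (fun s _ => by simp) hc₁ hc₂ hd₁ hd₂ hb₁ hb₂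
    he₁ he₂ h0 hl₁ hl₂ x hx
  rw [zero_div] at h1
  exact sub_eq_zero.1 (abs_eq_zero.1 (le_antisymm h1 (abs_nonneg _)))

theorem exists_lipschitz_ionDensity (α mb minf : ℝ) (hvb : 0 < vb) (hvinf : 0 < vinf) :
    ∃ ρ K : ℝ, 0 < ρ ∧ 0 ≤ K ∧ ∀ s t : ℝ, |s| < ρ → |t| < ρ →
      |ionDensity α mb minf vb vinf s - ionDensity α mb minf vb vinf t| ≤ K * |s - t| := by
  have h1 : ContDiffAt ℝ 1 (ionDensity α mb minf vb vinf) 0 := by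
    have h2 := (contDiffAt_beamDensity α mb minf hvb hvinf).comp (0 : ℝ)
      (f := fun s : ℝ => ((0 : ℝ), s)) (by fun_prop)
    refine h2.congr_of_eventuallyEq (Eventually.of_forall fun s => ?_)
    exact (beamDensity_zero_left α mb minf vb vinf s).symm
  obtain ⟨K, T, hT, hK⟩ := h1.exists_lipschitzOnWith
  obtain ⟨ρ, hρ, hsub⟩ := Metric.mem_nhds_iff.1 hT
  refine ⟨ρ, K, hρ, K.2, fun s t hs ht => ?_⟩
  have := hK.dist_le_mul s (hsub (by simpa using hs)) t (hsub (by simpa using ht))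
  simpa only [Real.dist_eq] using this

theorem IsReducedSolution.abs_le (hS : IsReducedSolution ne α mb minf vb vinf φb φ) {x : ℝ}
    (hx : 0 ≤ x) : |φ x| ≤ |φb| :=
  abs_le_abs_of_monotoneOn hS.boundary hS.tendsto_zero hS.monotone hx

/-- Without injected ions the reduced solution solves the hydrodynamic model with reflection. -/
theorem IsReducedSolution.isHydroSolution (hS : IsReducedSolution ne α 0 minf vb vinf φb φ)
    (hα : α ∈ Icc (0 : ℝ) 1) (hα1 : α ≠ 1) (hvinf : 0 < vinf) (hmass : (1 + α) * minf = 1) :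
    IsHydroSolution ne α vinf φb (limDensity α 0 minf vb vinf φ)
      (limVel α 0 minf vb vinf φ) φ := by
  have hα0 : α + 1 ≠ 0 := by linarith [hα.1]
  have hα2 : α - 1 ≠ 0 := sub_ne_zero.2 hα1
  have hminf : minf = 1 / (α + 1) := by
    rw [eq_div_iff hα0]; linarith
  have hρ : ∀ x, limDensity α 0 minf vb vinf φ x = vinf / √(vinf ^ 2 + 2 * φ x) := fun x => by
    simp only [limDensity, ionDensity, hmass]
    simp
  -- With a single beam `u` is proportional to the ion speed, so `u u'` is `((α - 1) / (α + 1))²`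
  -- times `φ'`.
  have hu : ∀ x, limVel α 0 minf vb vinf φ x
      = (α - 1) / (α + 1) * √(vinf ^ 2 + 2 * φ x) := fun x => by
    rw [limVel, hρ, hminf, div_div_eq_mul_div]
    field_simp
    ring
  have hpos : ∀ x, 0 < x → 0 < vinf ^ 2 + 2 * φ x := fun x hx => (hS.domain x hx.le).2
  have hφd : ∀ x, 0 < x → HasDerivAt φ (deriv φ x) x := fun x hx =>
    ((hS.contDiff.contDiffAt (Ici_mem_nhds hx)).differentiableAt (by simp)).hasDerivAt
  have hsq : ∀ x, 0 < x → HasDerivAt (fun y => √(vinf ^ 2 + 2 * φ y))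
      (deriv φ x / √(vinf ^ 2 + 2 * φ x)) x := fun x hx => by
    refine ((((hφd x hx).const_mul 2).const_add (vinf ^ 2)).sqrt (hpos x hx).ne').congr_deriv ?_
    rw [mul_div_mul_left _ _ two_ne_zero]
  have hne : ∀ x, 0 < x → √(vinf ^ 2 + 2 * φ x) ≠ 0 := fun x hx =>
    (Real.sqrt_pos.2 (hpos x hx)).ne'
  have hρf : limDensity α 0 minf vb vinf φ = fun x => vinf / √(vinf ^ 2 + 2 * φ x) := funext hρ
  have huf : limVel α 0 minf vb vinf φ = fun x => (α - 1) / (α + 1) * √(vinf ^ 2 + 2 * φ x) :=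
    funext hu
  have hlim : Tendsto (fun x => √(vinf ^ 2 + 2 * φ x)) atTop (𝓝 vinf) := by
    have h1 : Tendsto (fun x => √(vinf ^ 2 + 2 * φ x)) atTop (𝓝 (√(vinf ^ 2 + 2 * 0))) :=
      ((hS.tendsto_zero.const_mul 2).const_add (vinf ^ 2)).sqrt
    rwa [mul_zero, add_zero, Real.sqrt_sq hvinf.le] at h1
  refine ⟨fun x hx => ?_, fun x hx => ?_, hS.contDiff.mono Ioi_subset_Ici_self,
    hS.contDiff.continuousOn, fun x hx => ?_, fun x hx => ?_, hS.equation, ?_, ?_, ?_,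
    hS.tendsto_zero, hS.boundary⟩
  · rw [hρf]
    exact (differentiableAt_const _).fun_div (hsq x hx).differentiableAt (hne x hx)
  · rw [huf]
    exact ((hsq x hx).const_mul _).differentiableAt
  · have h1 : (fun y => limDensity α 0 minf vb vinf φ y * limVel α 0 minf vb vinf φ y)
        =ᶠ[𝓝 x] fun _ => vinf * ((α - 1) / (α + 1)) := by
      filter_upwards [Ioi_mem_nhds hx] with y hy
      have := hne y hy
      rw [hρ, hu]
      field_simp
    rw [h1.deriv_eq, deriv_const]
  · rw [huf, ((hsq x hx).const_mul _).deriv]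
    have := hne x hx
    field_simp
  · have hp : 0 < vinf ^ 2 + 2 * |φb| := by positivity
    refine ⟨vinf / √(vinf ^ 2 + 2 * |φb|), div_pos hvinf (Real.sqrt_pos.2 hp), fun x hx => ?_⟩
    rw [hρ]
    refine div_le_div_of_nonneg_left hvinf.le (Real.sqrt_pos.2 (hpos x hx)) (Real.sqrt_le_sqrt ?_)
    linarith [le_abs_self (φ x), hS.abs_le hx.le]
  · rw [hρf]
    have := (tendsto_const_nhds (x := vinf)).div hlim hvinf.ne'
    rwa [div_self hvinf.ne'] at this
  · rw [huf]
    exact hlim.const_mul _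

theorem supDist_le {a b : ℝ → ℝ} {C : ℝ} (h : ∀ x, 0 < x → |a x - b x| ≤ C) :
    supDist a b ≤ ENNReal.ofReal C :=
  iSup₂_le fun x hx => ENNReal.ofReal_le_ofReal (h x hx)

end Sheath

/-! ### Assembly: choice of constants, existence, uniqueness and error estimate. -/

theorem theorem2p5 (ne : ℝ → ℝ) (hne : ContDiff ℝ 2 ne) (hne0 : ne 0 = 1)
    (hne1 : deriv ne 0 = -1) (η : Sheath.Vel → ℝ) (hη : Sheath.IsMollifier η)
    (α mb minf vb vinf : ℝ) (hα : α ∈ Set.Icc (0 : ℝ) 1) (hα1 : α ≠ 1)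
    (hmb : 0 ≤ mb) (hminf : 0 < minf) (hvb : 0 < vb) (hvinf : 0 < vinf)
    (hmass : mb + (1 + α) * minf = 1)
    (hbohm : mb * (vb ^ 2)⁻¹ + (1 + α) * minf * (vinf ^ 2)⁻¹ < 1) :
    ∃ ε₀ : ℝ, 0 < ε₀ ∧ ∃ δ₀ : ℝ, 0 < δ₀ ∧ ∃ C₀ : ℝ, 0 < C₀ ∧
      ∀ φb : ℝ, φb ≠ 0 → |φb| < δ₀ →
        ∃ φ : ℝ → ℝ,
          -- the reduced problem has exactly one monotone solution
          Sheath.IsReducedSolution ne α mb minf vb vinf φb φ ∧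
          (∀ φ' : ℝ → ℝ, Sheath.IsReducedSolution ne α mb minf vb vinf φb φ' →
            Set.EqOn φ' φ (Set.Ici 0)) ∧
          (∀ ε : ℝ, 0 < ε → ε < ε₀ →
            -- the Vlasov-Poisson problem has exactly one solution
            ∃ (fε : ℝ × Sheath.Vel → ℝ) (φε : ℝ → ℝ),
              Sheath.IsVPSolution ne α φb (Sheath.gb η mb vb φb ε)
                (Sheath.ginf η α mb minf vb vinf ε) fε φε ∧
              (∀ (f' : ℝ × Sheath.Vel → ℝ) (φ' : ℝ → ℝ),
                Sheath.IsVPSolution ne α φb (Sheath.gb η mb vb φb ε)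
                  (Sheath.ginf η α mb minf vb vinf ε) f' φ' →
                (∀ x : ℝ, 0 ≤ x → ∀ᵐ ξ : Sheath.Vel, f' (x, ξ) = fε (x, ξ)) ∧
                Set.EqOn φ' φε (Set.Ici 0)) ∧
              -- its moments are well defined
              (∀ x : ℝ, 0 < x → 0 < Sheath.density fε x ∧
                Integrable fun ξ : Sheath.Vel => ξ.1 * fε (x, ξ)) ∧
              -- the error estimate
              Sheath.supDist (Sheath.density fε) (Sheath.limDensity α mb minf vb vinf φ)
                + Sheath.supDist (fun x => Sheath.density fε x * Sheath.meanVel fε x)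
                    (fun x => Sheath.limDensity α mb minf vb vinf φ x *
                      Sheath.limVel α mb minf vb vinf φ x)
                + Sheath.supDist φε φ ≤ ENNReal.ofReal (C₀ * ε)) ∧
          -- without injected ions the limit is the hydrodynamic model with reflection
          (mb = 0 → Sheath.IsHydroSolution ne α vinf φb
            (Sheath.limDensity α mb minf vb vinf φ) (Sheath.limVel α mb minf vb vinf φ) φ) := by
  obtain ⟨r₁, c, C, hr₁, hc, hC, hconst⟩ :=
    Sheath.exists_density_constants hne hne1 hvb hvinf hmass hbohm
  obtain ⟨r₂, K, hr₂, hK, hlip⟩ := Sheath.exists_lipschitz_ionDensity α mb minf hvb hvinf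
  -- Half of the slower beam speed: for `ε < r` all profiles are supported in `{ξ₁ > r}`.
  obtain ⟨r, hr, hrb, hrinf⟩ : ∃ r : ℝ, 0 < r ∧ 2 * r ≤ vb ∧ 2 * r ≤ vinf :=
    ⟨min vb vinf / 2, by positivity, by linarith [min_le_left vb vinf],
      by linarith [min_le_right vb vinf]⟩
  -- The bound `r² / 2` on `|φ_b|` keeps all beams untrapped. In `C₀`, `C + K (C / c)` comes from
  -- the density, `1` from the current and `C / c` from the potential.
  refine ⟨min r₁ r, lt_min hr₁ hr, min (min r₁ r₂) (r ^ 2 / 2), by positivity,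
    C + K * (C / c) + 1 + C / c, by positivity, fun φb hφb hφbδ => ?_⟩
  rw [lt_min_iff, lt_min_iff] at hφbδ
  obtain ⟨⟨hφ₁, hφ₂⟩, hφ₃⟩ := hφbδ
  have hδ : 2 * |φb| < r ^ 2 := by linarith
  have hφb0 : 0 < |φb| := abs_pos.2 hφb
  have hdom : ∀ s : ℝ, |s| ≤ |φb| → 0 < vb ^ 2 + 2 * s ∧ 0 < vinf ^ 2 + 2 * s := fun s hs => by
    have := neg_abs_le s
    constructor <;> nlinarith
  have hmono₀ : ∀ s t : ℝ, |s| ≤ |φb| → |t| ≤ |φb| → t ≤ s →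
      c * (s - t) ≤ (Sheath.ionDensity α mb minf vb vinf s - ne s)
        - (Sheath.ionDensity α mb minf vb vinf t - ne t) ∧
      (Sheath.ionDensity α mb minf vb vinf s - ne s)
        - (Sheath.ionDensity α mb minf vb vinf t - ne t) ≤ C * (s - t) := fun s t hs ht hts => by
    have := (hconst 0 s (by simpa using hr₁) (hs.trans_lt hφ₁)).2.2 t (ht.trans_lt hφ₁) hts
    simpa only [Sheath.beamDensity_zero_left] using this
  have hion0 : Sheath.ionDensity α mb minf vb vinf 0 = 1 := by
    rw [← Sheath.beamDensity_zero_left]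
    exact Sheath.beamDensity_zero_right (by linarith) (by linarith) hmass
  obtain ⟨φ, hφc, hφode, hφ0, hφlim, hφsign, hφle⟩ := Sheath.exists_decaying_solution_of_local
    (h := fun s => Sheath.ionDensity α mb minf vb vinf s - ne s) hφb0 hc
    (by simp only [hion0, hne0, sub_self]) hmono₀ hφb le_rfl
  have hred : Sheath.IsReducedSolution ne α mb minf vb vinf φb φ :=
    ⟨hφc.contDiffOn, hφsign.imp (fun h => (strictMono_of_deriv_pos h).monotone.monotoneOn _)
      fun h => (strictAnti_of_deriv_neg h).antitone.antitoneOn _,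
      fun x hx => hdom _ (hφle x hx), fun x hx => hφode x hx.le, hφ0, hφlim⟩
  refine ⟨φ, hred, fun φ' hφ' => ?_, fun ε hε hεlt => ?_, fun hmb0 => ?_⟩
  · exact Sheath.eqOn_of_ode (h := fun s => Sheath.ionDensity α mb minf vb vinf s - ne s) hc
      (fun s t hs ht hts => (hmono₀ s t hs ht hts).1) hφ'.contDiff.continuousOn
      hφc.continuous.continuousOn (hφ'.contDiff.mono Ioi_subset_Ici_self) hφc.contDiffOn
      (fun x hx => hφ'.abs_le hx) hφle hφ'.equation (fun x hx => hφode x hx.le)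
      (hφ'.boundary.trans hφ0.symm) hφ'.tendsto_zero hφlim
  · rw [lt_min_iff] at hεlt
    obtain ⟨hε₁, hε₂⟩ := hεlt
    have hsmall : Sheath.IsSmall η vb vinf r ε := ⟨hη, hr, hε, by linarith, by linarith⟩
    have hsm : ∀ s : ℝ, |s| ≤ |φb| → 2 * |s| < r ^ 2 := fun s hs => by linarith
    have hmono : ∀ s t : ℝ, |s| ≤ |φb| → |t| ≤ |φb| → t ≤ s →
        c * (s - t) ≤ (Sheath.smoothDensity η α mb minf vb vinf ε s - ne s)
          - (Sheath.smoothDensity η α mb minf vb vinf ε t - ne t) ∧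
        (Sheath.smoothDensity η α mb minf vb vinf ε s - ne s)
          - (Sheath.smoothDensity η α mb minf vb vinf ε t - ne t) ≤ C * (s - t) := by
      intro s t hs ht hts
      -- Only the ion density is averaged, so the increment of `ne` is moved into the bounds.
      have := Sheath.smoothDensity_sub_bounds (α := α) (mb := mb) (minf := minf) hsmall
        (hsm s hs) (hsm t ht) (a := c * (s - t) + (ne s - ne t))
        (b := C * (s - t) + (ne s - ne t)) fun τ hτ => by
          have := (hconst τ s (hτ.trans hε₁) (hs.trans_lt hφ₁)).2.2 t (ht.trans_lt hφ₁) hts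
          constructor <;> linarith
      constructor <;> linarith
    have hdens : ∀ s : ℝ, |s| ≤ |φb| →
        1 / 2 ≤ Sheath.smoothDensity η α mb minf vb vinf ε s ∧
        |Sheath.smoothDensity η α mb minf vb vinf ε s
          - Sheath.ionDensity α mb minf vb vinf s| ≤ C * ε := by
      intro s hs
      have hb : ∀ τ : ℝ, |τ| < ε →
          1 / 2 ≤ Sheath.beamDensity α mb minf vb vinf τ s ∧
          |Sheath.beamDensity α mb minf vb vinf τ s
            - Sheath.ionDensity α mb minf vb vinf s| ≤ C * ε := fun τ hτ => by
        have := hconst τ s (hτ.trans hε₁) (hs.trans_lt hφ₁)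
        exact ⟨this.1, this.2.1.trans (mul_le_mul_of_nonneg_left hτ.le hC.le)⟩
      have h1 := Sheath.smoothDensity_bounds hsmall (hsm s hs)
        (a := Sheath.ionDensity α mb minf vb vinf s - C * ε)
        (b := Sheath.ionDensity α mb minf vb vinf s + C * ε) fun τ hτ => by
          have := abs_le.1 (hb τ hτ).2
          constructor <;> linarith
      have h2 := Sheath.smoothDensity_bounds hsmall (hsm s hs) (a := 1 / 2)
        (b := Sheath.ionDensity α mb minf vb vinf s + C * ε) fun τ hτ => by
          have := abs_le.1 (hb τ hτ).2
          exact ⟨(hb τ hτ).1, by linarith⟩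
      exact ⟨h2.1, abs_le.2 ⟨by linarith, by linarith⟩⟩
    -- At zero potential every perturbed beam density equals `1`, hence so does the average:
    -- quasi-neutrality at infinity is exact for each `ε`.
    have hsmooth0 : Sheath.smoothDensity η α mb minf vb vinf ε 0 = 1 := by
      have := Sheath.smoothDensity_bounds (α := α) (mb := mb) (minf := minf) hsmall
        hsmall.two_mul_abs_zero_lt (a := 1) (b := 1) fun τ hτ => by
          have h1 := abs_lt.1 hτ
          rw [Sheath.beamDensity_zero_right (by linarith) (by linarith) hmass]
          exact ⟨le_rfl, le_rfl⟩
      exact le_antisymm this.2 this.1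
    obtain ⟨φε, hφεc, hφεode, hφε0, hφεlim, hφεsign, hφεle⟩ :=
      Sheath.exists_decaying_solution_of_local
        (h := fun s => Sheath.smoothDensity η α mb minf vb vinf ε s - ne s) hφb0 hc
        (by simp only [hsmooth0, hne0, sub_self]) hmono hφb le_rfl
    -- The right-hand sides differ by at most `C ε` and the slope is at least `c`, so the potentials
    -- differ by at most `C ε / c`.
    have hdist := Sheath.abs_sub_le_of_ode
      (h₁ := fun s => Sheath.smoothDensity η α mb minf vb vinf ε s - ne s)
      (h₂ := fun s => Sheath.ionDensity α mb minf vb vinf s - ne s) (κ := C * ε) hc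
      (by positivity) (fun s t hs ht hts => (hmono s t hs ht hts).1)
      (fun s hs => by simpa only [sub_sub_sub_cancel_right] using (hdens s hs).2)
      hφεc.continuous.continuousOn hφc.continuous.continuousOn hφεc.contDiffOn hφc.contDiffOn
      hφεle hφle (fun x hx => hφεode x hx.le) (fun x hx => hφode x hx.le)
      (hφε0.trans hφ0.symm) hφεlim hφlim
    have hmom : ∀ x : ℝ, 0 < x → Integrable fun ξ : Sheath.Vel =>
        ξ.1 * Sheath.ionDistribution η α mb minf vb vinf ε (φε x) ξ := fun x hx =>
      Sheath.integrable_mul_ionDistribution hsmall (hsm _ (hφεle x hx.le))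
    have hcur : ∀ x : ℝ, 0 < x →
        |(∫ ξ : Sheath.Vel, ξ.1 * Sheath.ionDistribution η α mb minf vb vinf ε (φε x) ξ)
          - (mb * vb + (α - 1) * minf * vinf)| ≤ ε := fun x hx =>
      Sheath.abs_current_sub_le hsmall (hsm _ (hφεle x hx.le)) hα hmb hminf hmass
    have hρ : ∀ x : ℝ, 0 < x → Sheath.density
        (fun p => Sheath.ionDistribution η α mb minf vb vinf ε (φε p.1) p.2) x
        = Sheath.smoothDensity η α mb minf vb vinf ε (φε x) := fun x hx =>
      Sheath.density_ionDistribution hsmall (hsm _ (hφεle x hx.le))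
    refine ⟨fun p => Sheath.ionDistribution η α mb minf vb vinf ε (φε p.1) p.2, φε,
      Sheath.isVPSolution_ionDistribution hsmall hα.1 hmb hminf.le hδ hφεc hφεle hφεsign hφεode
        hφε0 hφεlim, fun f' φ' hS => ?_, fun x hx => ⟨?_, hmom x hx⟩, ?_⟩
    · have hf' := fun (x : ℝ) (hx : 0 ≤ x) =>
        hS.ae_eq_ionDistribution hsmall (lt_of_le_of_ne hα.2 hα1) hδ hx
      -- Since `f'` is the ion distribution of its own potential, its Poisson equation is the same
      -- scalar equation, and uniqueness there identifies the potentials.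
      have heq : EqOn φ' φε (Ici 0) := Sheath.eqOn_of_ode
        (h := fun s => Sheath.smoothDensity η α mb minf vb vinf ε s - ne s) hc
        (fun s t hs ht hts => (hmono s t hs ht hts).1) hS.contDiff_one.continuousOn
        hφεc.continuous.continuousOn hS.contDiff_two hφεc.contDiffOn (fun x hx => hS.abs_le hx)
        hφεle (fun x hx => by
          rw [hS.poisson x hx, integral_congr_ae (hf' x hx.le),
            Sheath.integral_ionDistribution hsmall (hsm _ (hS.abs_le hx.le))])
        (fun x hx => hφεode x hx.le) (hS.boundary.trans hφε0.symm) hS.tendsto_zero hφεlim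
      refine ⟨fun x hx => ?_, heq⟩
      filter_upwards [hf' x hx] with ξ hξ
      rw [hξ, heq hx]
    · rw [hρ x hx]
      linarith [(hdens _ (hφεle x hx.le)).1]
    · have e1 := Sheath.supDist_le (C := C * ε + K * (C * ε / c))
        (a := Sheath.density
          fun p => Sheath.ionDistribution η α mb minf vb vinf ε (φε p.1) p.2)
        (b := Sheath.limDensity α mb minf vb vinf φ) fun x hx => by
          rw [hρ x hx, Sheath.limDensity]
          have h1 := hφεle x hx.le
          have h2 := hφle x hx.le
          have h3 := hlip (φε x) (φ x) (h1.trans_lt hφ₂) (h2.trans_lt hφ₂)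
          have h4 := mul_le_mul_of_nonneg_left (hdist x hx.le) hK
          exact (abs_sub_le _ (Sheath.ionDensity α mb minf vb vinf (φε x)) _).trans
            (add_le_add (hdens _ h1).2 (h3.trans h4))
      have e2 := Sheath.supDist_le (C := ε)
        (a := fun x => Sheath.density
            (fun p => Sheath.ionDistribution η α mb minf vb vinf ε (φε p.1) p.2) x *
          Sheath.meanVel
            (fun p => Sheath.ionDistribution η α mb minf vb vinf ε (φε p.1) p.2) x)
        (b := fun x => Sheath.limDensity α mb minf vb vinf φ x *
          Sheath.limVel α mb minf vb vinf φ x) fun x hx => by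
          have h1 := hφεle x hx.le
          have h2 : Sheath.density
              (fun p => Sheath.ionDistribution η α mb minf vb vinf ε (φε p.1) p.2) x ≠ 0 := by
            rw [hρ x hx]
            linarith [(hdens _ h1).1]
          have h3 : Sheath.limDensity α mb minf vb vinf φ x ≠ 0 := by
            have := (hconst 0 (φ x) (by simpa using hr₁) ((hφle x hx.le).trans_lt hφ₁)).1
            rw [Sheath.beamDensity_zero_left] at this
            rw [Sheath.limDensity]
            linarith
          rw [Sheath.meanVel, Sheath.limVel, ← mul_assoc, mul_one_div_cancel h2, one_mul,
            mul_div_cancel₀ _ h3]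
          exact hcur x hx
      have e3 := Sheath.supDist_le (a := φε) (b := φ) fun x hx => hdist x hx.le
      refine (add_le_add (add_le_add e1 e2) e3).trans (le_of_eq ?_)
      rw [← ENNReal.ofReal_add (by positivity) hε.le,
        ← ENNReal.ofReal_add (by positivity) (by positivity)]
      congr 1
      ring
  · subst hmb0
    exact hred.isHydroSolution hα hα1 hvinf (by linarith)
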